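/- **Setting.** Let $\Omega\subset\mathbb R^3$ be a domain of finite volume and $T=(0,T_0)$, $T_0>0$. Let $\xi_0,\xi_1,\xi_2\in C^\infty(\Omega)$ be non-negative color functions with $\xi_0+\xi_1+\xi_2=1$ (phase $0$ is the wall, phases $1,2$ are the fluids), let $\rho_a,p_a\in\mathbb R$ be constants and let $\sigma_{ab}=\sigma_{ba}\in\mathbb R$ $(a\ne b)$. The *proper tension coefficients* are $\sigma_a=\tfrac12(\sigma_{ab}+\sigma_{ac}-\sigma_{bc})$ for $\{a,b,c\}=\{0,1,2\}$. A *motion* is a smooth path $t\mapsto\gamma_t$, $t\in T$, of volume-preserving diffeomorphisms of $\Omega$. Its velocity $u$ is given by $u(\gamma_t(y),t)=\partial_t\gamma_t(y)$, it carries the color functions, $\xi_a(\gamma_t(y),t)=\xi_a(y)$, and $\rho=\sum_{a=0}^2\rho_a\xi_a$. The same formulas are used for paths of (orientation-preserving) diffeomorphisms of $\Omega$ that need not preserve volume. For such a path put $$\mathcal S_{\rm mul}=\int_T\!\int_\Omega\Big(\tfrac12\rho|u|^2-\sum_{a>b}\sigma_{ab}\sqrt{|\nabla\xi_a||\nabla\xi_b|}\,(\xi_a+\xi_b)+\sum_{a=0}^{2}p_a\xi_a\Big)d^3x\,dt,$$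 $$\mathcal S_{\rm tri}=\int_T\!\int_\Omega\Big(\tfrac12\rho|u|^2-\sum_{a=0}^{2}(\sigma_a|\nabla\xi_a|-p_a\xi_a)\Big)d^3x\,dt,\qquad \mathcal S_{\rm wall}=\int_T\!\int_\Omega\Big(\tfrac12\rho|u|^2-\sum_{a=1}^{2}(\sigma_a|\nabla\xi_a|-p_a\xi_a)\Big)d^3x\,dt .$$ A motion $\gamma$ is *stationary* for $\mathcal S_{\rm wall}$ under volume-preserving deformations if $\frac{d}{ds}\big|_{s=0}\mathcal S_{\rm wall}[\gamma^s]$ exists and is $0$ for every smooth family $\gamma^s$, $|s|<\delta$, of paths of diffeomorphisms of $\Omega$ with $\gamma^0=\gamma$ and $\gamma^s=\gamma$ off a compact subset of $T\times\Omega$, such that $\frac{\partial}{\partial s}\big|_{s=0}\det D\gamma^s_t=0$ everywhere (the variation is tangent to the volume-preserving diffeomorphisms). **Theorem 5.3.** Let $\gamma$ be a motion that leaves the wall fixed, $\xi_0(\gamma_t(y))=\xi_0(y)$, and for which $\rho|u|^2$ and $|\nabla\xi_a|$ $(a=0,1,2)$ are integrable over $T\times\Omega$. 1. (Reduction of the action.)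 $\sigma_{ab}=\sigma_a+\sigma_b$ for $a\neq b$. With $M_{012}(t)$ the intersection of the supports in $\Omega$ of $\xi_0(\cdot,t),\xi_1(\cdot,t),\xi_2(\cdot,t)$, $$\big|\mathcal S_{\rm mul}[\gamma]-\mathcal S_{\rm tri}[\gamma]\big|\le\Big(\sum_{a=0}^2|\sigma_a|\Big)\int_T\int_{M_{012}(t)}\sum_{a=0}^2|\nabla\xi_a|\,d^3x\,dt ,$$ and $\mathcal S_{\rm tri}[\gamma]$ equals $\mathcal S_{\rm wall}[\gamma]$ up to a constant that does not depend on the motion: $$\mathcal S_{\rm tri}[\gamma]=\mathcal S_{\rm wall}[\gamma]-T_0\int_\Omega\big(\sigma_0|\nabla\xi_0|-p_0\xi_0\big)\,d^3x .$$ 2. (Equation of motion.) $\gamma$ is stationary for $\mathcal S_{\rm wall}$ under volume-preserving deformations if and only if there is a pressure $p$, continuous on $T\times\Omega$ and locally Lipschitz in $x$ for each $t$, such that $$\frac{D(\rho u^i)}{Dt}+\partial_i p-\partial_j\overline\tau_{ij}=0\quad(i=1,2,3),\qquad \overline\tau=\sum_{a=1}^2\sigma_a\Big(I-\frac{\nabla\xi_a}{|\nabla\xi_a|}\otimes\frac{\nabla\xi_a}{|\nabla\xi_a|}\Big)|\nabla\xi_a|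 ,$$ where $\frac{D}{Dt}=\partial_t+u^j\partial_j$ and a summand of $\overline\tau$ is $0$ where $\nabla\xi_a=0$. For every $t\in T$ the equation holds (with $p$ and $\overline\tau$ differentiable in $x$) at almost every $x\in\Omega$, and at every $x\in\Omega$ near which $\overline\tau(\cdot,t)$ is $C^1$. -/

import Mathlib

open Set MeasureTheory
open scoped ContDiff

namespace WallFlow

/-- Three dimensional Euclidean space. -/
abbrev E3 : Type := EuclideanSpace ℝ (Fin 3)

/-! ### Diffeomorphisms, motions and variations -/

/-- `f` restricts to a smooth diffeomorphism of the open set `Ω` onto itself (the inverse is smooth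
because the Jacobian does not vanish). -/
structure IsDiffeo (Ω : Set E3) (f : E3 → E3) : Prop where
  bijOn : BijOn f Ω Ω
  smooth : ContDiffOn ℝ ∞ f Ω
  jacobian_pos : ∀ y ∈ Ω, 0 < (fderiv ℝ f y).det

/-- `γ : t ↦ γ t` is a smooth path, parametrised by the time interval `(0, T₀)`, of
volume-preserving diffeomorphisms of `Ω`: `γ t y` is the position at time `t` of the fluid particle
with label `y`. -/
structure IsMotion (Ω : Set E3) (T₀ : ℝ) (γ : ℝ → E3 → E3) : Prop where
  smooth : ContDiffOn ℝ ∞ (fun z : ℝ × E3 => γ z.1 z.2) (Ioo 0 T₀ ×ˢ Ω)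
  diffeo : ∀ t ∈ Ioo 0 T₀, IsDiffeo Ω (γ t)
  jacobian_eq_one : ∀ t ∈ Ioo 0 T₀, ∀ y ∈ Ω, (fderiv ℝ (γ t) y).det = 1

/-- `Γ` is an admissible variation of the motion `γ`: a smooth curve `s ↦ Γ s`, `|s| < δ`, of paths
of diffeomorphisms of `Ω`, which passes through `γ` at `s = 0`, differs from `γ` only inside a
compact subset of `(0, T₀) × Ω`, and is tangent at `s = 0` to the volume-preserving
diffeomorphisms, i.e. the Jacobian `det D(Γ s t)` is stationary at `s = 0`. In particular every
such curve that consists of volume-preserving diffeomorphisms is admissible. -/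
structure IsVariation (Ω : Set E3) (T₀ : ℝ) (γ : ℝ → E3 → E3) (Γ : ℝ → ℝ → E3 → E3)
    (δ : ℝ) : Prop where
  pos : 0 < δ
  smooth : ContDiffOn ℝ ∞ (fun z : ℝ × ℝ × E3 => Γ z.1 z.2.1 z.2.2)
    (Ioo (-δ) δ ×ˢ (Ioo 0 T₀ ×ˢ Ω))
  diffeo : ∀ s ∈ Ioo (-δ) δ, ∀ t ∈ Ioo 0 T₀, IsDiffeo Ω (Γ s t)
  start : ∀ t ∈ Ioo 0 T₀, ∀ y ∈ Ω, Γ 0 t y = γ t y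
  compactSupport : ∃ K : Set (ℝ × E3), IsCompact K ∧ K ⊆ Ioo 0 T₀ ×ˢ Ω ∧
    ∀ s ∈ Ioo (-δ) δ, ∀ t ∈ Ioo 0 T₀, ∀ y ∈ Ω, (t, y) ∉ K → Γ s t y = γ t y
  tangent : ∀ t ∈ Ioo 0 T₀, ∀ y ∈ Ω,
    HasDerivAt (fun s => (fderiv ℝ (Γ s t) y).det) 0 0

/-- A functional `S` of motions is stationary at `γ` under volume-preserving deformations:
its differential at `γ` vanishes on the tangent space of the volume-preserving motions. -/
def IsStationary (Ω : Set E3) (T₀ : ℝ) (S : (ℝ → E3 → E3) → ℝ) (γ : ℝ → E3 → E3) : Prop :=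
  ∀ (Γ : ℝ → ℝ → E3 → E3) (δ : ℝ), IsVariation Ω T₀ γ Γ δ →
    HasDerivAt (fun s => S (Γ s)) 0 0

/-! ### The Eulerian fields of a motion -/

noncomputable section

/-- The label `(γ t)⁻¹ x` of the particle that is at `x ∈ Ω` at time `t`. -/
def label (Ω : Set E3) (γ : ℝ → E3 → E3) (t : ℝ) (x : E3) : E3 :=
  Function.invFunOn (γ t) Ω x

/-- The Eulerian velocity field, `u(t, γ t y) = ∂ₜ γ t y`. -/
def velocity (Ω : Set E3) (γ : ℝ → E3 → E3) (t : ℝ) (x : E3) : E3 :=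
  deriv (fun s => γ s (label Ω γ t x)) t

/-- The field obtained when the motion carries the scalar function `f`, `f(t, γ t y) = f y`. -/
def transported (Ω : Set E3) (γ : ℝ → E3 → E3) (f : E3 → ℝ) (t : ℝ) (x : E3) : ℝ :=
  f (label Ω γ t x)

/-- The mass density `ρ = ∑ₐ ρₐ ξₐ`. -/
def density (Ω : Set E3) (ξ : Fin 3 → E3 → ℝ) (ρ : Fin 3 → ℝ) (γ : ℝ → E3 → E3)
    (t : ℝ) (x : E3) : ℝ :=
  ∑ a, ρ a * transported Ω γ (ξ a) t x

/-- `|∇ξₐ|(t, x)`. -/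
def gradNorm (Ω : Set E3) (ξ : Fin 3 → E3 → ℝ) (γ : ℝ → E3 → E3) (a : Fin 3)
    (t : ℝ) (x : E3) : ℝ :=
  ‖gradient (transported Ω γ (ξ a) t) x‖

/-- The kinetic energy density `½ ρ |u|²`. -/
def kinetic (Ω : Set E3) (ξ : Fin 3 → E3 → ℝ) (ρ : Fin 3 → ℝ) (γ : ℝ → E3 → E3)
    (t : ℝ) (x : E3) : ℝ :=
  1 / 2 * density Ω ξ ρ γ t x * ‖velocity Ω γ t x‖ ^ 2

/-! ### Tension coefficients and actions -/

/-- The proper surface tension coefficients of three phases,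
`σₐ = (σ_{ab} + σ_{ac} - σ_{bc}) / 2` for `{a, b, c} = {0, 1, 2}`. -/
def properTension (σ : Fin 3 → Fin 3 → ℝ) (a : Fin 3) : ℝ :=
  (σ a (a + 1) + σ a (a + 2) - σ (a + 1) (a + 2)) / 2

/-- The action of the three-phase field,
`∫∫ (½ρ|u|² - ∑_{a>b} σ_{ab} √(|∇ξₐ||∇ξ_b|) (ξₐ + ξ_b) + ∑ₐ pₐ ξₐ)`. -/
def multiAction (Ω : Set E3) (T₀ : ℝ) (ξ : Fin 3 → E3 → ℝ) (ρ : Fin 3 → ℝ)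
    (σ : Fin 3 → Fin 3 → ℝ) (p : Fin 3 → ℝ) (γ : ℝ → E3 → E3) : ℝ :=
  ∫ t in Ioo 0 T₀, ∫ x in Ω,
    (kinetic Ω ξ ρ γ t x
      - ∑ a : Fin 3, ∑ b ∈ Finset.univ.filter (fun b : Fin 3 => b < a),
          σ a b * √(gradNorm Ω ξ γ a t x * gradNorm Ω ξ γ b t x)
            * (transported Ω γ (ξ a) t x + transported Ω γ (ξ b) t x)
      + ∑ a : Fin 3, p a * transported Ω γ (ξ a) t x)

/-- `∫∫ (½ρ|u|² - ∑_{a ∈ A} (σₐ|∇ξₐ| - pₐ ξₐ))`, the sum being over the phases in `A`. -/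
def phaseAction (A : Finset (Fin 3)) (Ω : Set E3) (T₀ : ℝ) (ξ : Fin 3 → E3 → ℝ)
    (ρ : Fin 3 → ℝ) (σ : Fin 3 → ℝ) (p : Fin 3 → ℝ) (γ : ℝ → E3 → E3) : ℝ :=
  ∫ t in Ioo 0 T₀, ∫ x in Ω,
    (kinetic Ω ξ ρ γ t x
      - ∑ a ∈ A, (σ a * gradNorm Ω ξ γ a t x - p a * transported Ω γ (ξ a) t x))

/-- The symmetric action of the three-phase field (all phases `0, 1, 2`). -/
def triAction (Ω : Set E3) (T₀ : ℝ) (ξ : Fin 3 → E3 → ℝ)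
    (ρ : Fin 3 → ℝ) (σ : Fin 3 → ℝ) (p : Fin 3 → ℝ) (γ : ℝ → E3 → E3) : ℝ :=
  phaseAction Finset.univ Ω T₀ ξ ρ σ p γ

/-- The action of the two-phase flow (phases `1, 2`) with a wall (phase `0`). -/
def wallAction (Ω : Set E3) (T₀ : ℝ) (ξ : Fin 3 → E3 → ℝ)
    (ρ : Fin 3 → ℝ) (σ : Fin 3 → ℝ) (p : Fin 3 → ℝ) (γ : ℝ → E3 → E3) : ℝ :=
  phaseAction {1, 2} Ω T₀ ξ ρ σ p γ

/-- The triple-junction region at time `t`: the intersection of the supports (relative to `Ω`)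
of the three color functions. -/
def tripleRegion (Ω : Set E3) (ξ : Fin 3 → E3 → ℝ) (γ : ℝ → E3 → E3) (t : ℝ) : Set E3 :=
  Ω ∩ ⋂ a : Fin 3, closure {x ∈ Ω | transported Ω γ (ξ a) t x ≠ 0}

/-! ### The equation of motion -/

/-- The material derivative `D f / D t = ∂ₜ f + uʲ ∂ⱼ f` of a vector field along `u`. -/
def materialDeriv (u f : ℝ → E3 → E3) (t : ℝ) (x : E3) : E3 :=
  deriv (fun s => f s x) t + fderiv ℝ (f t) x (u t x)

/-- The unit normal `n = ∇f / |∇f|` (with value `0` where `∇f = 0`). -/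
def unitNormal (f : E3 → ℝ) (x : E3) : E3 := ‖gradient f x‖⁻¹ • gradient f x

/-- The stress `τ̄ = ∑_{a=1,2} σₐ (I - nₐ ⊗ nₐ) |∇ξₐ|`, a summand being `0` where `∇ξₐ = 0`. -/
def stress (Ω : Set E3) (ξ : Fin 3 → E3 → ℝ) (σ : Fin 3 → ℝ) (γ : ℝ → E3 → E3)
    (t : ℝ) (x : E3) (i j : Fin 3) : ℝ :=
  ∑ a ∈ ({1, 2} : Finset (Fin 3)),
    σ a * ((if i = j then 1 else 0)
      - unitNormal (transported Ω γ (ξ a) t) x i * unitNormal (transported Ω γ (ξ a) t) x j)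
      * gradNorm Ω ξ γ a t x

/-- The component `∂ⱼ f` of the derivative of a scalar function. -/
def partialDeriv (j : Fin 3) (f : E3 → ℝ) (x : E3) : ℝ :=
  fderiv ℝ f x (EuclideanSpace.single j 1)

/-- At `(t, x)` the pressure and the stress are differentiable in space, and
`D(ρuⁱ)/Dt + ∂ᵢ p - ∂ⱼ τ̄ᵢⱼ = 0` for `i = 1, 2, 3`. -/
def EquationAt (Ω : Set E3) (ξ : Fin 3 → E3 → ℝ) (ρ σ : Fin 3 → ℝ) (γ : ℝ → E3 → E3)
    (p : ℝ → E3 → ℝ) (t : ℝ) (x : E3) : Prop :=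
  DifferentiableAt ℝ (p t) x ∧
  (∀ i j, DifferentiableAt ℝ (fun y => stress Ω ξ σ γ t y i j) x) ∧
  ∀ i : Fin 3,
    materialDeriv (velocity Ω γ) (fun s y => density Ω ξ ρ γ s y • velocity Ω γ s y) t x i
      + partialDeriv i (p t) x
      - ∑ j : Fin 3, partialDeriv j (fun y => stress Ω ξ σ γ t y i j) x = 0

/-- The equation of motion on `(0, T₀) × Ω` with pressure field `p`. The stress is only Lipschitz in
space across the critical points of the color functions, so the equation is required at almost
every point of `Ω` at every time, and at every point near which the stress is `C¹`. -/
structure SolvesEquationOfMotion (Ω : Set E3) (T₀ : ℝ) (ξ : Fin 3 → E3 → ℝ)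
    (ρ σ : Fin 3 → ℝ) (γ : ℝ → E3 → E3) (p : ℝ → E3 → ℝ) : Prop where
  continuousOn : ContinuousOn (fun z : ℝ × E3 => p z.1 z.2) (Ioo 0 T₀ ×ˢ Ω)
  locallyLipschitz : ∀ t ∈ Ioo 0 T₀, LocallyLipschitzOn Ω (p t)
  ae_equation : ∀ t ∈ Ioo 0 T₀, ∀ᵐ x ∂(volume.restrict Ω), EquationAt Ω ξ ρ σ γ p t x
  equation : ∀ t ∈ Ioo 0 T₀, ∀ x ∈ Ω,
    (∀ i j, ContDiffAt ℝ 1 (fun y => stress Ω ξ σ γ t y i j) x) → EquationAt Ω ξ ρ σ γ p t x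

end

end WallFlow

/-! The statements about the actions are pointwise estimates integrated over space-time. Grouped by
proper tensions (`surfaceDefect_eq`), the difference of the two surface energy densities is
controlled by the gradients, because √(uv) ≤ (u+v)/2 and ξ_a + ξ_b ≤ 1. It vanishes wherever some
phase is absent nearby, since the other two then sum to one and have gradients of equal length. A
fixed wall contributes a density that does not depend on time, hence the constant.

For the equation of motion, the deformed action is pulled back to the undeformed configuration by
`flowMap`, the map Γ_s ∘ γ⁻¹ (`wallAction_eq`). The color functions then no longer depend on s; only
the Jacobian, the particle velocity and the inverse deformation gradient do. Differentiation under
the integral, followed by integration by parts in time along particle paths, shows that the first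
variation is minus the integral of the virtual work D(ρu)/Dt · v + τ̄ : ∇v, where v is the
divergence-free velocity of the variation (`hasDerivAt_wallAction`). The constants p_a drop out
because the Jacobian is stationary. The length of a gradient is not smooth where the gradient
vanishes, but a gradient that vanishes at s = 0 stays zero under the deformation, so the derivative
in s exists everywhere; local Lipschitz bounds justify the remaining limits and the integration by
parts in space.

Conversely, a divergence-free test field with a cut-off in time comes from an explicit variation
(`exists_isVariation_displacement`). So stationarity says that at every time the locally bounded
force F = D(ρu)/Dt - div τ̄ is orthogonal to all divergence-free test fields.

The pressure comes from `exists_potential`, a de Rham theorem with pointwise control. A mollifier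
that slides from x to y while its width changes obeys a continuity equation, and its flux, summed
over the path, is a test field whose divergence is the difference of the two end mollifiers
(`connector`). Connectedness joins every mollifier to a fixed one, and pairing F with the joining
field defines a mollified potential. Its differences are pairings of F with connectors, whose total
flux is y - x. This gives Lipschitz bounds, the limit as the width tends to 0, and the gradient -F
at every Lebesgue point of F: at almost every point, and at every point of continuity. -/

namespace WallFlow
noncomputable section
open Filter Topology
open scoped NNReal

/-! ### Integrals over the unit interval depending on a parameter -/

/-- A continuous function on `U × E`, with `[0, 1] ⊆ U`, has a continuous partial integral. -/
theorem continuous_integral_Icc_of_continuousOn {E F : Type*} [NormedAddCommGroup E]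
    [NormedSpace ℝ E] [FiniteDimensional ℝ E] [NormedAddCommGroup F] [NormedSpace ℝ F]
    {U : Set ℝ} (hU : Icc 0 1 ⊆ U) {f : ℝ → E → F}
    (hf : ContinuousOn (fun z : ℝ × E => f z.1 z.2) (U ×ˢ univ)) :
    Continuous fun z => ∫ r in Icc (0 : ℝ) 1, f r z := by
  have h1 : Continuous (fun z : E × ℝ => f (projIcc (0 : ℝ) 1 zero_le_one z.2) z.1) := by
    refine hf.comp_continuous (f := fun z : E × ℝ =>
      (((projIcc (0 : ℝ) 1 zero_le_one z.2 : ℝ)), z.1)) (by fun_prop) ?_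
    intro z
    exact ⟨hU (projIcc (0 : ℝ) 1 zero_le_one z.2).2, mem_univ _⟩
  have h2 := continuous_parametric_integral_of_continuous (μ := (volume : Measure ℝ))
    (f := fun (z : E) (r : ℝ) => f (projIcc (0 : ℝ) 1 zero_le_one r) z) h1
    (isCompact_Icc (a := (0 : ℝ)) (b := 1))
  refine h2.congr fun z => ?_
  refine setIntegral_congr_fun measurableSet_Icc fun r hr => ?_
  simp only [projIcc_of_mem zero_le_one hr]

theorem hasFDerivAt_integral_Icc {E F : Type} [NormedAddCommGroup E]
    [NormedSpace ℝ E] [FiniteDimensional ℝ E] [NormedAddCommGroup F] [NormedSpace ℝ F]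
    {U : Set ℝ} (hU : Icc 0 1 ⊆ U) {f : ℝ → E → F} {f' : ℝ → E → E →L[ℝ] F}
    (hf : ContinuousOn (fun z : ℝ × E => f z.1 z.2) (U ×ˢ univ))
    (hf' : ContinuousOn (fun z : ℝ × E => f' z.1 z.2) (U ×ˢ univ))
    (hd : ∀ r ∈ U, ∀ z, HasFDerivAt (f r) (f' r z) z) (z : E) :
    HasFDerivAt (fun z => ∫ r in Icc (0 : ℝ) 1, f r z) (∫ r in Icc (0 : ℝ) 1, f' r z) z := by
  have hc : ∀ {G : Type} [NormedAddCommGroup G] [NormedSpace ℝ G] (g : ℝ → E → G),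
      ContinuousOn (fun z : ℝ × E => g z.1 z.2) (U ×ˢ univ) → ∀ z,
      ContinuousOn (fun r => g r z) (Icc 0 1) := fun g hg z =>
    hg.comp (f := fun r : ℝ => (r, z)) (by fun_prop) fun r hr => ⟨hU hr, mem_univ _⟩
  -- The closed unit ball about z is compact in finite dimension, so one constant dominates the
  -- derivative.
  obtain ⟨C, hC⟩ := ((isCompact_Icc (a := (0 : ℝ)) (b := 1)).prod
    (isCompact_closedBall z 1)).exists_bound_of_continuousOn
    (hf'.mono (prod_mono hU (subset_univ _)))
  refine hasFDerivAt_integral_of_dominated_of_fderiv_le (μ := volume.restrict (Icc (0:ℝ) 1))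
    (F := fun z r => f r z) (F' := fun z r => f' r z) (bound := fun _ => C)
    (Metric.closedBall_mem_nhds z one_pos) ?_ ?_ ?_ ?_ ?_ ?_
  · exact Filter.Eventually.of_forall fun w =>
      (hc f hf w).aestronglyMeasurable measurableSet_Icc
  · exact (hc f hf z).integrableOn_Icc
  · exact (hc f' hf' z).aestronglyMeasurable measurableSet_Icc
  · refine (ae_restrict_iff' measurableSet_Icc).2 (Filter.Eventually.of_forall ?_)
    exact fun r hr w hw => hC (r, w) ⟨hr, hw⟩
  · exact integrableOn_const (by simp)
  · refine (ae_restrict_iff' measurableSet_Icc).2 (Filter.Eventually.of_forall ?_)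
    exact fun r hr w _ => hd r (hU hr) w

/-- Smoothness of an integral over `[0, 1]` depending on a parameter. -/
theorem contDiff_integral_Icc {E : Type} [NormedAddCommGroup E] [NormedSpace ℝ E]
    [FiniteDimensional ℝ E] {U : Set ℝ} (hUo : IsOpen U) (hU : Icc 0 1 ⊆ U) (n : ℕ) :
    ∀ {F : Type} [NormedAddCommGroup F] [NormedSpace ℝ F] {f : ℝ → E → F},
      ContDiffOn ℝ n (fun z : ℝ × E => f z.1 z.2) (U ×ˢ univ) →
      ContDiff ℝ n fun z => ∫ r in Icc (0 : ℝ) 1, f r z := by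
  -- The target F is quantified after n because the inductive step applies the hypothesis to the
  -- derivative, whose values lie in E →L[ℝ] F. With E and F both in `Type`, this space stays in the
  -- same universe.
  induction n with
  | zero =>
    intro F _ _ f hf
    simpa using! continuous_integral_Icc_of_continuousOn hU hf.continuousOn
  | succ n ih =>
    intro F _ _ f hf
    have ho : IsOpen (U ×ˢ (univ : Set E)) := hUo.prod isOpen_univ
    have hfd : ∀ r ∈ U, ∀ z, HasFDerivAt (f r)
        ((fderiv ℝ (fun z : ℝ × E => f z.1 z.2) (r, z)).comp
          (ContinuousLinearMap.inr ℝ ℝ E)) z := by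
      intro r hr z
      have h1 : HasFDerivAt (fun z : ℝ × E => f z.1 z.2) _ (r, z) :=
        ((hf.differentiableOn (by simp)).differentiableAt
          (ho.mem_nhds ⟨hr, mem_univ _⟩)).hasFDerivAt
      exact h1.comp z (hasFDerivAt_prodMk_right r z)
    have hf' : ContDiffOn ℝ n (fun z : ℝ × E =>
        (fderiv ℝ (fun z : ℝ × E => f z.1 z.2) z).comp (ContinuousLinearMap.inr ℝ ℝ E))
        (U ×ˢ univ) :=
      (hf.fderiv_of_isOpen ho (by norm_cast)).clm_comp contDiffOn_const
    have hmain := hasFDerivAt_integral_Icc hU (f := f) (f' := fun r z =>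
      (fderiv ℝ (fun z : ℝ × E => f z.1 z.2) (r, z)).comp (ContinuousLinearMap.inr ℝ ℝ E))
      hf.continuousOn hf'.continuousOn hfd
    have h3 := ih (f := fun r z => (fderiv ℝ (fun z : ℝ × E => f z.1 z.2) (r, z)).comp
      (ContinuousLinearMap.inr ℝ ℝ E)) hf'
    rw [show ((n + 1 : ℕ) : WithTop ℕ∞) = (n : WithTop ℕ∞) + 1 by norm_cast,
      contDiff_succ_iff_fderiv]
    refine ⟨fun z => (hmain z).differentiableAt, by simp, ?_⟩
    convert h3 using 2 with z
    exact (hmain z).fderiv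


/-! ### Test fields and mollifiers -/

/-- The divergence of a vector field on `ℝ³`. -/
def divergence (φ : E3 → E3) (x : E3) : ℝ :=
  ∑ i : Fin 3, fderiv ℝ φ x (EuclideanSpace.single i 1) i

/-- Smooth vector fields with compact support in `Ω`. -/
structure IsTestField (Ω : Set E3) (φ : E3 → E3) : Prop where
  smooth : ContDiff ℝ ∞ φ
  compact : HasCompactSupport φ
  support : tsupport φ ⊆ Ω

theorem IsTestField.add {Ω : Set E3} {φ ψ : E3 → E3} (hφ : IsTestField Ω φ)
    (hψ : IsTestField Ω ψ) : IsTestField Ω (φ + ψ) :=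
  ⟨hφ.smooth.add hψ.smooth, hφ.compact.add hψ.compact,
    (tsupport_add φ ψ).trans (union_subset hφ.support hψ.support)⟩

theorem IsTestField.neg {Ω : Set E3} {φ : E3 → E3} (hφ : IsTestField Ω φ) :
    IsTestField Ω (-φ) :=
  ⟨hφ.smooth.neg, hφ.compact.neg, (tsupport_neg φ).subset.trans hφ.support⟩

theorem divergence_add {φ ψ : E3 → E3} {x : E3} (hφ : DifferentiableAt ℝ φ x)
    (hψ : DifferentiableAt ℝ ψ x) :
    divergence (φ + ψ) x = divergence φ x + divergence ψ x := by
  simp [divergence, fderiv_add hφ hψ, Finset.sum_add_distrib]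

theorem divergence_neg (φ : E3 → E3) (x : E3) : divergence (-φ) x = -divergence φ x := by
  simp [divergence, fderiv_neg]

/-- A fixed radial mollifier on `ℝ³`, supported in the unit ball. -/
def mollifier (q : E3) : ℝ :=
  (⟨1 / 2, 1, by norm_num, by norm_num⟩ : ContDiffBump (0 : E3)).normed volume q

theorem mollifier_contDiff : ContDiff ℝ ∞ mollifier := ContDiffBump.contDiff_normed _

theorem mollifier_nonneg (q : E3) : 0 ≤ mollifier q := ContDiffBump.nonneg_normed _ q

theorem mollifier_neg (q : E3) : mollifier (-q) = mollifier q := ContDiffBump.normed_neg _ q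

theorem integral_mollifier : ∫ q, mollifier q = 1 := ContDiffBump.integral_normed _

theorem mollifier_hasCompactSupport : HasCompactSupport mollifier :=
  ContDiffBump.hasCompactSupport_normed _

theorem mollifier_eq_zero {q : E3} (hq : 1 ≤ ‖q‖) : mollifier q = 0 := by
  by_contra h
  have : q ∈ Function.support mollifier := h
  unfold mollifier at this
  erw [ContDiffBump.support_normed_eq] at this
  simp at this
  linarith

theorem exists_mollifier_le : ∃ M, 0 < M ∧ ∀ q, mollifier q ≤ M := by
  obtain ⟨C, hC⟩ := mollifier_hasCompactSupport.exists_bound_of_continuous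
    mollifier_contDiff.continuous
  exact ⟨max C 1, by positivity, fun q => (le_abs_self _).trans ((hC q).trans (le_max_left _ _))⟩

/-- The mollifier of width `ε` centred at `x`. -/
def bumpAt (x : E3) (ε : ℝ) (z : E3) : ℝ := (ε ^ 3)⁻¹ * mollifier (ε⁻¹ • (z - x))

theorem bumpAt_nonneg {x : E3} {ε : ℝ} (hε : 0 < ε) (z : E3) : 0 ≤ bumpAt x ε z := by
  have := mollifier_nonneg (ε⁻¹ • (z - x))
  unfold bumpAt; positivity

theorem bumpAt_eq_zero {x : E3} {ε : ℝ} (hε : 0 < ε) {z : E3} (hz : z ∉ Metric.closedBall x ε) :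
    bumpAt x ε z = 0 := by
  rw [Metric.mem_closedBall, dist_eq_norm, not_le] at hz
  rw [bumpAt, mollifier_eq_zero, mul_zero]
  rw [norm_smul, norm_inv, Real.norm_of_nonneg hε.le, inv_mul_eq_div, one_le_div hε]
  exact hz.le

theorem bumpAt_contDiff (x : E3) (ε : ℝ) : ContDiff ℝ ∞ (bumpAt x ε) :=
  contDiff_const.mul (mollifier_contDiff.comp (by fun_prop))

theorem integral_bumpAt (x : E3) {ε : ℝ} (hε : 0 < ε) : ∫ z, bumpAt x ε z = 1 := by
  unfold bumpAt
  rw [integral_const_mul, integral_sub_right_eq_self (fun z => mollifier (ε⁻¹ • z)),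
    Measure.integral_comp_inv_smul, integral_mollifier]
  have : Module.finrank ℝ E3 = 3 := by simp
  rw [this, abs_of_pos (by positivity), smul_eq_mul, mul_one, inv_mul_cancel₀ (by positivity)]

/-- The reflection z ↦ 2x - z preserves the bump and reverses z - x, so the first moment equals its
own negative. -/
theorem integral_bumpAt_smul_sub (x : E3) (ε : ℝ) :
    ∫ z, bumpAt x ε z • (z - x) = 0 := by
  have h1 : ∫ z, bumpAt x ε z • (z - x) = ∫ z, -(bumpAt x ε z • (z - x)) := by
    rw [← integral_sub_left_eq_self (fun z => bumpAt x ε z • (z - x)) volume ((2 : ℝ) • x)]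
    refine integral_congr_ae (Filter.Eventually.of_forall fun z => ?_)
    have : (2 : ℝ) • x - z - x = -(z - x) := by rw [two_smul]; abel
    simp only [bumpAt, this, smul_neg, mollifier_neg]
  rw [integral_neg] at h1
  have h2 : (2 : ℝ) • ∫ z, bumpAt x ε z • (z - x) = 0 := by
    rw [two_smul]
    nth_rewrite 1 [h1]
    exact neg_add_cancel _
  exact (smul_eq_zero.1 h2).resolve_left two_ne_zero

theorem bumpAt_hasCompactSupport (x : E3) {ε : ℝ} (hε : 0 < ε) :
    HasCompactSupport (bumpAt x ε) :=
  HasCompactSupport.intro (isCompact_closedBall x ε) fun _ hz => bumpAt_eq_zero hε hz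

/-! ### The flux of a moving mollifier -/

/-- The centre, at time `r`, of a mollifier moving from `x` to `y`. -/
def connCenter (x y : E3) (r : ℝ) : E3 := x + r • (y - x)

/-- The width, at time `r`, of a mollifier whose width changes from `ε` to `δ`. -/
def connWidth (ε δ r : ℝ) : ℝ := ε + r * (δ - ε)

/-- The velocity of a mollifier moving from `(x, ε)` to `(y, δ)`. -/
def connVelocity (x y : E3) (ε δ r : ℝ) (z : E3) : E3 :=
  (y - x) + ((δ - ε) / connWidth ε δ r) • (z - connCenter x y r)

/-- The flux of a mollifier moving from `(x, ε)` to `(y, δ)`. -/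
def connFlux (x y : E3) (ε δ r : ℝ) (z : E3) : E3 :=
  bumpAt (connCenter x y r) (connWidth ε δ r) z • connVelocity x y ε δ r z

/-- The total flux, a vector field whose divergence is the difference of two mollifiers. -/
def connector (x y : E3) (ε δ : ℝ) (z : E3) : E3 :=
  ∫ r in Icc (0 : ℝ) 1, connFlux x y ε δ r z

theorem connWidth_pos {ε δ : ℝ} (hε : 0 < ε) (hδ : 0 < δ) {r : ℝ} (hr : r ∈ Icc (0 : ℝ) 1) :
    0 < connWidth ε δ r := by
  have h : connWidth ε δ r = (1 - r) * ε + r * δ := by unfold connWidth; ring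
  rw [h]
  rcases hr.1.eq_or_lt with h0 | h0
  · subst h0; simpa
  · have := mul_pos h0 hδ
    have := mul_nonneg (sub_nonneg.2 hr.2) hε.le
    linarith

theorem connFlux_contDiffOn (x y : E3) (ε δ : ℝ) :
    ContDiffOn ℝ ∞ (fun z : ℝ × E3 => connFlux x y ε δ z.1 z.2)
      ({r | 0 < connWidth ε δ r} ×ˢ univ) := by
  have hw : ContDiff ℝ ∞ fun z : ℝ × E3 => connWidth ε δ z.1 := by
    unfold connWidth; fun_prop
  have hne : ∀ z ∈ ({r | 0 < connWidth ε δ r} ×ˢ univ : Set (ℝ × E3)),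
      connWidth ε δ z.1 ≠ 0 := fun z hz => ne_of_gt hz.1
  have hc : ContDiff ℝ ∞ fun z : ℝ × E3 => z.2 - connCenter x y z.1 := by
    unfold connCenter; fun_prop
  have h1 : ContDiffOn ℝ ∞ (fun z : ℝ × E3 => (connWidth ε δ z.1 ^ 3)⁻¹)
      ({r | 0 < connWidth ε δ r} ×ˢ univ) :=
    (hw.contDiffOn.pow 3).inv fun z hz => pow_ne_zero 3 (hne z hz)
  have h2 : ContDiffOn ℝ ∞ (fun z : ℝ × E3 =>
      mollifier ((connWidth ε δ z.1)⁻¹ • (z.2 - connCenter x y z.1)))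
      ({r | 0 < connWidth ε δ r} ×ˢ univ) :=
    mollifier_contDiff.comp_contDiffOn ((hw.contDiffOn.inv hne).smul hc.contDiffOn)
  have h3 : ContDiffOn ℝ ∞ (fun z : ℝ × E3 => (δ - ε) / connWidth ε δ z.1)
      ({r | 0 < connWidth ε δ r} ×ˢ univ) := contDiffOn_const.div hw.contDiffOn hne
  exact (h1.mul h2).smul (contDiffOn_const.add (h3.smul hc.contDiffOn))

theorem isOpen_connWidth_pos (ε δ : ℝ) : IsOpen {r | 0 < connWidth ε δ r} :=
  isOpen_lt continuous_const (by unfold connWidth; fun_prop)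

theorem connector_contDiff {x y : E3} {ε δ : ℝ} (hε : 0 < ε) (hδ : 0 < δ) :
    ContDiff ℝ ∞ (connector x y ε δ) :=
  contDiff_infty.2 fun n => contDiff_integral_Icc (isOpen_connWidth_pos ε δ)
    (fun _ hr => connWidth_pos hε hδ hr) n
    ((connFlux_contDiffOn x y ε δ).of_le (by exact_mod_cast le_top))

/-- Centre and width are affine in r and the distance to c is convex, so the condition dist + width
≤ R passes from the endpoints to all r between. -/
theorem closedBall_connCenter_subset {x y c : E3} {ε δ R : ℝ} (hx : dist x c + ε ≤ R)
    (hy : dist y c + δ ≤ R) {r : ℝ} (hr : r ∈ Icc (0 : ℝ) 1) :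
    Metric.closedBall (connCenter x y r) (connWidth ε δ r) ⊆ Metric.closedBall c R := by
  apply Metric.closedBall_subset_closedBall'
  have h : connCenter x y r - c = (1 - r) • (x - c) + r • (y - c) := by
    unfold connCenter; module
  have h2 : dist (connCenter x y r) c ≤ (1 - r) * dist x c + r * dist y c := by
    rw [dist_eq_norm, h, dist_eq_norm, dist_eq_norm]
    refine (norm_add_le _ _).trans_eq ?_
    rw [norm_smul, norm_smul, Real.norm_of_nonneg hr.1, Real.norm_of_nonneg (sub_nonneg.2 hr.2)]
  have h3 := mul_le_mul_of_nonneg_left hx (sub_nonneg.2 hr.2)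
  have h4 := mul_le_mul_of_nonneg_left hy hr.1
  unfold connWidth
  nlinarith

theorem connFlux_eq_zero {x y c : E3} {ε δ R : ℝ} (hε : 0 < ε) (hδ : 0 < δ)
    (hx : dist x c + ε ≤ R) (hy : dist y c + δ ≤ R) {z : E3} (hz : z ∉ Metric.closedBall c R)
    {r : ℝ} (hr : r ∈ Icc (0 : ℝ) 1) : connFlux x y ε δ r z = 0 := by
  rw [connFlux, bumpAt_eq_zero (connWidth_pos hε hδ hr)
    (fun h => hz (closedBall_connCenter_subset hx hy hr h)), zero_smul]

theorem connector_eq_zero {x y c : E3} {ε δ R : ℝ} (hε : 0 < ε) (hδ : 0 < δ)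
    (hx : dist x c + ε ≤ R) (hy : dist y c + δ ≤ R) {z : E3} (hz : z ∉ Metric.closedBall c R) :
    connector x y ε δ z = 0 := by
  rw [connector, setIntegral_congr_fun measurableSet_Icc
    (fun r hr => connFlux_eq_zero hε hδ hx hy hz hr)]
  simp

theorem connector_isTestField {Ω : Set E3} {x y c : E3} {ε δ R : ℝ} (hε : 0 < ε) (hδ : 0 < δ)
    (hx : dist x c + ε ≤ R) (hy : dist y c + δ ≤ R) (hΩ : Metric.closedBall c R ⊆ Ω) :
    IsTestField Ω (connector x y ε δ) where
  smooth := connector_contDiff hε hδ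
  compact := HasCompactSupport.intro (isCompact_closedBall c R)
    fun _ hz => connector_eq_zero hε hδ hx hy hz
  support := (closure_minimal (fun z hz => by
    by_contra h
    exact hz (connector_eq_zero hε hδ hx hy h)) Metric.isClosed_closedBall).trans hΩ

/-- This is the continuity equation. The velocity is affine in z and is chosen so that the rescaled
variable (z - centre)/width has r-derivative -velocity/width; its divergence 3(δ - ε)/width accounts
for the derivative of the normalising factor width⁻³. -/
theorem hasDerivAt_bumpAt_conn (x y : E3) (ε δ : ℝ) (z : E3) {r : ℝ}
    (hr : 0 < connWidth ε δ r) :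
    HasDerivAt (fun r => bumpAt (connCenter x y r) (connWidth ε δ r) z)
      (-divergence (connFlux x y ε δ r) z) r := by
  set e := connWidth ε δ r with he
  set w := z - connCenter x y r with hw
  set V := connVelocity x y ε δ r z with hV
  set m' := fderiv ℝ mollifier (e⁻¹ • w) with hm'
  have hm : HasFDerivAt mollifier m' (e⁻¹ • w) :=
    (mollifier_contDiff.differentiable (by simp) _).hasFDerivAt
  have hed : HasDerivAt (connWidth ε δ) (δ - ε) r :=
    (((hasDerivAt_id r).mul_const (δ - ε)).const_add ε).congr_deriv (one_mul _)
  have hwd : HasDerivAt (fun r => z - connCenter x y r) (-(y - x)) r := by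
    simpa [connCenter] using (((hasDerivAt_id r).smul_const (y - x)).const_add x).const_sub z
  have hq : HasDerivAt (fun r => (connWidth ε δ r)⁻¹ • (z - connCenter x y r))
      (-(e⁻¹ • V)) r := by
    refine ((hed.inv hr.ne').smul hwd).congr_deriv ?_
    simp only [hV, connVelocity, ← he, ← hw, smul_add, smul_smul, smul_neg, neg_add]
    congr 2
    rw [← neg_smul]
    congr 1
    field_simp
  have h3 := (((hed.pow 3).inv (pow_ne_zero 3 hr.ne')).mul
    (hm.comp_hasDerivAt r hq))
  refine h3.congr_deriv ?_
  have hbump : HasFDerivAt (bumpAt (connCenter x y r) e)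
      ((e ^ 3)⁻¹ • (m'.comp (e⁻¹ • ContinuousLinearMap.id ℝ E3))) z := by
    refine HasFDerivAt.const_mul (HasFDerivAt.comp (g := mollifier) z hm ?_) _
    exact ((hasFDerivAt_id z).sub_const _).const_smul e⁻¹
  have hvel : HasFDerivAt (connVelocity x y ε δ r)
      (((δ - ε) / e) • ContinuousLinearMap.id ℝ E3) z :=
    (((hasFDerivAt_id z).sub_const _).const_smul ((δ - ε) / e)).const_add (y - x)
  have hfl := (hbump.smul hvel).fderiv
  have hfl' : fderiv ℝ (connFlux x y ε δ r) z = _ := hfl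
  have hsum : m' V = ∑ i, V i * m' (EuclideanSpace.single i 1) := by
    conv_lhs => rw [← (EuclideanSpace.basisFun (Fin 3) ℝ).sum_repr V]
    simp
  rw [divergence, hfl']
  simp only [add_apply, smul_apply,
    ContinuousLinearMap.smulRight_apply, ContinuousLinearMap.comp_apply,
    ContinuousLinearMap.id_apply, PiLp.add_apply, PiLp.smul_apply, smul_eq_mul, map_smul,
    Finset.sum_add_distrib, map_neg, ← hV, hsum, Fin.sum_univ_three, ← he, ← hw, bumpAt,
    PiLp.single_apply, if_true, Pi.inv_apply, Pi.pow_apply, Function.comp_apply]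
  field_simp
  ring

/-- Integrating the continuity equation over r in [0, 1] leaves only the two end mollifiers. -/
theorem divergence_connector {x y : E3} {ε δ : ℝ} (hε : 0 < ε) (hδ : 0 < δ) (z : E3) :
    divergence (connector x y ε δ) z = bumpAt x ε z - bumpAt y δ z := by
  set U := {r | 0 < connWidth ε δ r} with hUdef
  have hU : Icc (0 : ℝ) 1 ⊆ U := fun r hr => connWidth_pos hε hδ hr
  have ho : IsOpen (U ×ˢ (univ : Set E3)) := (isOpen_connWidth_pos ε δ).prod isOpen_univ
  have hf := connFlux_contDiffOn x y ε δ
  have hfd : ∀ r ∈ U, ∀ z, HasFDerivAt (connFlux x y ε δ r)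
      (fderiv ℝ (connFlux x y ε δ r) z) z := by
    intro r hr z
    have h1 : DifferentiableAt ℝ (fun z : ℝ × E3 => connFlux x y ε δ z.1 z.2) (r, z) :=
      (hf.differentiableOn (by simp)).differentiableAt (ho.mem_nhds ⟨hr, mem_univ _⟩)
    exact (h1.comp z (hasFDerivAt_prodMk_right r z).differentiableAt).hasFDerivAt
  have hfe : ∀ r ∈ U, ∀ z, fderiv ℝ (connFlux x y ε δ r) z =
      (fderiv ℝ (fun z : ℝ × E3 => connFlux x y ε δ z.1 z.2) (r, z)).comp
          (ContinuousLinearMap.inr ℝ ℝ E3) := by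
    intro r hr z
    have h1 : DifferentiableAt ℝ (fun z : ℝ × E3 => connFlux x y ε δ z.1 z.2) (r, z) :=
      (hf.differentiableOn (by simp)).differentiableAt (ho.mem_nhds ⟨hr, mem_univ _⟩)
    exact (h1.hasFDerivAt.comp z (hasFDerivAt_prodMk_right r z)).fderiv
  have hf' : ContinuousOn (fun z : ℝ × E3 => fderiv ℝ (connFlux x y ε δ z.1) z.2)
      (U ×ˢ univ) := by
    have h : ContinuousOn (fun z : ℝ × E3 =>
        (fderiv ℝ (fun z : ℝ × E3 => connFlux x y ε δ z.1 z.2) z).comp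
          (ContinuousLinearMap.inr ℝ ℝ E3)) (U ×ˢ univ) :=
      (hf.continuousOn_fderiv_of_isOpen ho (by simp)).clm_comp continuousOn_const
    exact h.congr fun z hz => hfe z.1 hz.1 z.2
  have hmain := hasFDerivAt_integral_Icc hU hf.continuousOn hf' hfd z
  have hcr : ContinuousOn (fun r => fderiv ℝ (connFlux x y ε δ r) z) (Icc 0 1) :=
    hf'.comp (f := fun r : ℝ => (r, z)) (by fun_prop) fun r hr => ⟨hU hr, mem_univ _⟩
  let T : (E3 →L[ℝ] E3) →L[ℝ] ℝ := ∑ i : Fin 3,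
    (EuclideanSpace.proj i).comp (ContinuousLinearMap.apply ℝ E3 (EuclideanSpace.single i 1))
  have hT : ∀ (φ : E3 → E3) w, divergence φ w = T (fderiv ℝ φ w) := by
    intro φ w; simp [T, divergence]
  have h1 : divergence (connector x y ε δ) z
      = ∫ r in Icc (0 : ℝ) 1, divergence (connFlux x y ε δ r) z := by
    simp_rw [hT]
    rw [T.integral_comp_comm hcr.integrableOn_Icc]
    congr 1
    exact hmain.fderiv
  have hcd : ContinuousOn (fun r => divergence (connFlux x y ε δ r) z) (Icc 0 1) := by
    simp_rw [hT]
    exact T.continuous.comp_continuousOn hcr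
  rw [h1, integral_Icc_eq_integral_Ioc, ← intervalIntegral.integral_of_le zero_le_one]
  have h2 := intervalIntegral.integral_eq_sub_of_hasDerivAt (a := 0) (b := 1)
    (f := fun r => -bumpAt (connCenter x y r) (connWidth ε δ r) z)
    (f' := fun r => divergence (connFlux x y ε δ r) z) (fun r hr => by
      rw [uIcc_of_le zero_le_one] at hr
      simpa using! (hasDerivAt_bumpAt_conn x y ε δ z (connWidth_pos hε hδ hr)).neg)
    (hcd.intervalIntegrable_of_Icc zero_le_one)
  rw [h2]
  simp only [connCenter, connWidth, zero_smul, one_smul, zero_mul, one_mul, add_zero,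
    add_sub_cancel]
  ring

/-- On the support of the bump, |z - centre| is at most the width, which cancels the width in the
denominator of the velocity. -/
theorem norm_connFlux_le {x y : E3} {ε δ : ℝ} (hε : 0 < ε) (hδ : 0 < δ) {r : ℝ}
    (hr : r ∈ Icc (0 : ℝ) 1) (z : E3) :
    ‖connFlux x y ε δ r z‖ ≤
      (‖y - x‖ + |δ - ε|) * bumpAt (connCenter x y r) (connWidth ε δ r) z := by
  have he := connWidth_pos hε hδ hr
  by_cases hz : z ∈ Metric.closedBall (connCenter x y r) (connWidth ε δ r)
  · rw [connFlux, norm_smul, Real.norm_of_nonneg (bumpAt_nonneg he z), mul_comm]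
    refine mul_le_mul_of_nonneg_right ?_ (bumpAt_nonneg he z)
    refine (norm_add_le _ _).trans (add_le_add_right ?_ _)
    rw [norm_smul, norm_div, Real.norm_eq_abs, Real.norm_of_nonneg he.le, ← dist_eq_norm,
      div_mul_eq_mul_div]
    exact div_le_of_le_mul₀ he.le (abs_nonneg _)
      (mul_le_mul_of_nonneg_left (Metric.mem_closedBall.1 hz) (abs_nonneg _))
  · rw [connFlux, bumpAt_eq_zero he hz]
    simp

theorem continuous_connFlux {x y : E3} {ε δ : ℝ} (hε : 0 < ε) (hδ : 0 < δ) {r : ℝ}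
    (hr : r ∈ Icc (0 : ℝ) 1) : Continuous (connFlux x y ε δ r) := by
  rw [← continuousOn_univ]
  exact (connFlux_contDiffOn x y ε δ).continuousOn.comp (f := fun z : E3 => (r, z))
    (by fun_prop) fun z _ => ⟨connWidth_pos hε hδ hr, mem_univ _⟩

/-- The mollifier has mass one and vanishing first moment, so only the translation part of the
velocity survives. -/
theorem integral_connFlux {x y : E3} {ε δ : ℝ} (hε : 0 < ε) (hδ : 0 < δ) {r : ℝ}
    (hr : r ∈ Icc (0 : ℝ) 1) : ∫ z, connFlux x y ε δ r z = y - x := by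
  have he := connWidth_pos hε hδ hr
  have hb := (bumpAt_contDiff (connCenter x y r) (connWidth ε δ r)).continuous
  have hs := bumpAt_hasCompactSupport (connCenter x y r) he
  simp only [connFlux, connVelocity, smul_add]
  rw [integral_add]
  · rw [integral_smul_const, integral_bumpAt _ he, one_smul]
    simp_rw [smul_comm _ ((δ - ε) / connWidth ε δ r)]
    rw [integral_smul, integral_bumpAt_smul_sub, smul_zero, add_zero]
  · exact (hb.smul continuous_const).integrable_of_hasCompactSupport hs.smul_right
  · exact Continuous.integrable_of_hasCompactSupport (by fun_prop) hs.smul_right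

theorem integrable_inner_connFlux (x y : E3) {c : E3} {ε δ R L : ℝ} {F : E3 → E3} (hε : 0 < ε)
    (hδ : 0 < δ)
    (hF : AEStronglyMeasurable F (volume.restrict (Metric.closedBall c R)))
    (hL : ∀ᵐ z ∂volume.restrict (Metric.closedBall c R), ‖F z‖ ≤ L) :
    Integrable (fun z : ℝ × E3 => inner ℝ (F z.2) (connFlux x y ε δ z.1 z.2))
      ((volume.restrict (Icc (0 : ℝ) 1)).prod (volume.restrict (Metric.closedBall c R))) := by
  have hU : Icc (0 : ℝ) 1 ⊆ {r | 0 < connWidth ε δ r} := fun r hr => connWidth_pos hε hδ hr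
  have hcont : ContinuousOn (fun z : ℝ × E3 => connFlux x y ε δ z.1 z.2)
      (Icc (0 : ℝ) 1 ×ˢ Metric.closedBall c R) :=
    (connFlux_contDiffOn x y ε δ).continuousOn.mono (prod_mono hU (subset_univ _))
  have hcomp : IsCompact (Icc (0 : ℝ) 1 ×ˢ Metric.closedBall c R) :=
    isCompact_Icc.prod (isCompact_closedBall c R)
  obtain ⟨C, hC⟩ := hcomp.exists_bound_of_continuousOn hcont
  have : IsFiniteMeasure (volume.restrict (Metric.closedBall c R)) :=
    ⟨by rw [Measure.restrict_apply_univ]; exact (isCompact_closedBall c R).measure_lt_top⟩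
  refine Integrable.of_bound (C := L * C) ?_ ?_
  · refine hF.comp_snd.inner ?_
    rw [Measure.prod_restrict]
    exact hcont.aestronglyMeasurable hcomp.measurableSet
  · have h1 : ∀ᵐ z : ℝ × E3 ∂((volume.restrict (Icc (0 : ℝ) 1)).prod
        (volume.restrict (Metric.closedBall c R))), ‖F z.2‖ ≤ L :=
      Measure.quasiMeasurePreserving_snd.ae hL
    have h2 : ∀ᵐ z : ℝ × E3 ∂((volume.restrict (Icc (0 : ℝ) 1)).prod
        (volume.restrict (Metric.closedBall c R))),
        z ∈ Icc (0 : ℝ) 1 ×ˢ Metric.closedBall c R := by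
      rw [Measure.prod_restrict]
      exact ae_restrict_mem hcomp.measurableSet
    filter_upwards [h1, h2] with z hz1 hz2
    exact (norm_inner_le_norm _ _).trans (mul_le_mul hz1 (hC z hz2) (norm_nonneg _)
      ((norm_nonneg _).trans hz1))

theorem integral_inner_connector {x y c : E3} {ε δ R L : ℝ} {F : E3 → E3} (hε : 0 < ε)
    (hδ : 0 < δ) (hx : dist x c + ε ≤ R) (hy : dist y c + δ ≤ R)
    (hF : AEStronglyMeasurable F (volume.restrict (Metric.closedBall c R)))
    (hL : ∀ᵐ z ∂volume.restrict (Metric.closedBall c R), ‖F z‖ ≤ L) :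
    ∫ z, inner ℝ (F z) (connector x y ε δ z) = ∫ r in Icc (0 : ℝ) 1,
      ∫ z in Metric.closedBall c R, inner ℝ (F z) (connFlux x y ε δ r z) := by
  have hU : Icc (0 : ℝ) 1 ⊆ {r | 0 < connWidth ε δ r} := fun r hr => connWidth_pos hε hδ hr
  have hint := integrable_inner_connFlux x y hε hδ hF hL
  rw [integral_integral_swap (f := fun r z => inner ℝ (F z) (connFlux x y ε δ r z)) hint]
  rw [← setIntegral_eq_integral_of_forall_compl_eq_zero (s := Metric.closedBall c R)]
  · refine integral_congr_ae (Filter.Eventually.of_forall fun z => ?_)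
    refine (integral_inner ?_ _).symm
    refine ContinuousOn.integrableOn_Icc ?_
    exact (connFlux_contDiffOn x y ε δ).continuousOn.comp (f := fun r : ℝ => (r, z))
      (by fun_prop) fun r hr => ⟨hU hr, mem_univ _⟩
  · intro z hz
    rw [connector_eq_zero hε hδ hx hy hz, inner_zero_right]

/-- Since the connector has total flux y - x, pairing it with F gives c₀ · (y - x) up to the
weighted mean deviation of F from c₀. The choice c₀ = 0 yields Lipschitz bounds, and c₀ = F x yields
the derivative at a Lebesgue point. -/
theorem abs_integral_inner_connector_sub_le {x y c : E3} {ε δ R L B : ℝ} {F : E3 → E3}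
    (c₀ : E3) (hε : 0 < ε)
    (hδ : 0 < δ) (hx : dist x c + ε ≤ R) (hy : dist y c + δ ≤ R)
    (hF : AEStronglyMeasurable F (volume.restrict (Metric.closedBall c R)))
    (hL : ∀ᵐ z ∂volume.restrict (Metric.closedBall c R), ‖F z‖ ≤ L)
    (hB : ∀ r ∈ Icc (0 : ℝ) 1, ∫ z in Metric.closedBall c R,
      ‖F z - c₀‖ * bumpAt (connCenter x y r) (connWidth ε δ r) z ≤ B) :
    |(∫ z, inner ℝ (F z) (connector x y ε δ z)) - inner ℝ c₀ (y - x)|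
      ≤ (‖y - x‖ + |δ - ε|) * B := by
  have : IsFiniteMeasure (volume.restrict (Metric.closedBall c R)) :=
    ⟨by rw [Measure.restrict_apply_univ]; exact (isCompact_closedBall c R).measure_lt_top⟩
  set μ := volume.restrict (Metric.closedBall c R) with hμ
  have hFi : Integrable (fun z => F z - c₀) μ :=
    (Integrable.of_bound hF L hL).sub (integrable_const _)
  have hkey : ∀ r ∈ Icc (0 : ℝ) 1,
      |(∫ z, inner ℝ (F z) (connFlux x y ε δ r z) ∂μ) - inner ℝ c₀ (y - x)| ≤
        (‖y - x‖ + |δ - ε|) * B := by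
    intro r hr
    have he := connWidth_pos hε hδ hr
    have hcf := continuous_connFlux (x := x) (y := y) hε hδ hr
    have hbm := (bumpAt_contDiff (connCenter x y r) (connWidth ε δ r)).continuous
    have hflux : ∫ z, connFlux x y ε δ r z ∂μ = y - x := by
      rw [← integral_connFlux hε hδ hr]
      exact setIntegral_eq_integral_of_forall_compl_eq_zero fun z hz =>
        connFlux_eq_zero hε hδ hx hy hz hr
    have hfi : Integrable (fun z => connFlux x y ε δ r z) μ :=
      hcf.continuousOn.integrableOn_compact (isCompact_closedBall c R)
    have hbi : Integrable (fun z => ‖F z - c₀‖ *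
        bumpAt (connCenter x y r) (connWidth ε δ r) z) μ := by
      obtain ⟨C, hC⟩ := (bumpAt_hasCompactSupport (connCenter x y r) he).exists_bound_of_continuous
        hbm
      exact hFi.norm.mul_bdd (c := C) hbm.aestronglyMeasurable (Filter.Eventually.of_forall hC)
    have hdom : ∀ z, ‖inner ℝ (F z - c₀) (connFlux x y ε δ r z)‖ ≤
        (‖y - x‖ + |δ - ε|) * (‖F z - c₀‖ *
          bumpAt (connCenter x y r) (connWidth ε δ r) z) := by
      intro z
      refine (norm_inner_le_norm _ _).trans ?_
      have := mul_le_mul_of_nonneg_left (norm_connFlux_le (x := x) (y := y) hε hδ hr z)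
        (norm_nonneg (F z - c₀))
      linarith
    have hdi : Integrable (fun z => inner ℝ (F z - c₀) (connFlux x y ε δ r z)) μ :=
      (hbi.const_mul _).mono' (hFi.aestronglyMeasurable.inner hcf.aestronglyMeasurable)
        (Filter.Eventually.of_forall hdom)
    have hci : Integrable (fun z => inner ℝ c₀ (connFlux x y ε δ r z)) μ :=
      hfi.const_inner c₀
    have hsplit : ∫ z, inner ℝ (F z) (connFlux x y ε δ r z) ∂μ =
        (∫ z, inner ℝ (F z - c₀) (connFlux x y ε δ r z) ∂μ) + inner ℝ c₀ (y - x) := by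
      rw [← hflux, ← integral_inner hfi, ← integral_add hdi hci]
      refine integral_congr_ae (Filter.Eventually.of_forall fun z => ?_)
      simp only [inner_sub_left]
      ring
    rw [hsplit, add_sub_cancel_right]
    refine (norm_integral_le_of_norm_le (hbi.const_mul _)
      (Filter.Eventually.of_forall hdom)).trans ?_
    rw [integral_const_mul]
    exact mul_le_mul_of_nonneg_left (hB r hr) (by positivity)
  have hmeas : IntegrableOn (fun r => ∫ z, inner ℝ (F z) (connFlux x y ε δ r z) ∂μ)
      (Icc (0 : ℝ) 1) := (integrable_inner_connFlux x y hε hδ hF hL).integral_prod_left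
  rw [integral_inner_connector hε hδ hx hy hF hL]
  have hconst : ∫ _ in Icc (0 : ℝ) 1, (inner ℝ c₀ (y - x) : ℝ) = inner ℝ c₀ (y - x) := by
    simp
  rw [← hconst, ← integral_sub hmeas (integrableOn_const (by simp))]
  have hle := norm_setIntegral_le_of_norm_le_const (μ := volume) (s := Icc (0 : ℝ) 1)
    (f := fun r => (∫ z, inner ℝ (F z) (connFlux x y ε δ r z) ∂μ) - inner ℝ c₀ (y - x))
    (C := (‖y - x‖ + |δ - ε|) * B) measure_Icc_lt_top hkey
  simpa using hle

/-! ### Potentials of fields orthogonal to divergence-free test fields -/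

/-- Any two mollifiers supported in a connected open set differ by the divergence of a test
field. -/
theorem exists_testField_divergence_eq {Ω : Set E3} (hΩ : IsOpen Ω) (hc : IsPreconnected Ω)
    {x y : E3} {ε δ : ℝ} (hε : 0 < ε) (hδ : 0 < δ) (hx : Metric.closedBall x ε ⊆ Ω)
    (hy : Metric.closedBall y δ ⊆ Ω) :
    ∃ φ, IsTestField Ω φ ∧ ∀ z, divergence φ z = bumpAt x ε z - bumpAt y δ z := by
  have add : ∀ {f g h : E3 → ℝ}, (∃ φ, IsTestField Ω φ ∧ ∀ z, divergence φ z = f z - g z) →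
      (∃ φ, IsTestField Ω φ ∧ ∀ z, divergence φ z = g z - h z) →
      ∃ φ, IsTestField Ω φ ∧ ∀ z, divergence φ z = f z - h z := by
    rintro f g h ⟨φ, hφ, h1⟩ ⟨ψ, hψ, h2⟩
    refine ⟨φ + ψ, hφ.add hψ, fun z => ?_⟩
    rw [divergence_add (hφ.smooth.differentiable (by simp) z)
      (hψ.smooth.differentiable (by simp) z), h1, h2]
    ring
  -- With a common centre, the larger of the two balls contains the support of the connector.
  have scale : ∀ {x : E3} {ε δ : ℝ}, 0 < ε → 0 < δ → Metric.closedBall x ε ⊆ Ω →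
      Metric.closedBall x δ ⊆ Ω →
      ∃ φ, IsTestField Ω φ ∧ ∀ z, divergence φ z = bumpAt x ε z - bumpAt x δ z := by
    intro x ε δ hε hδ hx hy
    refine ⟨connector x x ε δ, connector_isTestField (c := x) (R := max ε δ) hε hδ
      (by simp) (by simp) ?_, divergence_connector hε hδ⟩
    rcases max_cases ε δ with h | h <;> rw [h.1] <;> assumption
  have ball : ∀ x ∈ Ω, ∃ R > 0, Metric.closedBall x R ⊆ Ω := fun x hx =>
    Metric.nhds_basis_closedBall.mem_iff.1 (hΩ.mem_nhds hx)
  -- It is enough that the relation on centres holds locally, is transitive and is symmetric.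
  -- Locally: rescale to radius R/2, slide inside a ball of radius R, and rescale again. For
  -- transitivity the intermediate mollifier may have any admissible width.
  have hP := hc.induction₂ (fun x y => ∀ ε δ, 0 < ε → 0 < δ → Metric.closedBall x ε ⊆ Ω →
    Metric.closedBall y δ ⊆ Ω →
    ∃ φ, IsTestField Ω φ ∧ ∀ z, divergence φ z = bumpAt x ε z - bumpAt y δ z) ?_ ?_ ?_
    (hx (Metric.mem_closedBall_self hε.le)) (hy (Metric.mem_closedBall_self hδ.le))
  · exact hP ε δ hε hδ hx hy
  · intro x hx
    obtain ⟨R, hR, hRΩ⟩ := ball x hx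
    filter_upwards [mem_nhdsWithin_of_mem_nhds (Metric.closedBall_mem_nhds x (half_pos hR))]
      with y hy ε δ hε hδ hxε hyδ
    have hR2 := half_pos hR
    have h1 : dist x x + R / 2 ≤ R := by simp; linarith
    have h2 : dist y x + R / 2 ≤ R := by
      have := Metric.mem_closedBall.1 hy
      linarith
    refine add (scale hε hR2 hxε ((Metric.closedBall_subset_closedBall (by linarith)).trans hRΩ))
      (add (g := bumpAt y (R / 2)) ⟨connector x y (R / 2) (R / 2),
        connector_isTestField hR2 hR2 h1 h2 hRΩ, divergence_connector hR2 hR2⟩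
      (scale hR2 hδ ?_ hyδ))
    exact (Metric.closedBall_subset_closedBall' (by linarith)).trans hRΩ
  · intro x y z _ hy _ hxy hyz ε δ hε hδ hx hz
    obtain ⟨R, hR, hRΩ⟩ := ball y hy
    exact add (hxy ε R hε hR hx hRΩ) (hyz R δ hR hδ hRΩ hz)
  · intro x y _ _ hxy ε δ hε hδ hx hy
    obtain ⟨φ, hφ, h⟩ := hxy δ ε hδ hε hy hx
    exact ⟨-φ, hφ.neg, fun z => by rw [divergence_neg, h]; ring⟩

theorem IsTestField.integrable_inner {Ω : Set E3} {φ F : E3 → E3} (hφ : IsTestField Ω φ)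
    (hF : LocallyIntegrableOn F Ω) : Integrable fun z => inner ℝ (F z) (φ z) := by
  have h1 : IntegrableOn F (tsupport φ) := hF.integrableOn_compact_subset hφ.support hφ.compact
  obtain ⟨C, hC⟩ := hφ.compact.exists_bound_of_continuous hφ.smooth.continuous
  have h2 : IntegrableOn (fun z => inner ℝ (F z) (φ z)) (tsupport φ) := by
    refine (h1.norm.mul_const C).mono'
      (h1.aestronglyMeasurable.inner hφ.smooth.continuous.aestronglyMeasurable) ?_
    exact Eventually.of_forall fun z => (norm_inner_le_norm _ _).trans
      (mul_le_mul_of_nonneg_left (hC z) (norm_nonneg _))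
  refine (integrableOn_iff_integrable_of_support_subset fun z hz => ?_).1 h2
  by_contra h
  exact hz (by simp [image_eq_zero_of_notMem_tsupport h])

/-- `x` is a Lebesgue point of `F`. -/
def IsLebesguePoint (F : E3 → E3) (x : E3) : Prop :=
  ∀ θ > 0, ∃ r₀ > 0, ∀ r, 0 < r → r < r₀ →
    ∫ z in Metric.closedBall x r, ‖F z - F x‖ ≤ θ * r ^ 3

theorem integral_mul_bumpAt_le {c x : E3} {R ε L : ℝ} {g : E3 → ℝ} (hε : 0 < ε)
    (h0 : ∀ z, 0 ≤ g z)
    (hL : ∀ᵐ z ∂volume.restrict (Metric.closedBall c R), g z ≤ L) (hL0 : 0 ≤ L) :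
    ∫ z in Metric.closedBall c R, g z * bumpAt x ε z ≤ L := by
  have hb : Integrable (bumpAt x ε) :=
    (bumpAt_contDiff x ε).continuous.integrable_of_hasCompactSupport
      (bumpAt_hasCompactSupport x hε)
  calc ∫ z in Metric.closedBall c R, g z * bumpAt x ε z
      ≤ ∫ z in Metric.closedBall c R, L * bumpAt x ε z := by
        refine integral_mono_of_nonneg (Eventually.of_forall fun z =>
          mul_nonneg (h0 z) (bumpAt_nonneg hε z)) (hb.integrableOn.const_mul L) ?_
        filter_upwards [hL] with z hz
        exact mul_le_mul_of_nonneg_right hz (bumpAt_nonneg hε z)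
    _ ≤ ∫ z, L * bumpAt x ε z := setIntegral_le_integral (hb.const_mul L)
        (Eventually.of_forall fun z => mul_nonneg hL0 (bumpAt_nonneg hε z))
    _ = L := by rw [integral_const_mul, integral_bumpAt x hε, mul_one]

/-- The regularised potential of a field that is orthogonal to divergence-free test fields. -/
theorem exists_regularised_potential {Ω : Set E3} (hΩ : IsOpen Ω) (hc : IsConnected Ω)
    {T : Set ℝ} {F : ℝ → E3 → E3} (hF : ∀ t ∈ T, LocallyIntegrableOn (F t) Ω)
    (hcont : ∀ φ, IsTestField Ω φ → ContinuousOn (fun t => ∫ z, inner ℝ (F t z) (φ z)) T)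
    (hzero : ∀ φ, IsTestField Ω φ → (∀ z, divergence φ z = 0) → ∀ t ∈ T,
      ∫ z, inner ℝ (F t z) (φ z) = 0) :
    ∃ P : ℝ → E3 → ℝ → ℝ,
      (∀ x ε, 0 < ε → Metric.closedBall x ε ⊆ Ω → ContinuousOn (fun t => P t x ε) T) ∧
      ∀ t ∈ T, ∀ x y c ε δ R, 0 < ε → 0 < δ → dist x c + ε ≤ R → dist y c + δ ≤ R →
        Metric.closedBall c R ⊆ Ω →
        P t x ε - P t y δ = ∫ z, inner ℝ (F t z) (connector x y ε δ z) := by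
  obtain ⟨x₀, hx₀⟩ := hc.nonempty
  obtain ⟨ε₀, hε₀, hε₀Ω⟩ := Metric.nhds_basis_closedBall.mem_iff.1 (hΩ.mem_nhds hx₀)
  -- The conditions on x and ε stand after the existential so that `choose` yields a field for all
  -- arguments; the value 0 is irrelevant where they fail.
  have hex : ∀ x ε, ∃ φ, 0 < ε → Metric.closedBall x ε ⊆ Ω → IsTestField Ω φ ∧
      ∀ z, divergence φ z = bumpAt x ε z - bumpAt x₀ ε₀ z := by
    intro x ε
    by_cases h : 0 < ε ∧ Metric.closedBall x ε ⊆ Ω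
    · obtain ⟨φ, hφ⟩ := exists_testField_divergence_eq hΩ hc.isPreconnected h.1 hε₀ h.2 hε₀Ω
      exact ⟨φ, fun _ _ => hφ⟩
    · exact ⟨0, fun h1 h2 => absurd ⟨h1, h2⟩ h⟩
  choose φ hφ using hex
  refine ⟨fun t x ε => ∫ z, inner ℝ (F t z) (φ x ε z), fun x ε hε hx =>
    hcont _ (hφ x ε hε hx).1, ?_⟩
  intro t ht x y c ε δ R hε hδ hx hy hR
  have h1 := hφ x ε hε ((Metric.closedBall_subset_closedBall' (by linarith)).trans hR)
  have h2 := hφ y δ hδ ((Metric.closedBall_subset_closedBall' (by linarith)).trans hR)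
  have h3 := connector_isTestField hε hδ hx hy hR
  have hd : ∀ {ψ : E3 → E3}, IsTestField Ω ψ → ∀ z, DifferentiableAt ℝ ψ z :=
    fun hψ z => hψ.smooth.differentiable (by simp) z
  -- Both joining fields end at the same reference mollifier, so their difference has the divergence
  -- of the connector.
  have h4 := hzero (φ x ε + (-(φ y δ) + -connector x y ε δ)) (h1.1.add (h2.1.neg.add h3.neg))
    (fun z => by
      rw [divergence_add (hd h1.1 z) (hd (h2.1.neg.add h3.neg) z),
        divergence_add (hd h2.1.neg z) (hd h3.neg z), divergence_neg, divergence_neg, h1.2, h2.2,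
        divergence_connector hε hδ]
      ring) t ht
  have i1 := h1.1.integrable_inner (hF t ht)
  have i2 := h2.1.integrable_inner (hF t ht)
  have i3 := h3.integrable_inner (hF t ht)
  have h5 : ∫ z, inner ℝ (F t z) ((φ x ε + (-(φ y δ) + -connector x y ε δ)) z) =
      (∫ z, inner ℝ (F t z) (φ x ε z)) - (∫ z, inner ℝ (F t z) (φ y δ z)) -
        ∫ z, inner ℝ (F t z) (connector x y ε δ z) := by
    have i4 : Integrable fun z => inner ℝ (F t z) (φ x ε z) - inner ℝ (F t z) (φ y δ z) :=
      i1.sub i2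
    rw [← integral_sub i1 i2, ← integral_sub i4 i3]
    refine integral_congr_ae (Eventually.of_forall fun z => ?_)
    simp only [Pi.add_apply, Pi.neg_apply, inner_add_right, inner_neg_right]
    ring
  show (∫ z, inner ℝ (F t z) (φ x ε z)) - (∫ z, inner ℝ (F t z) (φ y δ z)) = _
  linarith

/-- A locally bounded field that depends weakly continuously on `t` and is orthogonal to the
divergence-free test fields is minus the gradient of a potential, at all its Lebesgue points. -/
theorem exists_potential {Ω : Set E3} (hΩ : IsOpen Ω) (hc : IsConnected Ω)
    {T : Set ℝ} {F : ℝ → E3 → E3} (hF : ∀ t ∈ T, LocallyIntegrableOn (F t) Ω)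
    (hbd : ∀ t₀ ∈ T, ∀ x₀ ∈ Ω, ∃ L R, 0 ≤ L ∧ 0 < R ∧ Metric.closedBall x₀ R ⊆ Ω ∧
      ∀ᶠ t in 𝓝[T] t₀, ∀ᵐ z ∂volume.restrict (Metric.closedBall x₀ R), ‖F t z‖ ≤ L)
    (hcont : ∀ φ, IsTestField Ω φ → ContinuousOn (fun t => ∫ z, inner ℝ (F t z) (φ z)) T)
    (hzero : ∀ φ, IsTestField Ω φ → (∀ z, divergence φ z = 0) → ∀ t ∈ T,
      ∫ z, inner ℝ (F t z) (φ z) = 0) :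
    ∃ p : ℝ → E3 → ℝ, ContinuousOn (fun z : ℝ × E3 => p z.1 z.2) (T ×ˢ Ω) ∧
      (∀ t ∈ T, LocallyLipschitzOn Ω (p t)) ∧
      ∀ t ∈ T, ∀ x ∈ Ω, IsLebesguePoint (F t) x →
        HasFDerivAt (p t) (-innerSL ℝ (F t x)) x := by
  obtain ⟨P, hPc, hP⟩ := exists_regularised_potential hΩ hc hF hcont hzero
  have hmeas : ∀ t ∈ T, ∀ c R, Metric.closedBall c R ⊆ Ω →
      IntegrableOn (F t) (Metric.closedBall c R) := fun t ht c R hR =>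
    (hF t ht).integrableOn_compact_subset hR (isCompact_closedBall c R)
  -- With comparison vector 0, the deviation bound is just the bound L on F.
  have est : ∀ t ∈ T, ∀ c R L, 0 ≤ L → Metric.closedBall c R ⊆ Ω →
      (∀ᵐ z ∂volume.restrict (Metric.closedBall c R), ‖F t z‖ ≤ L) →
      ∀ x y ε δ, 0 < ε → 0 < δ → dist x c + ε ≤ R → dist y c + δ ≤ R →
        |P t x ε - P t y δ| ≤ L * (‖y - x‖ + |δ - ε|) := by
    intro t ht c R L hL0 hR hL x y ε δ hε hδ hx hy
    rw [hP t ht x y c ε δ R hε hδ hx hy hR]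
    have := abs_integral_inner_connector_sub_le (B := L) 0 hε hδ hx hy
      (hmeas t ht c R hR).aestronglyMeasurable hL (fun r hr => by
        simp only [sub_zero]
        exact integral_mul_bumpAt_le (connWidth_pos hε hδ hr) (fun z => norm_nonneg _) hL hL0)
    rw [inner_zero_left, sub_zero] at this
    linarith
  -- At a fixed centre the estimate bounds the oscillation in the width by L times the difference of
  -- widths, so the limit exists by the Cauchy criterion; `limUnder` needs no proof that it exists.
  set p : ℝ → E3 → ℝ := fun t x => limUnder (𝓝[>] 0) (P t x) with hp
  have htend : ∀ t ∈ T, ∀ c R L, 0 ≤ L → Metric.closedBall c R ⊆ Ω →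
      (∀ᵐ z ∂volume.restrict (Metric.closedBall c R), ‖F t z‖ ≤ L) →
      ∀ x, dist x c < R → Tendsto (P t x) (𝓝[>] 0) (𝓝 (p t x)) := by
    intro t ht c R L hL0 hR hL x hx
    refine tendsto_nhds_limUnder (cauchy_map_iff_exists_tendsto.1 ?_)
    refine Metric.cauchy_iff.2 ⟨inferInstance, fun e he => ?_⟩
    set η := min (R - dist x c) (e / (L + 1)) with hη
    have hη0 : 0 < η := lt_min (by linarith) (by positivity)
    refine ⟨_, image_mem_map (Ioo_mem_nhdsGT hη0), ?_⟩
    rintro _ ⟨a, ha, rfl⟩ _ ⟨b, hb, rfl⟩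
    have h1 := min_le_left (R - dist x c) (e / (L + 1))
    have h2 := min_le_right (R - dist x c) (e / (L + 1))
    have h3 := est t ht c R L hL0 hR hL x x a b ha.1 hb.1 (by linarith [ha.2])
      (by linarith [hb.2])
    rw [Real.dist_eq]
    refine h3.trans_lt ?_
    rw [sub_self, norm_zero, zero_add]
    have h4 : |b - a| ≤ η := by
      rw [abs_le]; constructor <;> linarith [ha.1, ha.2, hb.1, hb.2]
    have h5 : (L + 1) * η ≤ e := by
      calc (L + 1) * η ≤ (L + 1) * (e / (L + 1)) :=
            mul_le_mul_of_nonneg_left h2 (by linarith)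
        _ = e := by field_simp
    have h6 := mul_le_mul_of_nonneg_left h4 hL0
    linarith
  have hlim : ∀ t ∈ T, ∀ c R L, 0 ≤ L → Metric.closedBall c R ⊆ Ω →
      (∀ᵐ z ∂volume.restrict (Metric.closedBall c R), ‖F t z‖ ≤ L) →
      ∀ x ε, 0 < ε → dist x c + ε ≤ R → |P t x ε - p t x| ≤ L * ε := by
    intro t ht c R L hL0 hR hL x ε hε hx
    have h1 := ((htend t ht c R L hL0 hR hL x (by linarith)).const_sub (P t x ε)).abs
    refine le_of_tendsto h1 ?_
    filter_upwards [Ioo_mem_nhdsGT hε] with δ hδ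
    refine (est t ht c R L hL0 hR hL x x ε δ hε hδ.1 hx (by linarith [hδ.2])).trans ?_
    rw [sub_self, norm_zero, zero_add]
    refine mul_le_mul_of_nonneg_left ?_ hL0
    rw [abs_le]; constructor <;> linarith [hδ.1, hδ.2]
  have hlip : ∀ t ∈ T, ∀ c R L, 0 ≤ L → Metric.closedBall c R ⊆ Ω →
      (∀ᵐ z ∂volume.restrict (Metric.closedBall c R), ‖F t z‖ ≤ L) →
      ∀ x y, dist x c < R → dist y c < R → |p t x - p t y| ≤ L * ‖y - x‖ := by
    intro t ht c R L hL0 hR hL x y hx hy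
    have h1 := ((htend t ht c R L hL0 hR hL x hx).sub (htend t ht c R L hL0 hR hL y hy)).abs
    refine le_of_tendsto h1 ?_
    have h0 : 0 < min (R - dist x c) (R - dist y c) := lt_min (by linarith) (by linarith)
    filter_upwards [Ioo_mem_nhdsGT h0] with δ hδ
    have h2 := min_le_left (R - dist x c) (R - dist y c)
    have h3 := min_le_right (R - dist x c) (R - dist y c)
    have := est t ht c R L hL0 hR hL x y δ δ hδ.1 hδ.1 (by linarith [hδ.2]) (by linarith [hδ.2])
    simpa using this
  refine ⟨p, ?_, ?_, ?_⟩
  · rintro ⟨t₀, x₀⟩ ⟨ht₀, hx₀⟩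
    obtain ⟨L, R, hL0, hR0, hRΩ, hL⟩ := hbd t₀ ht₀ x₀ hx₀
    refine Metric.tendsto_nhds.2 fun e he => ?_
    -- Four errors of e/4 are added: moving from x to x₀, regularising at time t, changing the time
    -- at fixed width, and regularising at t₀. Using L + 1 avoids division by zero.
    set ε := min R (e / (4 * (L + 1))) with hε
    have hε0 : 0 < ε := lt_min hR0 (by positivity)
    have hεR : ε ≤ R := min_le_left _ _
    have hεe : L * ε ≤ e / 4 := by
      calc L * ε ≤ (L + 1) * (e / (4 * (L + 1))) :=
            mul_le_mul (by linarith) (min_le_right _ _) hε0.le (by linarith)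
        _ = e / 4 := by field_simp
    have h1 : ∀ᶠ t in 𝓝[T] t₀, |P t x₀ ε - P t₀ x₀ ε| < e / 4 := by
      have := Metric.tendsto_nhds.1 (hPc x₀ ε hε0
        ((Metric.closedBall_subset_closedBall hεR).trans hRΩ) t₀ ht₀) (e / 4) (by linarith)
      simpa [Real.dist_eq] using this
    have h2 : ∀ᶠ x in 𝓝[Ω] x₀, dist x x₀ < ε :=
      mem_nhdsWithin_of_mem_nhds (Metric.ball_mem_nhds x₀ hε0)
    have h3 := hL.self_of_nhdsWithin ht₀
    rw [nhdsWithin_prod_eq]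
    filter_upwards [((hL.and h1).and self_mem_nhdsWithin).prod_mk h2]
    rintro ⟨t, x⟩ ⟨⟨⟨hLt, hPt⟩, ht⟩, hx⟩
    simp only at hLt hPt ht hx ⊢
    have a1 := hlip t ht x₀ R L hL0 hRΩ hLt x x₀ (by linarith) (by simpa using hR0)
    have a2 := hlim t ht x₀ R L hL0 hRΩ hLt x₀ ε hε0 (by simpa using hεR)
    have a3 := hlim t₀ ht₀ x₀ R L hL0 hRΩ h3 x₀ ε hε0 (by simpa using hεR)
    have a4 : L * ‖x₀ - x‖ ≤ L * ε := by
      refine mul_le_mul_of_nonneg_left ?_ hL0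
      rw [← dist_eq_norm, dist_comm]
      exact hx.le
    rw [Real.dist_eq]
    rw [abs_lt] at hPt ⊢
    rw [abs_le] at a1 a2 a3
    constructor <;> linarith [a1.1, a1.2, a2.1, a2.2, a3.1, a3.2, hPt.1, hPt.2]
  · intro t ht x hx
    obtain ⟨L, R, hL0, hR0, hRΩ, hL⟩ := hbd t ht x hx
    refine ⟨⟨L, hL0⟩, Metric.ball x R,
      mem_nhdsWithin_of_mem_nhds (Metric.ball_mem_nhds x hR0), ?_⟩
    refine LipschitzOnWith.of_dist_le_mul fun y hy z hz => ?_
    have := hlip t ht x R L hL0 hRΩ (hL.self_of_nhdsWithin ht) y z hy hz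
    rwa [Real.dist_eq, dist_comm, dist_eq_norm]
  · intro t ht x hx hleb
    obtain ⟨L, R, hL0, hR0, hRΩ, hL'⟩ := hbd t ht x hx
    have hL := hL'.self_of_nhdsWithin ht
    obtain ⟨M, hM0, hM⟩ := exists_mollifier_le
    refine HasFDerivAt.of_isLittleO (Asymptotics.isLittleO_iff.2 fun e he => ?_)
    -- The mollifiers have width κ times d = |y - x|. Each of the two regularisation errors is then
    -- at most L κ d ≤ (e/4) d, which leaves (e/2) d for the connector.
    set κ := min 1 (e / (4 * (L + 1))) with hκ
    have hκ0 : 0 < κ := lt_min one_pos (by positivity)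
    have hκ1 : κ ≤ 1 := min_le_left _ _
    have hκe : L * κ ≤ e / 4 := by
      calc L * κ ≤ (L + 1) * (e / (4 * (L + 1))) :=
            mul_le_mul (by linarith) (min_le_right _ _) hκ0.le (by linarith)
        _ = e / 4 := by field_simp
    -- A mollifier of width κd is at most M (κd)⁻³, and the ball of radius d + κd has oscillation at
    -- most θ (d + κd)³. The product is M θ (1 + κ⁻¹)³, which this θ makes equal to e/2.
    obtain ⟨r₀, hr₀, hθ⟩ := hleb (e / (2 * M * (1 + κ⁻¹) ^ 3)) (by positivity)
    have hr : 0 < min R r₀ / 2 := half_pos (lt_min hR0 hr₀)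
    filter_upwards [Metric.ball_mem_nhds x hr] with y hy
    rw [Metric.mem_ball, dist_eq_norm] at hy
    set d := ‖y - x‖ with hd
    rcases (norm_nonneg (y - x)).eq_or_lt with h0 | h0
    · have : y = x := by
        rw [← sub_eq_zero]; exact norm_eq_zero.1 h0.symm
      simp [this, hd]
    rw [← hd] at h0
    have hm1 := min_le_left R r₀
    have hm2 := min_le_right R r₀
    have hε0 : 0 < κ * d := mul_pos hκ0 h0
    have hεd : κ * d ≤ d := mul_le_of_le_one_left h0.le hκ1
    have hyx : dist y x = d := dist_eq_norm y x
    have hsub : Metric.closedBall x (d + κ * d) ⊆ Metric.closedBall x R :=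
      Metric.closedBall_subset_closedBall (by linarith)
    have b1 := hlim t ht x R L hL0 hRΩ hL x (κ * d) hε0 (by rw [dist_self]; linarith)
    have b2 := hlim t ht x R L hL0 hRΩ hL y (κ * d) hε0 (by rw [hyx]; linarith)
    have hLe : L * (κ * d) ≤ e / 4 * d := by
      rw [← mul_assoc]; exact mul_le_mul_of_nonneg_right hκe h0.le
    have hFi := hmeas t ht x (d + κ * d) (hsub.trans hRΩ)
    have hFx : Integrable (fun z => F t z - F t x)
        (volume.restrict (Metric.closedBall x (d + κ * d))) :=
      hFi.sub (integrableOn_const (isCompact_closedBall x _).measure_lt_top.ne)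
    have b3 := abs_integral_inner_connector_sub_le (x := x) (y := y) (c := x)
      (R := d + κ * d) (L := L) (B := e / 2)
      (F t x) hε0 hε0 (by rw [dist_self]; linarith) (by rw [hyx])
      hFi.aestronglyMeasurable
      (ae_mono (Measure.restrict_mono hsub le_rfl) hL) (fun r _ => by
        have hw : connWidth (κ * d) (κ * d) r = κ * d := by simp [connWidth]
        rw [hw]
        have h1 : ∀ z, ‖F t z - F t x‖ * bumpAt (connCenter x y r) (κ * d) z ≤
            ((κ * d) ^ 3)⁻¹ * M * ‖F t z - F t x‖ := by
          intro z
          rw [mul_comm]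
          refine mul_le_mul_of_nonneg_right ?_ (norm_nonneg _)
          exact mul_le_mul_of_nonneg_left (hM _) (by positivity)
        calc _ ≤ ∫ z in Metric.closedBall x (d + κ * d),
                ((κ * d) ^ 3)⁻¹ * M * ‖F t z - F t x‖ :=
              integral_mono_of_nonneg (Eventually.of_forall fun z =>
                mul_nonneg (norm_nonneg _) (bumpAt_nonneg hε0 z)) (hFx.norm.const_mul _)
                (Eventually.of_forall h1)
          _ = ((κ * d) ^ 3)⁻¹ * M * ∫ z in Metric.closedBall x (d + κ * d),
                ‖F t z - F t x‖ := integral_const_mul _ _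
          _ ≤ ((κ * d) ^ 3)⁻¹ * M * (e / (2 * M * (1 + κ⁻¹) ^ 3) * (d + κ * d) ^ 3) :=
              mul_le_mul_of_nonneg_left (hθ _ (by linarith) (by linarith)) (by positivity)
          _ = e / 2 := by field_simp; ring)
    rw [← hP t ht x y x (κ * d) (κ * d) (d + κ * d) hε0 hε0 (by rw [dist_self]; linarith)
      (by rw [hyx]) (hsub.trans hRΩ), ← hd, sub_self, abs_zero, add_zero] at b3
    have hgoal : p t y - p t x - (-innerSL ℝ (F t x)) (y - x) =
        p t y - p t x + inner ℝ (F t x) (y - x) := by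
      simp
    rw [hgoal, Real.norm_eq_abs]
    rw [abs_le] at b1 b2 b3 ⊢
    constructor <;> linarith [b1.1, b1.2, b2.1, b2.2, b3.1, b3.2]

/-! ### Partial derivatives, labels and smoothness of the Eulerian fields -/

section Partial
variable {P X F : Type*} [NormedAddCommGroup P] [NormedSpace ℝ P] [NormedAddCommGroup X]
  [NormedSpace ℝ X] [NormedAddCommGroup F] [NormedSpace ℝ F]

theorem hasFDerivAt_partial_snd {f : P × X → F} {z : P × X} (hf : DifferentiableAt ℝ f z) :
    HasFDerivAt (fun x => f (z.1, x)) ((fderiv ℝ f z).comp (ContinuousLinearMap.inr ℝ P X)) z.2 :=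
  HasFDerivAt.comp (g := f) z.2 hf.hasFDerivAt (hasFDerivAt_prodMk_right z.1 z.2)

theorem hasDerivAt_partial_fst {f : ℝ × X → F} {z : ℝ × X} (hf : DifferentiableAt ℝ f z) :
    HasDerivAt (fun s => f (s, z.2)) (fderiv ℝ f z (1, 0)) z.1 := by
  have h : HasDerivAt (fun s : ℝ => (s, z.2)) ((1 : ℝ), (0 : X)) z.1 :=
    (hasDerivAt_id z.1).prodMk (hasDerivAt_const z.1 z.2)
  exact HasFDerivAt.comp_hasDerivAt (l := f) z.1 hf.hasFDerivAt h

theorem contDiffOn_partial_snd {f : P × X → F} {W : Set (P × X)} (hW : IsOpen W)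
    (hf : ContDiffOn ℝ ∞ f W) :
    ContDiffOn ℝ ∞ (fun z : P × X => fderiv ℝ (fun x => f (z.1, x)) z.2) W := by
  have h : ContDiffOn ℝ ∞ (fun z => (fderiv ℝ f z).comp (ContinuousLinearMap.inr ℝ P X)) W :=
    (hf.fderiv_of_isOpen hW (by simp)).clm_comp contDiffOn_const
  refine h.congr fun z hz => ?_
  exact (hasFDerivAt_partial_snd ((hf.contDiffAt (hW.mem_nhds hz)).differentiableAt
    (by simp))).fderiv

theorem contDiffOn_partial_fst {f : ℝ × X → F} {W : Set (ℝ × X)} (hW : IsOpen W)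
    (hf : ContDiffOn ℝ ∞ f W) :
    ContDiffOn ℝ ∞ (fun z : ℝ × X => deriv (fun s => f (s, z.2)) z.1) W := by
  have h : ContDiffOn ℝ ∞ (fun z => fderiv ℝ f z (1, 0)) W :=
    (hf.fderiv_of_isOpen hW (by simp)).clm_apply contDiffOn_const
  refine h.congr fun z hz => ?_
  exact (hasDerivAt_partial_fst ((hf.contDiffAt (hW.mem_nhds hz)).differentiableAt
    (by simp))).deriv

/-- Symmetry of second derivatives, in the form that exchanges the derivative in the variation
parameter with those in space or time. -/
theorem hasDerivAt_fderiv_apply_comm {f : X → F} {z e w : X} (hf : ContDiffAt ℝ ∞ f z) :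
    fderiv ℝ (fun z => fderiv ℝ f z w) z e = fderiv ℝ (fun z => fderiv ℝ f z e) z w := by
  have hd : DifferentiableAt ℝ (fderiv ℝ f) z :=
    (hf.fderiv_right (m := ∞) (by simp)).differentiableAt (by simp)
  have h := (hf.isSymmSndFDerivAt (by
    rw [minSmoothness_of_isRCLikeNormedField]; exact WithTop.coe_le_coe.2 le_top)).eq e w
  have h1 : ∀ w, fderiv ℝ (fun z => fderiv ℝ f z w) z = (fderiv ℝ (fderiv ℝ f) z).flip w := by
    intro w
    rw [fderiv_clm_apply hd (differentiableAt_const w)]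
    simp
  rw [h1, h1]
  exact h

end Partial

section Label
variable {Ω : Set E3} {T₀ : ℝ} {γ : ℝ → E3 → E3} {t : ℝ} {x y : E3}

theorem label_mem (hd : IsDiffeo Ω (γ t)) (hx : x ∈ Ω) : label Ω γ t x ∈ Ω :=
  Function.invFunOn_mem (hd.bijOn.surjOn hx)

theorem apply_label (hd : IsDiffeo Ω (γ t)) (hx : x ∈ Ω) : γ t (label Ω γ t x) = x :=
  Function.invFunOn_eq (hd.bijOn.surjOn hx)

theorem label_apply (hd : IsDiffeo Ω (γ t)) (hy : y ∈ Ω) : label Ω γ t (γ t y) = y :=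
  hd.bijOn.injOn.leftInvOn_invFunOn hy

theorem transported_apply (f : E3 → ℝ) (hd : IsDiffeo Ω (γ t)) (hy : y ∈ Ω) :
    transported Ω γ f t (γ t y) = f y := by
  rw [transported, label_apply hd hy]

/-- The label is a smooth function of time and position. -/
theorem contDiffOn_label (hΩ : IsOpen Ω)
    (hs : ContDiffOn ℝ ∞ (fun z : ℝ × E3 => γ z.1 z.2) (Ioo 0 T₀ ×ˢ Ω))
    (hd : ∀ t ∈ Ioo 0 T₀, IsDiffeo Ω (γ t)) :
    ContDiffOn ℝ ∞ (fun z : ℝ × E3 => label Ω γ z.1 z.2) (Ioo 0 T₀ ×ˢ Ω) := by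
  have hW : IsOpen (Ioo 0 T₀ ×ˢ Ω) := isOpen_Ioo.prod hΩ
  rintro ⟨t₀, x₀⟩ ⟨ht₀, hx₀⟩
  simp only at ht₀ hx₀
  set y₀ := label Ω γ t₀ x₀ with hy₀
  have hy₀Ω : y₀ ∈ Ω := label_mem (hd t₀ ht₀) hx₀
  have hfy₀ : γ t₀ y₀ = x₀ := apply_label (hd t₀ ht₀) hx₀
  -- The inverse function theorem is applied to (t, y) ↦ (t, γ_t y) on space-time. Its derivative is
  -- block triangular, so it is injective because the spatial Jacobian does not vanish.
  set f : ℝ × E3 → ℝ × E3 := fun z => (z.1, γ z.1 z.2) with hf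
  have hγ : ContDiffAt ℝ ∞ (fun z : ℝ × E3 => γ z.1 z.2) (t₀, y₀) :=
    hs.contDiffAt (hW.mem_nhds ⟨ht₀, hy₀Ω⟩)
  have hfc : ContDiffAt ℝ ∞ f (t₀, y₀) := contDiffAt_fst.prodMk hγ
  have hγd := hγ.differentiableAt (by simp)
  have hf' : HasFDerivAt f ((ContinuousLinearMap.fst ℝ ℝ E3).prod
      (fderiv ℝ (fun z : ℝ × E3 => γ z.1 z.2) (t₀, y₀))) (t₀, y₀) :=
    hasFDerivAt_fst.prodMk hγd.hasFDerivAt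
  have hker : Function.Injective ((ContinuousLinearMap.fst ℝ ℝ E3).prod
      (fderiv ℝ (fun z : ℝ × E3 => γ z.1 z.2) (t₀, y₀))) := by
    rw [injective_iff_map_eq_zero]
    rintro ⟨τ, h⟩ h0
    have h1 : τ = 0 := congrArg Prod.fst h0
    subst h1
    have h2 : fderiv ℝ (fun z : ℝ × E3 => γ z.1 z.2) (t₀, y₀) (0, h) = 0 := congrArg Prod.snd h0
    have h3 : fderiv ℝ (γ t₀) y₀ h = 0 := by
      have := (hasFDerivAt_partial_snd (f := fun z : ℝ × E3 => γ z.1 z.2) hγd).fderiv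
      simp only at this
      rw [this]
      simpa using h2
    have h4 := ((hd t₀ ht₀).jacobian_pos y₀ hy₀Ω).ne'
    have h5 : LinearMap.ker (fderiv ℝ (γ t₀) y₀ : E3 →ₗ[ℝ] E3) = ⊥ := by
      by_contra hne
      exact h4 (LinearMap.det_eq_zero_iff_ker_ne_bot.2 hne)
    have h6 : h = 0 := by
      have : h ∈ LinearMap.ker (fderiv ℝ (γ t₀) y₀ : E3 →ₗ[ℝ] E3) := h3
      rwa [h5, Submodule.mem_bot] at this
    rw [h6]; rfl
  let e : (ℝ × E3) ≃L[ℝ] (ℝ × E3) := (LinearEquiv.ofInjectiveEndo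
    (((ContinuousLinearMap.fst ℝ ℝ E3).prod
      (fderiv ℝ (fun z : ℝ × E3 => γ z.1 z.2) (t₀, y₀)) : (ℝ × E3) →L[ℝ] (ℝ × E3)) :
      (ℝ × E3) →ₗ[ℝ] (ℝ × E3)) hker).toContinuousLinearEquiv
  have hfe : HasFDerivAt f (e : (ℝ × E3) →L[ℝ] (ℝ × E3)) (t₀, y₀) := by
    convert! hf' using 1
  have hinv := hfc.to_localInverse hfe (by simp)
  set ℓ := hfc.localInverse hfe (by simp) with hℓ
  have hfb : f (t₀, y₀) = (t₀, x₀) := by rw [hf]; simp [hfy₀]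
  have hℓb : ℓ (t₀, x₀) = (t₀, y₀) := by
    rw [← hfb]; exact hfc.localInverse_apply_image hfe (by simp)
  rw [hfb] at hinv
  have hright : ∀ᶠ z in 𝓝 (t₀, x₀), f (ℓ z) = z := by
    have := (hfc.hasStrictFDerivAt' hfe (by simp)).eventually_right_inverse
    rwa [hfb] at this
  have hmem : ∀ᶠ z in 𝓝 (t₀, x₀), ℓ z ∈ Ioo 0 T₀ ×ˢ Ω :=
    hinv.continuousAt (by rw [hℓb]; exact hW.mem_nhds ⟨ht₀, hy₀Ω⟩)
  refine ContDiffAt.contDiffWithinAt ?_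
  refine (contDiffAt_snd.comp (t₀, x₀) hinv).congr_of_eventuallyEq ?_
  -- The local inverse preserves the time and takes values in Ω, so injectivity of γ_t identifies
  -- its second component with the label.
  filter_upwards [hright, hmem] with z hz1 hz2
  have h1 : (ℓ z).1 = z.1 := (by rw [hz1] : (f (ℓ z)).1 = z.1)
  have h2 : γ (ℓ z).1 (ℓ z).2 = z.2 := (by rw [hz1] : (f (ℓ z)).2 = z.2)
  rw [h1] at h2
  have h3 : z.1 ∈ Ioo 0 T₀ := h1 ▸ hz2.1
  show label Ω γ z.1 z.2 = (ℓ z).2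
  rw [← h2, label_apply (hd _ h3) hz2.2]

theorem IsDiffeo.differentiableAt {f : E3 → E3} (hΩ : IsOpen Ω) (hf : IsDiffeo Ω f)
    (hx : x ∈ Ω) : DifferentiableAt ℝ f x :=
  (hf.smooth.contDiffAt (hΩ.mem_nhds hx)).differentiableAt (by simp)

/-- Change of variables for a diffeomorphism. -/
theorem IsDiffeo.integral_comp {f : E3 → E3} (hΩ : IsOpen Ω) (hf : IsDiffeo Ω f) (g : E3 → ℝ) :
    ∫ x in Ω, g x = ∫ y in Ω, (fderiv ℝ f y).det * g (f y) := by
  have h := integral_image_eq_integral_abs_det_fderiv_smul volume hΩ.measurableSet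
    (fun y hy => (hf.differentiableAt hΩ hy).hasFDerivAt.hasFDerivWithinAt) hf.bijOn.injOn g
  rw [hf.bijOn.image_eq] at h
  rw [h]
  refine setIntegral_congr_fun hΩ.measurableSet fun y hy => ?_
  simp only [smul_eq_mul, abs_of_pos (hf.jacobian_pos y hy)]

end Label

section Fields
variable {Ω : Set E3} {T₀ : ℝ} {γ : ℝ → E3 → E3}

theorem IsMotion.isOpen_domain (hΩ : IsOpen Ω) (T₀ : ℝ) : IsOpen (Ioo 0 T₀ ×ˢ Ω) :=
  isOpen_Ioo.prod hΩ

theorem IsMotion.label_contDiffOn (hΩ : IsOpen Ω) (hγ : IsMotion Ω T₀ γ) :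
    ContDiffOn ℝ ∞ (fun z : ℝ × E3 => label Ω γ z.1 z.2) (Ioo 0 T₀ ×ˢ Ω) :=
  contDiffOn_label hΩ hγ.smooth hγ.diffeo

theorem IsMotion.mapsTo_label (hγ : IsMotion Ω T₀ γ) :
    MapsTo (fun z : ℝ × E3 => (z.1, label Ω γ z.1 z.2)) (Ioo 0 T₀ ×ˢ Ω) (Ioo 0 T₀ ×ˢ Ω) :=
  fun _ hz => ⟨hz.1, label_mem (hγ.diffeo _ hz.1) hz.2⟩

theorem IsMotion.lagrangian_comp_label {F : Type*} [NormedAddCommGroup F] [NormedSpace ℝ F]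
    (hΩ : IsOpen Ω) (hγ : IsMotion Ω T₀ γ) {g : ℝ × E3 → F}
    (hg : ContDiffOn ℝ ∞ g (Ioo 0 T₀ ×ˢ Ω)) :
    ContDiffOn ℝ ∞ (fun z : ℝ × E3 => g (z.1, label Ω γ z.1 z.2)) (Ioo 0 T₀ ×ˢ Ω) :=
  hg.comp (contDiffOn_fst.prodMk (hγ.label_contDiffOn hΩ)) hγ.mapsTo_label

theorem IsMotion.transported_contDiffOn (hΩ : IsOpen Ω) (hγ : IsMotion Ω T₀ γ) {f : E3 → ℝ}
    (hf : ContDiffOn ℝ ∞ f Ω) :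
    ContDiffOn ℝ ∞ (fun z : ℝ × E3 => transported Ω γ f z.1 z.2) (Ioo 0 T₀ ×ˢ Ω) :=
  hf.comp (hγ.label_contDiffOn hΩ) fun _ hz => label_mem (hγ.diffeo _ hz.1) hz.2

theorem IsMotion.velocity_contDiffOn (hΩ : IsOpen Ω) (hγ : IsMotion Ω T₀ γ) :
    ContDiffOn ℝ ∞ (fun z : ℝ × E3 => velocity Ω γ z.1 z.2) (Ioo 0 T₀ ×ˢ Ω) :=
  hγ.lagrangian_comp_label hΩ (g := fun z : ℝ × E3 => deriv (fun s => γ s z.2) z.1)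
    (contDiffOn_partial_fst (f := fun z : ℝ × E3 => γ z.1 z.2)
      (IsMotion.isOpen_domain hΩ T₀) hγ.smooth)

theorem IsMotion.density_contDiffOn (hΩ : IsOpen Ω) (hγ : IsMotion Ω T₀ γ)
    {ξ : Fin 3 → E3 → ℝ} (hξ : ∀ a, ContDiffOn ℝ ∞ (ξ a) Ω) (ρ : Fin 3 → ℝ) :
    ContDiffOn ℝ ∞ (fun z : ℝ × E3 => density Ω ξ ρ γ z.1 z.2) (Ioo 0 T₀ ×ˢ Ω) :=
  ContDiffOn.sum fun a _ => contDiffOn_const.mul (hγ.transported_contDiffOn hΩ (hξ a))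

theorem IsMotion.gradient_contDiffOn (hΩ : IsOpen Ω) (hγ : IsMotion Ω T₀ γ) {f : E3 → ℝ}
    (hf : ContDiffOn ℝ ∞ f Ω) :
    ContDiffOn ℝ ∞ (fun z : ℝ × E3 => gradient (transported Ω γ f z.1) z.2)
      (Ioo 0 T₀ ×ˢ Ω) :=
  (InnerProductSpace.toDual ℝ E3).symm.contDiff.comp_contDiffOn
    (contDiffOn_partial_snd (f := fun z : ℝ × E3 => transported Ω γ f z.1 z.2)
      (IsMotion.isOpen_domain hΩ T₀) (hγ.transported_contDiffOn hΩ hf))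

theorem IsMotion.momentum_contDiffOn (hΩ : IsOpen Ω) (hγ : IsMotion Ω T₀ γ)
    {ξ : Fin 3 → E3 → ℝ} (hξ : ∀ a, ContDiffOn ℝ ∞ (ξ a) Ω) (ρ : Fin 3 → ℝ) :
    ContDiffOn ℝ ∞ (fun z : ℝ × E3 => density Ω ξ ρ γ z.1 z.2 • velocity Ω γ z.1 z.2)
      (Ioo 0 T₀ ×ˢ Ω) :=
  (hγ.density_contDiffOn hΩ hξ ρ).smul (hγ.velocity_contDiffOn hΩ)

theorem IsMotion.materialDeriv_contDiffOn (hΩ : IsOpen Ω) (hγ : IsMotion Ω T₀ γ)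
    {m : ℝ → E3 → E3} (hm : ContDiffOn ℝ ∞ (fun z : ℝ × E3 => m z.1 z.2) (Ioo 0 T₀ ×ˢ Ω)) :
    ContDiffOn ℝ ∞ (fun z : ℝ × E3 => materialDeriv (velocity Ω γ) m z.1 z.2)
      (Ioo 0 T₀ ×ˢ Ω) := by
  have hW := IsMotion.isOpen_domain hΩ T₀
  exact (contDiffOn_partial_fst hW hm).add
    ((contDiffOn_partial_snd hW hm).clm_apply (hγ.velocity_contDiffOn hΩ))

/-- The material derivative is the time derivative along particle paths. -/
theorem IsMotion.hasDerivAt_along (hΩ : IsOpen Ω) (hγ : IsMotion Ω T₀ γ)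
    {m : ℝ → E3 → E3} (hm : ContDiffOn ℝ ∞ (fun z : ℝ × E3 => m z.1 z.2) (Ioo 0 T₀ ×ˢ Ω))
    {t : ℝ} (ht : t ∈ Ioo 0 T₀) {y : E3} (hy : y ∈ Ω) :
    HasDerivAt (fun s => m s (γ s y)) (materialDeriv (velocity Ω γ) m t (γ t y)) t := by
  have hW := IsMotion.isOpen_domain hΩ T₀
  have hx : γ t y ∈ Ω := (hγ.diffeo t ht).bijOn.mapsTo hy
  have hmd : DifferentiableAt ℝ (fun z : ℝ × E3 => m z.1 z.2) (t, γ t y) :=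
    (hm.contDiffAt (hW.mem_nhds ⟨ht, hx⟩)).differentiableAt (by simp)
  have hγd : DifferentiableAt ℝ (fun z : ℝ × E3 => γ z.1 z.2) (t, y) :=
    (hγ.smooth.contDiffAt (hW.mem_nhds ⟨ht, hy⟩)).differentiableAt (by simp)
  have h1 := hasDerivAt_partial_fst hγd
  have hv : velocity Ω γ t (γ t y) = fderiv ℝ (fun z : ℝ × E3 => γ z.1 z.2) (t, y) (1, 0) := by
    rw [velocity, label_apply (hγ.diffeo t ht) hy]
    exact h1.deriv
  have h2 : HasDerivAt (fun s => (s, γ s y)) ((1 : ℝ), velocity Ω γ t (γ t y)) t := by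
    rw [hv]; exact (hasDerivAt_id t).prodMk h1
  have h3 := HasFDerivAt.comp_hasDerivAt (l := fun z : ℝ × E3 => m z.1 z.2) t
    hmd.hasFDerivAt h2
  refine h3.congr_deriv ?_
  have h4 := hasDerivAt_partial_fst hmd
  have h5 := hasFDerivAt_partial_snd hmd
  simp only at h4 h5
  rw [materialDeriv, h4.deriv, h5.fderiv]
  simp only [ContinuousLinearMap.comp_apply, ContinuousLinearMap.inr_apply]
  rw [← map_add]
  simp

end Fields

/-! ### Locally Lipschitz functions and Lebesgue points -/

theorem locallyLipschitzOn_of_contDiffOn {X F : Type*} [NormedAddCommGroup X] [NormedSpace ℝ X]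
    [NormedAddCommGroup F] [NormedSpace ℝ F] {W : Set X} (hW : IsOpen W) {f : X → F}
    (hf : ContDiffOn ℝ ∞ f W) : LocallyLipschitzOn W f := by
  intro x hx
  obtain ⟨K, t, ht, h⟩ := ((hf.contDiffAt (hW.mem_nhds hx)).of_le
    (by exact_mod_cast le_top) : ContDiffAt ℝ 1 f x).exists_lipschitzOnWith
  exact ⟨K, t, mem_nhdsWithin_of_mem_nhds ht, h⟩

theorem _root_.LipschitzWith.comp_locallyLipschitzOn {X Y Z : Type*} [PseudoEMetricSpace X]
    [PseudoEMetricSpace Y] [PseudoEMetricSpace Z] {C : ℝ≥0} {G : Y → Z} (hG : LipschitzWith C G)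
    {f : X → Y} {W : Set X} (hf : LocallyLipschitzOn W f) :
    LocallyLipschitzOn W (fun x => G (f x)) := by
  intro x hx
  obtain ⟨K, t, ht, h⟩ := hf hx
  exact ⟨C * K, t, ht, hG.comp_lipschitzOnWith h⟩

/-- Integration by parts for a locally Lipschitz function against a smooth function with compact
support. -/
theorem integral_partialDeriv_mul {Ω : Set E3} (hΩ : IsOpen Ω) {f g : E3 → ℝ}
    (hf : LocallyLipschitzOn Ω f) (hg : ContDiff ℝ ∞ g) (hgc : HasCompactSupport g)
    (hgs : tsupport g ⊆ Ω) (j : Fin 3) :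
    Integrable (fun x => partialDeriv j f x * g x) ∧
    Integrable (fun x => f x * partialDeriv j g x) ∧
    ∫ x, partialDeriv j f x * g x = -∫ x, f x * partialDeriv j g x := by
  -- On a compact neighbourhood K of the support of g the function f is Lipschitz. It is replaced by
  -- a Lipschitz extension h to the whole space, which agrees with f near the support of g, so that
  -- the global formula applies.
  obtain ⟨K, hK, hgK, hKΩ⟩ := exists_compact_between hgc hΩ hgs
  obtain ⟨C, hC⟩ := (hf.mono hKΩ).exists_lipschitzOnWith_of_compact hK
  obtain ⟨h, hh, hfh⟩ := hC.extend_real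
  obtain ⟨D, hD⟩ := ContDiff.lipschitzWith_of_hasCompactSupport hgc hg (by simp)
  set e : E3 := EuclideanSpace.single j 1 with he
  have hzero : ∀ x, x ∉ tsupport g → g x = 0 ∧ partialDeriv j g x = 0 := by
    intro x hx
    refine ⟨image_eq_zero_of_notMem_tsupport hx, ?_⟩
    rw [partialDeriv, image_eq_zero_of_notMem_tsupport
      (fun h' => hx (tsupport_fderiv_subset ℝ h'))]
    simp
  have h1 : ∀ᵐ x, lineDeriv ℝ h x e * g x = partialDeriv j f x * g x := by
    filter_upwards [hh.ae_differentiableAt (μ := volume)] with x hx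
    by_cases hxg : x ∈ tsupport g
    · have : f =ᶠ[𝓝 x] h := by
        filter_upwards [isOpen_interior.mem_nhds (hgK hxg)] with y hy
        exact hfh (interior_subset hy)
      rw [hx.lineDeriv_eq_fderiv, partialDeriv, this.fderiv_eq]
    · rw [(hzero x hxg).1, mul_zero, mul_zero]
  have h2 : ∀ x, lineDeriv ℝ g x (-e) * h x = -(f x * partialDeriv j g x) := by
    intro x
    rw [(hg.differentiable (by simp) x).lineDeriv_eq_fderiv, map_neg]
    by_cases hxg : x ∈ tsupport g
    · rw [hfh (interior_subset (hgK hxg)), partialDeriv]; ring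
    · have := (hzero x hxg).2
      rw [partialDeriv] at this
      rw [partialDeriv, this]; simp
  have hgi : Integrable g := hg.continuous.integrable_of_hasCompactSupport hgc
  have i1 : Integrable (fun x => lineDeriv ℝ h x e * g x) := by
    refine hgi.bdd_mul (c := C * ‖e‖) (measurable_lineDeriv hh.continuous).aestronglyMeasurable ?_
    exact Eventually.of_forall fun x => norm_lineDeriv_le_of_lipschitz ℝ hh
  have i2 : Integrable (fun x => f x * partialDeriv j g x) := by
    have hcont : Continuous (fun x => h x * partialDeriv j g x) :=
      hh.continuous.mul ((hg.continuous_fderiv (by simp)).clm_apply continuous_const)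
    have hcs : HasCompactSupport (fun x => h x * partialDeriv j g x) :=
      HasCompactSupport.intro hgc fun x hx => by rw [(hzero x hx).2, mul_zero]
    refine (hcont.integrable_of_hasCompactSupport hcs).congr (Eventually.of_forall fun x => ?_)
    by_cases hxg : x ∈ tsupport g
    · simp only [hfh (interior_subset (hgK hxg))]
    · simp only [(hzero x hxg).2, mul_zero]
  refine ⟨i1.congr h1, i2, ?_⟩
  rw [← integral_congr_ae h1, hh.integral_lineDeriv_mul_eq hD hgc, ← integral_neg]
  exact integral_congr_ae (Eventually.of_forall h2)

/-- Rademacher's theorem for locally Lipschitz functions on an open set. -/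
theorem ae_differentiableAt_of_locallyLipschitzOn {Ω : Set E3} (hΩ : IsOpen Ω) {f : E3 → ℝ}
    (hf : LocallyLipschitzOn Ω f) : ∀ᵐ x ∂volume.restrict Ω, DifferentiableAt ℝ f x := by
  rw [ae_restrict_iff' hΩ.measurableSet, ae_iff]
  refine measure_null_of_locally_null _ fun x hx => ?_
  simp only [mem_ofPred_eq, Classical.not_imp] at hx
  obtain ⟨K, t, ht, h⟩ := hf hx.1
  rw [hΩ.nhdsWithin_eq hx.1] at ht
  refine ⟨_, inter_mem_nhdsWithin _ (interior_mem_nhds.2 ht), ?_⟩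
  refine measure_mono_null ?_ (ae_iff.1 (h.ae_differentiableWithinAt_of_mem (μ := volume)))
  rintro y ⟨hy1, hy2⟩
  simp only [mem_ofPred_eq, Classical.not_imp] at hy1 ⊢
  exact ⟨interior_subset hy2, fun hd => hy1.2 (hd.differentiableAt (mem_interior_iff_mem_nhds.1 hy2))⟩

theorem volume_real_closedBall (x : E3) {r : ℝ} (hr : 0 ≤ r) :
    volume.real (Metric.closedBall x r) = r ^ 3 * volume.real (Metric.ball (0 : E3) 1) := by
  rw [measureReal_def, Measure.addHaar_closedBall _ _ hr, ENNReal.toReal_mul,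
    ENNReal.toReal_ofReal (by positivity), measureReal_def]
  simp

/-- Almost every point is a Lebesgue point. -/
theorem ae_isLebesguePoint {Ω : Set E3} (hΩ : IsOpen Ω) {F : E3 → E3}
    (hF : LocallyIntegrableOn F Ω) : ∀ᵐ x ∂volume.restrict Ω, IsLebesguePoint F x := by
  rw [ae_restrict_iff' hΩ.measurableSet, ae_iff]
  refine measure_null_of_locally_null _ fun x hx => ?_
  simp only [mem_ofPred_eq, Classical.not_imp] at hx
  obtain ⟨R, hR, hRΩ⟩ := Metric.nhds_basis_closedBall.mem_iff.1 (hΩ.mem_nhds hx.1)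
  -- Cutting F off outside a ball makes it integrable on the whole space, where the differentiation
  -- theorem applies; points of the open ball do not see the cut-off at small scales.
  have hint : Integrable ((Metric.closedBall x R).indicator F) :=
    (integrable_indicator_iff Metric.isClosed_closedBall.measurableSet).2
      (hF.integrableOn_compact_subset hRΩ (isCompact_closedBall x R))
  refine ⟨_, inter_mem_nhdsWithin _ (Metric.ball_mem_nhds x hR), ?_⟩
  refine measure_mono_null ?_ (ae_iff.1 (IsUnifLocDoublingMeasure.ae_tendsto_average_norm_sub
    volume hint.locallyIntegrable 1))
  rintro y ⟨hy1, hy2⟩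
  simp only [mem_ofPred_eq, Classical.not_imp] at hy1 ⊢
  refine fun hd => hy1.2 fun θ hθ => ?_
  have ht := hd (l := 𝓝[>] (0 : ℝ)) (fun _ => y) id tendsto_id (by
    filter_upwards [self_mem_nhdsWithin] with r hr
    exact Metric.mem_closedBall_self (by simpa using le_of_lt hr))
  set V := volume.real (Metric.ball (0 : E3) 1) with hV
  have hV0 : 0 < V := ENNReal.toReal_pos (Metric.measure_ball_pos _ _ one_pos).ne'
    measure_ball_lt_top.ne
  have hev := ht.eventually (gt_mem_nhds (show (0 : ℝ) < θ / V by positivity))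
  have hyR : 0 < R - dist y x := by
    have := Metric.mem_ball.1 hy2
    linarith
  obtain ⟨r₀, hr₀, hr₀'⟩ := mem_nhdsGT_iff_exists_Ioo_subset.1
    (hev.and (Ioo_mem_nhdsGT hyR))
  refine ⟨r₀, hr₀, fun r hr hrr => ?_⟩
  obtain ⟨h1, h2⟩ := hr₀' ⟨hr, hrr⟩
  simp only [id] at h1
  have hsub : Metric.closedBall y r ⊆ Metric.closedBall x R :=
    Metric.closedBall_subset_closedBall' (by linarith [h2.2])
  rw [setAverage_eq, volume_real_closedBall y hr.le, smul_eq_mul, ← hV] at h1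
  have heq : ∫ z in Metric.closedBall y r, ‖F z - F y‖ = ∫ z in Metric.closedBall y r,
      ‖(Metric.closedBall x R).indicator F z - (Metric.closedBall x R).indicator F y‖ := by
    refine setIntegral_congr_fun Metric.isClosed_closedBall.measurableSet fun z hz => ?_
    simp only [indicator_of_mem (hsub hz),
      indicator_of_mem (hsub (Metric.mem_closedBall_self hr.le))]
  rw [heq]
  rw [inv_mul_lt_iff₀ (by positivity)] at h1
  refine h1.le.trans_eq ?_
  field_simp

theorem isLebesguePoint_of_continuousAt {F : E3 → E3} {x : E3} (hF : ContinuousAt F x) :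
    IsLebesguePoint F x := by
  intro θ hθ
  set V := volume.real (Metric.ball (0 : E3) 1) with hV
  have hV0 : 0 < V := ENNReal.toReal_pos (Metric.measure_ball_pos _ _ one_pos).ne'
    measure_ball_lt_top.ne
  obtain ⟨r₀, hr₀, h⟩ := Metric.continuousAt_iff.1 hF (θ / V) (by positivity)
  refine ⟨r₀, hr₀, fun r hr hrr => ?_⟩
  have h1 := norm_setIntegral_le_of_norm_le_const (μ := volume) (s := Metric.closedBall x r)
    (f := fun z => ‖F z - F x‖) (C := θ / V) (isCompact_closedBall x r).measure_lt_top
    (fun z hz => by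
      rw [norm_norm, ← dist_eq_norm]
      exact (h ((Metric.mem_closedBall.1 hz).trans_lt hrr)).le)
  rw [volume_real_closedBall x hr.le, ← hV] at h1
  refine (le_abs_self _).trans (h1.trans_eq ?_)
  field_simp

/-! ### The stress, the force density and the virtual work -/

/-- One entry of the stress of a single phase, as a function of the gradient. -/
def stressEntry (i j : Fin 3) (q : E3) : ℝ :=
  ((if i = j then 1 else 0) - (‖q‖⁻¹ • q) i * (‖q‖⁻¹ • q) j) * ‖q‖

/-- With n = q/|q| the entry is δ_ij |q| - n_i q_j. The first term is 1-Lipschitz. The second is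
3-Lipschitz because |q'| |n - n'| ≤ 2 |q - q'|, which also holds when q or q' is 0 with the
convention n = 0. So the singularity of n at zeros of the gradient is harmless. -/
theorem stressEntry_lipschitz (i j : Fin 3) : LipschitzWith 4 (stressEntry i j) := by
  have hn : ∀ q : E3, ‖q‖ • (‖q‖⁻¹ • q) = q := by
    intro q
    rcases eq_or_ne q 0 with rfl | h
    · simp
    · rw [smul_smul, mul_inv_cancel₀ (norm_ne_zero_iff.2 h), one_smul]
  have hn1 : ∀ q : E3, ‖‖q‖⁻¹ • q‖ ≤ 1 := by
    intro q
    rw [norm_smul, norm_inv, norm_norm]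
    exact inv_mul_le_one
  have hc : ∀ (q : E3) (i : Fin 3), |q i| ≤ ‖q‖ := fun q i => PiLp.norm_apply_le q i
  refine LipschitzWith.of_dist_le_mul fun q q' => ?_
  rw [Real.dist_eq, dist_eq_norm]
  set n := ‖q‖⁻¹ • q with hnq
  set n' := ‖q'‖⁻¹ • q' with hnq'
  have e1 : stressEntry i j q = (if i = j then 1 else 0) * ‖q‖ - n i * q j := by
    have : q j = ‖q‖ * n j := (congrArg (fun v : E3 => v j) (hn q)).symm
    rw [stressEntry, ← hnq, this]; ring
  have e2 : stressEntry i j q' = (if i = j then 1 else 0) * ‖q'‖ - n' i * q' j := by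
    have : q' j = ‖q'‖ * n' j := (congrArg (fun v : E3 => v j) (hn q')).symm
    rw [stressEntry, ← hnq', this]; ring
  have h0 : |‖q‖ - ‖q'‖| ≤ ‖q - q'‖ := abs_norm_sub_norm_le q q'
  have h1 : ‖q'‖ * ‖n - n'‖ ≤ 2 * ‖q - q'‖ := by
    have : ‖q'‖ • (n - n') = (‖q'‖ - ‖q‖) • n + (q - q') := by
      rw [smul_sub, hn q', sub_smul, hn q]; abel
    calc ‖q'‖ * ‖n - n'‖ = ‖‖q'‖ • (n - n')‖ := by rw [norm_smul, norm_norm]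
      _ ≤ ‖(‖q'‖ - ‖q‖) • n‖ + ‖q - q'‖ := by rw [this]; exact norm_add_le _ _
      _ ≤ ‖q - q'‖ * 1 + ‖q - q'‖ := by
        rw [norm_smul, Real.norm_eq_abs, abs_sub_comm]
        gcongr
        exact hn1 q
      _ = 2 * ‖q - q'‖ := by ring
  have h2 : |n i * q j - n' i * q' j| ≤ 3 * ‖q - q'‖ := by
    have : n i * q j - n' i * q' j = n i * (q - q') j + (n - n') i * q' j := by
      simp only [PiLp.sub_apply]; ring
    rw [this]
    refine (abs_add_le _ _).trans ?_
    rw [abs_mul, abs_mul]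
    have a1 : |n i| * |(q - q') j| ≤ 1 * ‖q - q'‖ :=
      mul_le_mul ((hc n i).trans (hn1 q)) (hc _ j) (abs_nonneg _) zero_le_one
    have a2 : |(n - n') i| * |q' j| ≤ ‖n - n'‖ * ‖q'‖ :=
      mul_le_mul (hc _ i) (hc _ j) (abs_nonneg _) (norm_nonneg _)
    linarith
  have h3 : |(if i = j then (1 : ℝ) else 0) * ‖q‖ - (if i = j then 1 else 0) * ‖q'‖| ≤
      ‖q - q'‖ := by
    rw [← mul_sub, abs_mul]
    split_ifs
    · simpa using h0
    · simp
  rw [e1, e2]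
  rw [abs_le] at h2 h3 ⊢
  push_cast
  constructor <;> linarith [h2.1, h2.2, h3.1, h3.2]

/-- The rate of change `D(ρu)/Dt` of the momentum density. -/
def momentumRate (Ω : Set E3) (ξ : Fin 3 → E3 → ℝ) (ρ : Fin 3 → ℝ) (γ : ℝ → E3 → E3) :
    ℝ → E3 → E3 :=
  materialDeriv (velocity Ω γ) fun s y => density Ω ξ ρ γ s y • velocity Ω γ s y

/-- The force density `D(ρu)/Dt - div τ̄`, defined almost everywhere. -/
def forceField (Ω : Set E3) (ξ : Fin 3 → E3 → ℝ) (ρ σ : Fin 3 → ℝ) (γ : ℝ → E3 → E3)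
    (t : ℝ) (x : E3) : E3 :=
  WithLp.toLp 2 fun i => momentumRate Ω ξ ρ γ t x i -
    ∑ j : Fin 3, partialDeriv j (fun y => stress Ω ξ σ γ t y i j) x

/-- The virtual work density `D(ρu)/Dt · φ + τ̄ : ∇φ`. -/
def workDensity (Ω : Set E3) (ξ : Fin 3 → E3 → ℝ) (ρ σ : Fin 3 → ℝ) (γ : ℝ → E3 → E3)
    (t : ℝ) (φ : E3 → E3) (x : E3) : ℝ :=
  inner ℝ (momentumRate Ω ξ ρ γ t x) (φ x) +
    ∑ i : Fin 3, ∑ j : Fin 3,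
      stress Ω ξ σ γ t x i j * fderiv ℝ φ x (EuclideanSpace.single j 1) i

section Stress
variable {Ω : Set E3} {T₀ : ℝ} {γ : ℝ → E3 → E3} {ξ : Fin 3 → E3 → ℝ} {σ : Fin 3 → ℝ}

theorem stress_eq (t : ℝ) (x : E3) (i j : Fin 3) :
    stress Ω ξ σ γ t x i j = ∑ a ∈ ({1, 2} : Finset (Fin 3)),
      σ a * stressEntry i j (gradient (transported Ω γ (ξ a) t) x) := by
  refine Finset.sum_congr rfl fun a _ => ?_
  rw [stressEntry, gradNorm, mul_assoc]
  rfl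

theorem _root_.LipschitzWith.const_mul_real {X : Type*} [PseudoMetricSpace X] {C : ℝ≥0}
    {f : X → ℝ} (hf : LipschitzWith C f) (c : ℝ) :
    LipschitzWith (‖c‖₊ * C) fun x => c * f x :=
  LipschitzWith.of_dist_le_mul fun x y => by
    have := mul_le_mul_of_nonneg_left (hf.dist_le_mul x y) (norm_nonneg c)
    rw [Real.dist_eq] at this ⊢
    rw [← mul_sub, abs_mul]
    push_cast
    rw [mul_assoc]
    exact this

/-- Each phase contributes a Lipschitz function of a smooth gradient. Joint regularity in (t, x) is
needed to bound spatial derivatives uniformly in time. -/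
theorem stress_locallyLipschitzOn (hΩ : IsOpen Ω) (hγ : IsMotion Ω T₀ γ)
    (hξ : ∀ a, ContDiffOn ℝ ∞ (ξ a) Ω) (i j : Fin 3) :
    LocallyLipschitzOn (Ioo 0 T₀ ×ˢ Ω) fun z : ℝ × E3 => stress Ω ξ σ γ z.1 z.2 i j := by
  have h : ∀ a, LocallyLipschitzOn (Ioo 0 T₀ ×ˢ Ω) fun z : ℝ × E3 =>
      σ a * stressEntry i j (gradient (transported Ω γ (ξ a) z.1) z.2) := fun a =>
    ((stressEntry_lipschitz i j).const_mul_real (σ a)).comp_locallyLipschitzOn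
      (locallyLipschitzOn_of_contDiffOn (IsMotion.isOpen_domain hΩ T₀)
        (hγ.gradient_contDiffOn hΩ (hξ a)))
  have h2 := (h 1).add (h 2)
  have : (fun z : ℝ × E3 => stress Ω ξ σ γ z.1 z.2 i j) = fun z =>
      σ 1 * stressEntry i j (gradient (transported Ω γ (ξ 1) z.1) z.2) +
      σ 2 * stressEntry i j (gradient (transported Ω γ (ξ 2) z.1) z.2) := by
    funext z
    rw [stress_eq, Finset.sum_pair (by decide)]
  rw [this]
  exact h2

theorem LocallyLipschitzOn.slice {f : ℝ × E3 → ℝ} {I : Set ℝ}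
    (hf : LocallyLipschitzOn (I ×ˢ Ω) f) {t : ℝ} (ht : t ∈ I) :
    LocallyLipschitzOn Ω fun x => f (t, x) := by
  intro x hx
  obtain ⟨K, s, hs, h⟩ := hf (show (t, x) ∈ I ×ˢ Ω from ⟨ht, hx⟩)
  have hl : LipschitzWith 1 (fun x : E3 => (t, x)) := LipschitzWith.prodMk_left t
  refine ⟨K * 1, (fun x : E3 => (t, x)) ⁻¹' s, ?_, h.comp hl.lipschitzOnWith (mapsTo_preimage _ _)⟩
  have hc : ContinuousWithinAt (fun x : E3 => (t, x)) Ω x := by fun_prop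
  have hm : MapsTo (fun x : E3 => (t, x)) Ω (I ×ˢ Ω) := fun y hy => ⟨ht, hy⟩
  exact hc.tendsto_nhdsWithin hm hs

theorem stress_locallyLipschitzOn_slice (hΩ : IsOpen Ω) (hγ : IsMotion Ω T₀ γ)
    (hξ : ∀ a, ContDiffOn ℝ ∞ (ξ a) Ω) {t : ℝ} (ht : t ∈ Ioo 0 T₀) (i j : Fin 3) :
    LocallyLipschitzOn Ω fun x => stress Ω ξ σ γ t x i j :=
  LocallyLipschitzOn.slice (stress_locallyLipschitzOn hΩ hγ hξ i j) ht

theorem momentumRate_contDiffOn (hΩ : IsOpen Ω) (hγ : IsMotion Ω T₀ γ)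
    (hξ : ∀ a, ContDiffOn ℝ ∞ (ξ a) Ω) (ρ : Fin 3 → ℝ) :
    ContDiffOn ℝ ∞ (fun z : ℝ × E3 => momentumRate Ω ξ ρ γ z.1 z.2) (Ioo 0 T₀ ×ˢ Ω) :=
  hγ.materialDeriv_contDiffOn hΩ (hγ.momentum_contDiffOn hΩ hξ ρ)

theorem momentumRate_slice_continuousOn (hΩ : IsOpen Ω) (hγ : IsMotion Ω T₀ γ)
    (hξ : ∀ a, ContDiffOn ℝ ∞ (ξ a) Ω) (ρ : Fin 3 → ℝ) {t : ℝ} (ht : t ∈ Ioo 0 T₀) :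
    ContinuousOn (momentumRate Ω ξ ρ γ t) Ω :=
  (momentumRate_contDiffOn hΩ hγ hξ ρ).continuousOn.comp (f := fun x : E3 => (t, x))
    (by fun_prop) fun _ hx => ⟨ht, hx⟩

end Stress

section Test
variable {Ω : Set E3} {φ : E3 → E3}

theorem IsTestField.component (hφ : IsTestField Ω φ) (i : Fin 3) :
    ContDiff ℝ ∞ (fun x => φ x i) ∧ HasCompactSupport (fun x => φ x i) ∧
      tsupport (fun x => φ x i) ⊆ Ω := by
  have h1 : ∀ x, x ∉ tsupport φ → φ x i = 0 := fun x hx => by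
    rw [image_eq_zero_of_notMem_tsupport hx]; rfl
  refine ⟨(EuclideanSpace.proj (𝕜 := ℝ) i).contDiff.comp hφ.smooth,
    HasCompactSupport.intro hφ.compact h1, Subset.trans ?_ hφ.support⟩
  refine closure_minimal (fun x hx => ?_) (isClosed_tsupport φ)
  by_contra h
  exact hx (h1 x h)

theorem partialDeriv_component {x : E3} (hφ : DifferentiableAt ℝ φ x) (i j : Fin 3) :
    partialDeriv j (fun y => φ y i) x = fderiv ℝ φ x (EuclideanSpace.single j 1) i := by
  have := ((EuclideanSpace.proj (𝕜 := ℝ) i).hasFDerivAt.comp x hφ.hasFDerivAt).fderiv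
  rw [partialDeriv]
  erw [this]
  rfl

theorem IsTestField.partialDeriv_component (hφ : IsTestField Ω φ) (x : E3) (i j : Fin 3) :
    partialDeriv j (fun y => φ y i) x = fderiv ℝ φ x (EuclideanSpace.single j 1) i :=
  WallFlow.partialDeriv_component (hφ.smooth.differentiable (by simp) x) i j

end Test

section Work
variable {Ω : Set E3} {T₀ : ℝ} {γ : ℝ → E3 → E3} {ξ : Fin 3 → E3 → ℝ} {σ : Fin 3 → ℝ}

theorem setIntegral_eq_integral_of_testField {φ : E3 → E3} (hφ : IsTestField Ω φ)
    {g : E3 → ℝ} (hg : ∀ x, x ∉ tsupport φ → g x = 0) : ∫ x in Ω, g x = ∫ x, g x :=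
  setIntegral_eq_integral_of_forall_compl_eq_zero fun x hx => hg x fun h => hx (hφ.support h)

theorem integrable_inner_momentumRate (hΩ : IsOpen Ω) (hγ : IsMotion Ω T₀ γ)
    (hξ : ∀ a, ContDiffOn ℝ ∞ (ξ a) Ω) (ρ : Fin 3 → ℝ) {t : ℝ} (ht : t ∈ Ioo 0 T₀)
    {φ : E3 → E3} (hφ : IsTestField Ω φ) :
    Integrable fun x => inner ℝ (momentumRate Ω ξ ρ γ t x) (φ x) :=
  hφ.integrable_inner ((momentumRate_slice_continuousOn hΩ hγ hξ ρ ht).locallyIntegrableOn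
    hΩ.measurableSet)

theorem inner_eq_sum (v w : E3) : inner ℝ v w = ∑ i, v i * w i := by
  rw [PiLp.inner_apply]
  exact Finset.sum_congr rfl fun i _ => by simp [mul_comm]

/-- Integration by parts in the virtual work. -/
theorem integral_workDensity (hΩ : IsOpen Ω) (hγ : IsMotion Ω T₀ γ)
    (hξ : ∀ a, ContDiffOn ℝ ∞ (ξ a) Ω) (ρ : Fin 3 → ℝ) {t : ℝ} (ht : t ∈ Ioo 0 T₀)
    {φ : E3 → E3} (hφ : IsTestField Ω φ) :
    ∫ x in Ω, workDensity Ω ξ ρ σ γ t φ x =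
      ∫ x, inner ℝ (forceField Ω ξ ρ σ γ t x) (φ x) := by
  have hA := integrable_inner_momentumRate hΩ hγ hξ ρ ht hφ
  have hibp := fun i j => integral_partialDeriv_mul hΩ
    (stress_locallyLipschitzOn_slice (σ := σ) hΩ hγ hξ ht i j) (hφ.component i).1
    (hφ.component i).2.1 (hφ.component i).2.2 j
  simp only [hφ.partialDeriv_component] at hibp
  rw [setIntegral_eq_integral_of_testField hφ]
  · have h1 : ∫ x, workDensity Ω ξ ρ σ γ t φ x =
        (∫ x, inner ℝ (momentumRate Ω ξ ρ γ t x) (φ x)) + ∑ i : Fin 3, ∑ j : Fin 3,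
          ∫ x, stress Ω ξ σ γ t x i j * fderiv ℝ φ x (EuclideanSpace.single j 1) i := by
      unfold workDensity
      rw [integral_add hA (integrable_finsetSum _ fun i _ =>
        integrable_finsetSum _ fun j _ => (hibp i j).2.1),
        integral_finsetSum _ fun i _ => integrable_finsetSum _ fun j _ => (hibp i j).2.1]
      congr 1
      exact Finset.sum_congr rfl fun i _ => integral_finsetSum _ fun j _ => (hibp i j).2.1
    have h2 : ∫ x, inner ℝ (forceField Ω ξ ρ σ γ t x) (φ x) =
        (∫ x, inner ℝ (momentumRate Ω ξ ρ γ t x) (φ x)) - ∑ i : Fin 3, ∑ j : Fin 3,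
          ∫ x, partialDeriv j (fun y => stress Ω ξ σ γ t y i j) x * φ x i := by
      have : ∀ x, inner ℝ (forceField Ω ξ ρ σ γ t x) (φ x) =
          inner ℝ (momentumRate Ω ξ ρ γ t x) (φ x) - ∑ i : Fin 3, ∑ j : Fin 3,
            partialDeriv j (fun y => stress Ω ξ σ γ t y i j) x * φ x i := by
        intro x
        simp only [inner_eq_sum, forceField, sub_mul, Finset.sum_sub_distrib, Finset.sum_mul]
      simp only [this]
      rw [integral_sub hA (integrable_finsetSum _ fun i _ =>
        integrable_finsetSum _ fun j _ => (hibp i j).1),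
        integral_finsetSum _ fun i _ => integrable_finsetSum _ fun j _ => (hibp i j).1]
      congr 1
      exact Finset.sum_congr rfl fun i _ => integral_finsetSum _ fun j _ => (hibp i j).1
    rw [h1, h2]
    simp only [(hibp _ _).2.2, Finset.sum_neg_distrib, sub_neg_eq_add]
  · intro x hx
    have h1 : fderiv ℝ φ x = 0 :=
      image_eq_zero_of_notMem_tsupport fun h => hx (tsupport_fderiv_subset ℝ h)
    simp [workDensity, image_eq_zero_of_notMem_tsupport hx, h1]

/-- If the equation of motion holds, the virtual work of divergence-free fields vanishes. -/
theorem integral_workDensity_eq_zero (hΩ : IsOpen Ω) (hγ : IsMotion Ω T₀ γ)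
    (hξ : ∀ a, ContDiffOn ℝ ∞ (ξ a) Ω) {ρ : Fin 3 → ℝ} {p : ℝ → E3 → ℝ}
    (hp : SolvesEquationOfMotion Ω T₀ ξ ρ σ γ p) {t : ℝ} (ht : t ∈ Ioo 0 T₀)
    {φ : E3 → E3} (hφ : IsTestField Ω φ) (hdiv : ∀ x, divergence φ x = 0) :
    ∫ x in Ω, workDensity Ω ξ ρ σ γ t φ x = 0 := by
  rw [integral_workDensity hΩ hγ hξ ρ ht hφ]
  have hibp := fun i => integral_partialDeriv_mul hΩ (hp.locallyLipschitz t ht)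
    (hφ.component i).1 (hφ.component i).2.1 (hφ.component i).2.2 i
  simp only [hφ.partialDeriv_component] at hibp
  -- The force is -∇p almost everywhere, which is enough under the integral; moving the gradient
  -- from p to φ leaves the integral of p div φ, which is 0.
  have h1 : ∀ᵐ x, inner ℝ (forceField Ω ξ ρ σ γ t x) (φ x) =
      -∑ i : Fin 3, partialDeriv i (p t) x * φ x i := by
    filter_upwards [(ae_restrict_iff' hΩ.measurableSet).1 (hp.ae_equation t ht)] with x hx
    by_cases hxφ : x ∈ tsupport φ
    · rw [inner_eq_sum, ← Finset.sum_neg_distrib]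
      refine Finset.sum_congr rfl fun i _ => ?_
      have h := (hx (hφ.support hxφ)).2.2 i
      have h' : forceField Ω ξ ρ σ γ t x i = -partialDeriv i (p t) x := by
        simp only [forceField, momentumRate]
        linarith
      rw [h', neg_mul]
    · simp [image_eq_zero_of_notMem_tsupport hxφ]
  rw [integral_congr_ae h1, integral_neg, integral_finsetSum _ fun i _ => (hibp i).1]
  simp only [(hibp _).2.2, Finset.sum_neg_distrib, neg_neg]
  rw [← integral_finsetSum _ fun i _ => (hibp i).2.1]
  simp only [← Finset.mul_sum]
  have : ∀ x, ∑ i : Fin 3, fderiv ℝ φ x (EuclideanSpace.single i 1) i = 0 := hdiv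
  simp [this]

/-- Provides the weak continuity in t required by `exists_potential`. It is stated for the virtual
work because there the derivatives fall on φ and the stress enters undifferentiated; the force
itself need not depend continuously on t. -/
theorem continuousOn_integral_workDensity (hΩ : IsOpen Ω) (hγ : IsMotion Ω T₀ γ)
    (hξ : ∀ a, ContDiffOn ℝ ∞ (ξ a) Ω) (ρ : Fin 3 → ℝ)
    {φ : E3 → E3} (hφ : IsTestField Ω φ) :
    ContinuousOn (fun t => ∫ x in Ω, workDensity Ω ξ ρ σ γ t φ x) (Ioo 0 T₀) := by
  have hzero : ∀ t x, x ∉ tsupport φ → workDensity Ω ξ ρ σ γ t φ x = 0 := by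
    intro t x hx
    have h1 : fderiv ℝ φ x = 0 :=
      image_eq_zero_of_notMem_tsupport fun h => hx (tsupport_fderiv_subset ℝ h)
    simp [workDensity, image_eq_zero_of_notMem_tsupport hx, h1]
  simp_rw [fun t => setIntegral_eq_integral_of_testField hφ (hzero t)]
  refine continuousOn_integral_of_compact_support hφ.compact ?_ fun t x _ hx => hzero t x hx
  have hc : ContinuousOn (fun z : ℝ × E3 => workDensity Ω ξ ρ σ γ z.1 φ z.2)
      (Ioo 0 T₀ ×ˢ Ω) := by
    unfold workDensity
    refine ((momentumRate_contDiffOn hΩ hγ hξ ρ).continuousOn.inner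
      (hφ.smooth.continuous.comp continuous_snd).continuousOn).add
      (continuousOn_finsetSum _ fun i _ => continuousOn_finsetSum _ fun j _ =>
        (stress_locallyLipschitzOn hΩ hγ hξ i j).continuousOn.mul ?_)
    refine Continuous.continuousOn ?_
    exact (EuclideanSpace.proj (𝕜 := ℝ) i).continuous.comp
      (((hφ.smooth.continuous_fderiv (by simp)).comp continuous_snd).clm_apply continuous_const)
  rintro ⟨t, x⟩ ⟨ht, -⟩
  by_cases hx : x ∈ tsupport φ
  · exact (hc.continuousAt ((IsMotion.isOpen_domain hΩ T₀).mem_nhds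
      ⟨ht, hφ.support hx⟩)).continuousWithinAt
  · refine ContinuousAt.continuousWithinAt ?_
    have : (fun z : ℝ × E3 => workDensity Ω ξ ρ σ γ z.1 φ z.2) =ᶠ[𝓝 (t, x)] fun _ => 0 := by
      filter_upwards [continuous_snd.continuousAt.preimage_mem_nhds
        ((isClosed_tsupport φ).isOpen_compl.mem_nhds hx)] with z hz
      exact hzero z.1 z.2 hz
    exact continuousAt_const.congr this.symm

theorem measurable_partialDeriv (j : Fin 3) (f : E3 → ℝ) : Measurable (partialDeriv j f) :=
  measurable_fderiv_apply_const ℝ f _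

/-- The force density is bounded, locally uniformly in time. -/
theorem forceField_locally_bounded (hΩ : IsOpen Ω) (hγ : IsMotion Ω T₀ γ)
    (hξ : ∀ a, ContDiffOn ℝ ∞ (ξ a) Ω) (ρ : Fin 3 → ℝ) {t₀ : ℝ} (ht₀ : t₀ ∈ Ioo 0 T₀)
    {x₀ : E3} (hx₀ : x₀ ∈ Ω) :
    ∃ L R, 0 ≤ L ∧ 0 < R ∧ Metric.closedBall x₀ R ⊆ Ω ∧
      ∀ᶠ t in 𝓝 t₀, ∀ z ∈ Metric.closedBall x₀ R, ‖forceField Ω ξ ρ σ γ t z‖ ≤ L := by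
  have hW := IsMotion.isOpen_domain hΩ T₀
  have hz₀ : (t₀, x₀) ∈ Ioo 0 T₀ ×ˢ Ω := ⟨ht₀, hx₀⟩
  -- A Lipschitz constant in (t, x) near (t₀, x₀) bounds the spatial derivatives of the stress at
  -- all nearby times; where the stress is not differentiable, `fderiv` is 0 and obeys the same
  -- bound.
  have hlip := fun i j => stress_locallyLipschitzOn (σ := σ) hΩ hγ hξ i j hz₀
  choose C s hs hC using hlip
  simp only [hW.nhdsWithin_eq hz₀] at hs
  set m := momentumRate Ω ξ ρ γ t₀ x₀ with hm
  have hA : ∀ᶠ z : ℝ × E3 in 𝓝 (t₀, x₀), ‖momentumRate Ω ξ ρ γ z.1 z.2‖ < ‖m‖ + 1 :=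
    ((momentumRate_contDiffOn hΩ hγ hξ ρ).continuousOn.continuousAt
      (hW.mem_nhds hz₀)).norm.eventually (gt_mem_nhds (by simp [hm]))
  have hall : ∀ᶠ z : ℝ × E3 in 𝓝 (t₀, x₀), ‖momentumRate Ω ξ ρ γ z.1 z.2‖ < ‖m‖ + 1 ∧
      z ∈ Ioo 0 T₀ ×ˢ Ω ∧ ∀ i j, z ∈ s i j :=
    hA.and ((hW.eventually_mem hz₀).and
      (eventually_all.2 fun i => eventually_all.2 fun j => hs i j))
  rw [nhds_prod_eq] at hall
  obtain ⟨pa, hpa, pb, hpb, hab⟩ := eventually_prod_iff.1 hall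
  obtain ⟨R, hR, hRb⟩ := Metric.nhds_basis_ball.mem_iff.1 hpb
  set B : ℝ := ‖m‖ + 1 + ∑ i : Fin 3, ∑ j : Fin 3, (C i j : ℝ) with hB
  have hB0 : 0 ≤ B := by positivity
  have hsub : Metric.closedBall x₀ (R / 2) ⊆ Metric.ball x₀ R :=
    Metric.closedBall_subset_ball (by linarith)
  -- B bounds each of the three components, and the norm is at most the sum of their absolute
  -- values.
  refine ⟨3 * B, R / 2, by positivity, half_pos hR,
    fun x hx => (hab hpa.self_of_nhds (hRb (hsub hx))).2.1.2, ?_⟩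
  filter_upwards [hpa] with t ht x hx
  have hxt := hab ht (hRb (hsub hx))
  have hpd : ∀ i j, |partialDeriv j (fun y => stress Ω ξ σ γ t y i j) x| ≤ C i j := by
    intro i j
    have hnb : Metric.ball x₀ R ∈ 𝓝 x := Metric.isOpen_ball.mem_nhds (hsub hx)
    have hl : LipschitzOnWith (C i j) (fun y => stress Ω ξ σ γ t y i j)
        (Metric.ball x₀ R) :=
      LipschitzOnWith.of_dist_le_mul fun y hy y' hy' => by
        have := (hC i j).dist_le_mul (t, y) ((hab ht (hRb hy)).2.2 i j) (t, y')
          ((hab ht (hRb hy')).2.2 i j)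
        rwa [Prod.dist_eq, dist_self, max_eq_right dist_nonneg] at this
    have h1 := norm_fderiv_le_of_lipschitzOn ℝ hnb hl
    have h2 := (fderiv ℝ (fun y => stress Ω ξ σ γ t y i j) x).le_opNorm
      (EuclideanSpace.single j 1)
    rw [PiLp.norm_single, norm_one, mul_one] at h2
    exact h2.trans h1
  have hcomp : ∀ i, |forceField Ω ξ ρ σ γ t x i| ≤ B := by
    intro i
    have h1 : |momentumRate Ω ξ ρ γ t x i| ≤ ‖m‖ + 1 :=
      (PiLp.norm_apply_le _ i).trans hxt.1.le
    have h2 : |∑ j : Fin 3, partialDeriv j (fun y => stress Ω ξ σ γ t y i j) x| ≤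
        ∑ j : Fin 3, (C i j : ℝ) :=
      (Finset.abs_sum_le_sum_abs _ _).trans (Finset.sum_le_sum fun j _ => hpd i j)
    have h3 : ∑ j : Fin 3, (C i j : ℝ) ≤ ∑ i : Fin 3, ∑ j : Fin 3, (C i j : ℝ) :=
      Finset.single_le_sum (f := fun i => ∑ j : Fin 3, (C i j : ℝ))
        (fun i _ => Finset.sum_nonneg fun j _ => (C i j).2) (Finset.mem_univ i)
    exact (abs_sub _ _).trans (by linarith)
  have h4 : ‖forceField Ω ξ ρ σ γ t x‖ ≤ ∑ i : Fin 3, |forceField Ω ξ ρ σ γ t x i| := by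
    rw [EuclideanSpace.norm_eq]
    refine Real.sqrt_le_iff.2 ⟨by positivity, ?_⟩
    exact Finset.sum_sq_le_sq_sum_of_nonneg fun i _ => abs_nonneg _
  refine h4.trans ((Finset.sum_le_sum fun i _ => hcomp i).trans_eq ?_)
  simp

theorem forceField_locallyIntegrableOn (hΩ : IsOpen Ω) (hγ : IsMotion Ω T₀ γ)
    (hξ : ∀ a, ContDiffOn ℝ ∞ (ξ a) Ω) (ρ : Fin 3 → ℝ) {t : ℝ} (ht : t ∈ Ioo 0 T₀) :
    LocallyIntegrableOn (forceField Ω ξ ρ σ γ t) Ω := by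
  intro x hx
  obtain ⟨L, R, hL0, hR, hRΩ, hL⟩ := forceField_locally_bounded (σ := σ) hΩ hγ hξ ρ ht hx
  refine ⟨Metric.closedBall x R, mem_nhdsWithin_of_mem_nhds (Metric.closedBall_mem_nhds x hR), ?_⟩
  have : IsFiniteMeasure (volume.restrict (Metric.closedBall x R)) :=
    ⟨by rw [Measure.restrict_apply_univ]; exact (isCompact_closedBall x R).measure_lt_top⟩
  refine Integrable.of_bound (C := L) ?_ ?_
  · have h1 : ContinuousOn (momentumRate Ω ξ ρ γ t) (Metric.closedBall x R) :=
      (momentumRate_slice_continuousOn hΩ hγ hξ ρ ht).mono hRΩ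
    have h2 : Measurable fun x : E3 => (WithLp.toLp 2 fun i : Fin 3 =>
        ∑ j : Fin 3, partialDeriv j (fun y => stress Ω ξ σ γ t y i j) x : E3) := by
      refine (WithLp.measurable_toLp 2 _).comp (measurable_pi_lambda _ fun i => ?_)
      exact Finset.measurable_sum _ fun j _ => measurable_partialDeriv _ _
    exact (h1.aestronglyMeasurable Metric.isClosed_closedBall.measurableSet).sub
      h2.aestronglyMeasurable
  · exact (ae_restrict_iff' Metric.isClosed_closedBall.measurableSet).2
      (Eventually.of_forall hL.self_of_nhds)

/-- If the virtual work of divergence-free fields vanishes, there is a pressure. -/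
theorem exists_solvesEquationOfMotion (hΩ : IsOpen Ω) (hc : IsConnected Ω)
    (hγ : IsMotion Ω T₀ γ) (hξ : ∀ a, ContDiffOn ℝ ∞ (ξ a) Ω) (ρ : Fin 3 → ℝ)
    (hw : ∀ φ, IsTestField Ω φ → (∀ x, divergence φ x = 0) → ∀ t ∈ Ioo 0 T₀,
      ∫ x in Ω, workDensity Ω ξ ρ σ γ t φ x = 0) :
    ∃ p, SolvesEquationOfMotion Ω T₀ ξ ρ σ γ p := by
  obtain ⟨p, hpc, hpl, hpd⟩ := exists_potential hΩ hc (T := Ioo 0 T₀)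
    (F := forceField Ω ξ ρ σ γ)
    (fun t ht => forceField_locallyIntegrableOn hΩ hγ hξ ρ ht)
    (fun t₀ ht₀ x₀ hx₀ => by
      obtain ⟨L, R, hL0, hR, hRΩ, hL⟩ := forceField_locally_bounded (σ := σ) hΩ hγ hξ ρ ht₀ hx₀
      refine ⟨L, R, hL0, hR, hRΩ, ?_⟩
      filter_upwards [mem_nhdsWithin_of_mem_nhds hL] with t ht
      exact (ae_restrict_iff' Metric.isClosed_closedBall.measurableSet).2
        (Eventually.of_forall ht))
    (fun φ hφ => (continuousOn_integral_workDensity (σ := σ) hΩ hγ hξ ρ hφ).congr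
      fun t ht => (integral_workDensity hΩ hγ hξ ρ ht hφ).symm)
    (fun φ hφ hdiv t ht => by
      rw [← integral_workDensity hΩ hγ hξ ρ ht hφ]
      exact hw φ hφ hdiv t ht)
  -- This serves both forms of the equation: almost every point is a Lebesgue point with
  -- differentiable stress, and where the stress is C¹ the force is continuous, so that the point is
  -- a Lebesgue point.
  have key : ∀ t ∈ Ioo 0 T₀, ∀ x ∈ Ω, IsLebesguePoint (forceField Ω ξ ρ σ γ t) x →
      (∀ i j, DifferentiableAt ℝ (fun y => stress Ω ξ σ γ t y i j) x) →
      EquationAt Ω ξ ρ σ γ p t x := by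
    intro t ht x hx hleb hd
    have h := hpd t ht x hx hleb
    refine ⟨h.differentiableAt, hd, fun i => ?_⟩
    have h1 : partialDeriv i (p t) x = -forceField Ω ξ ρ σ γ t x i := by
      rw [partialDeriv, h.fderiv]
      simp [inner_eq_sum, PiLp.single_apply]
    rw [h1]
    simp only [forceField, momentumRate]
    ring
  refine ⟨p, hpc, hpl, fun t ht => ?_, fun t ht x hx hC => ?_⟩
  · have h1 := ae_isLebesguePoint hΩ (forceField_locallyIntegrableOn (σ := σ) hΩ hγ hξ ρ ht)
    have h2 : ∀ᵐ x ∂volume.restrict Ω, ∀ i j,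
        DifferentiableAt ℝ (fun y => stress Ω ξ σ γ t y i j) x :=
      ae_all_iff.2 fun i => ae_all_iff.2 fun j => ae_differentiableAt_of_locallyLipschitzOn hΩ
        (stress_locallyLipschitzOn_slice hΩ hγ hξ ht i j)
    filter_upwards [h1, h2, ae_restrict_mem hΩ.measurableSet] with x hx1 hx2 hx3
    exact key t ht x hx3 hx1 hx2
  · refine key t ht x hx (isLebesguePoint_of_continuousAt ?_)
      fun i j => (hC i j).differentiableAt (by simp)
    have h1 : ContinuousAt (momentumRate Ω ξ ρ γ t) x :=
      (momentumRate_slice_continuousOn hΩ hγ hξ ρ ht).continuousAt (hΩ.mem_nhds hx)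
    have h2 : ∀ i j, ContinuousAt (partialDeriv j fun y => stress Ω ξ σ γ t y i j) x :=
      fun i j => (((hC i j).fderiv_right (m := 0) (by simp)).continuousAt).clm_apply
        continuousAt_const
    have h3 : ContinuousAt (fun x : E3 => (WithLp.toLp 2 fun i : Fin 3 =>
        ∑ j : Fin 3, partialDeriv j (fun y => stress Ω ξ σ γ t y i j) x : E3)) x := by
      refine (PiLp.continuous_toLp 2 _).continuousAt.comp (continuousAt_pi.2 fun i => ?_)
      exact tendsto_finsetSum _ fun j _ => h2 i j
    exact h1.sub h3

end Work

/-! ### Derivative of the determinant -/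

section Determinant

theorem det_eq_matrix_det (A : E3 →L[ℝ] E3) :
    A.det = (Matrix.of fun i j : Fin 3 => A (EuclideanSpace.single j (1 : ℝ)) i).det := by
  have h : A.det = LinearMap.det (A : E3 →ₗ[ℝ] E3) := rfl
  rw [h, ← LinearMap.det_toMatrix (EuclideanSpace.basisFun (Fin 3) ℝ).toBasis]
  congr 1

/-- The entry of a linear map, as a continuous linear functional. -/
def entryCLM (i j : Fin 3) : (E3 →L[ℝ] E3) →L[ℝ] ℝ :=
  (EuclideanSpace.proj (𝕜 := ℝ) i : E3 →L[ℝ] ℝ).comp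
    (ContinuousLinearMap.apply ℝ E3 (EuclideanSpace.single j (1 : ℝ)))

theorem contDiff_det : ContDiff ℝ ∞ (fun A : E3 →L[ℝ] E3 => A.det) := by
  have h : ∀ i j : Fin 3, ContDiff ℝ ∞
      (fun A : E3 →L[ℝ] E3 => A (EuclideanSpace.single j (1 : ℝ)) i) := fun i j =>
    (entryCLM i j).contDiff
  simp only [det_eq_matrix_det, Matrix.det_fin_three, Matrix.of_apply]
  have := h
  fun_prop

/-- Jacobi's formula at the identity: in the expansion of the 3 × 3 determinant only the derivatives
of diagonal entries survive. -/
theorem hasDerivAt_det_of_eq_id {M : ℝ → E3 →L[ℝ] E3} {M' : E3 →L[ℝ] E3}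
    (hM : HasDerivAt M M' 0) (h0 : M 0 = ContinuousLinearMap.id ℝ E3) :
    HasDerivAt (fun s => (M s).det) (∑ i : Fin 3, M' (EuclideanSpace.single i 1) i) 0 := by
  have h : ∀ i j : Fin 3, HasDerivAt (fun s => M s (EuclideanSpace.single j (1 : ℝ)) i)
      (M' (EuclideanSpace.single j (1 : ℝ)) i) 0 := fun i j =>
    (entryCLM i j).hasFDerivAt.comp_hasDerivAt 0 hM
  simp only [det_eq_matrix_det, Matrix.det_fin_three, Matrix.of_apply]
  refine ((((((((h 0 0).mul (h 1 1)).mul (h 2 2)).sub (((h 0 0).mul (h 1 2)).mul (h 2 1))).sub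
    (((h 0 1).mul (h 1 0)).mul (h 2 2))).add (((h 0 1).mul (h 1 2)).mul (h 2 0))).add
    (((h 0 2).mul (h 1 0)).mul (h 2 1))).sub (((h 0 2).mul (h 1 1)).mul (h 2 0))).congr_deriv ?_
  simp [h0, Fin.sum_univ_three]

end Determinant

section Partial
variable {F : Type*} [NormedAddCommGroup F] [NormedSpace ℝ F]

theorem hasFDerivAt_partial_third {f : ℝ × ℝ × E3 → F} {z : ℝ × ℝ × E3}
    (hf : DifferentiableAt ℝ f z) :
    HasFDerivAt (fun x => f (z.1, z.2.1, x)) ((fderiv ℝ f z).comp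
      ((ContinuousLinearMap.inr ℝ ℝ (ℝ × E3)).comp (ContinuousLinearMap.inr ℝ ℝ E3))) z.2.2 := by
  have h : HasFDerivAt (fun x : E3 => (z.1, z.2.1, x))
      ((ContinuousLinearMap.inr ℝ ℝ (ℝ × E3)).comp (ContinuousLinearMap.inr ℝ ℝ E3)) z.2.2 :=
    (hasFDerivAt_prodMk_right z.1 z.2).comp z.2.2 (hasFDerivAt_prodMk_right z.2.1 z.2.2)
  exact HasFDerivAt.comp (g := f) z.2.2 hf.hasFDerivAt h

theorem hasDerivAt_partial_second {f : ℝ × ℝ × E3 → F} {z : ℝ × ℝ × E3}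
    (hf : DifferentiableAt ℝ f z) :
    HasDerivAt (fun t => f (z.1, t, z.2.2)) (fderiv ℝ f z (0, 1, 0)) z.2.1 := by
  have h : HasDerivAt (fun t : ℝ => (z.1, t, z.2.2)) ((0 : ℝ), (1 : ℝ), (0 : E3)) z.2.1 :=
    (hasDerivAt_const _ _).prodMk ((hasDerivAt_id _).prodMk (hasDerivAt_const _ _))
  exact HasFDerivAt.comp_hasDerivAt (l := f) z.2.1 hf.hasFDerivAt h

end Partial

/-! ### The deformed action in undeformed coordinates -/

/-- The deformation at time `t`, in terms of the position `x` in the undeformed motion. -/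
def flowMap (Ω : Set E3) (γ : ℝ → E3 → E3) (Γ : ℝ → ℝ → E3 → E3) (s t : ℝ) (x : E3) : E3 :=
  Γ s t (label Ω γ t x)

/-- The Eulerian velocity field of a variation. -/
def variationField (Ω : Set E3) (γ : ℝ → E3 → E3) (Γ : ℝ → ℝ → E3 → E3) (t : ℝ) (x : E3) : E3 :=
  deriv (fun s => flowMap Ω γ Γ s t x) 0

/-- The particle velocity in the deformed motion. -/
def particleVelocity (Ω : Set E3) (γ : ℝ → E3 → E3) (Γ : ℝ → ℝ → E3 → E3) (s t : ℝ) (x : E3) :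
    E3 :=
  deriv (fun τ => Γ s τ (label Ω γ t x)) t

section Flow
variable {Ω : Set E3} {T₀ : ℝ} {γ : ℝ → E3 → E3} {Γ : ℝ → ℝ → E3 → E3} {δ : ℝ}

/-- Differentiate γ_t ∘ label = id and use that γ_t has Jacobian 1. -/
theorem det_fderiv_label (hΩ : IsOpen Ω) (hγ : IsMotion Ω T₀ γ) {t : ℝ} (ht : t ∈ Ioo 0 T₀)
    {x : E3} (hx : x ∈ Ω) :
    DifferentiableAt ℝ (label Ω γ t) x ∧ (fderiv ℝ (label Ω γ t) x).det = 1 := by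
  have hl : DifferentiableAt ℝ (label Ω γ t) x :=
    (hasFDerivAt_partial_snd (f := fun z : ℝ × E3 => label Ω γ z.1 z.2) (z := (t, x))
      (((hγ.label_contDiffOn hΩ).contDiffAt ((IsMotion.isOpen_domain hΩ T₀).mem_nhds
        ⟨ht, hx⟩)).differentiableAt (by simp))).differentiableAt
  refine ⟨hl, ?_⟩
  have hy := label_mem (hγ.diffeo t ht) hx
  have hg := (hγ.diffeo t ht).differentiableAt hΩ hy
  have h1 : HasFDerivAt (fun x => γ t (label Ω γ t x))
      ((fderiv ℝ (γ t) (label Ω γ t x)).comp (fderiv ℝ (label Ω γ t) x)) x :=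
    hg.hasFDerivAt.comp x hl.hasFDerivAt
  have h2 : HasFDerivAt (fun x => γ t (label Ω γ t x)) (ContinuousLinearMap.id ℝ E3) x := by
    refine (hasFDerivAt_id x).congr_of_eventuallyEq ?_
    filter_upwards [hΩ.mem_nhds hx] with z hz
    exact apply_label (hγ.diffeo t ht) hz
  have h3 := congrArg (fun A : E3 →L[ℝ] E3 => A.det) (h1.unique h2)
  have h4 : ((fderiv ℝ (γ t) (label Ω γ t x)).comp (fderiv ℝ (label Ω γ t) x)).det =
      (fderiv ℝ (γ t) (label Ω γ t x)).det * (fderiv ℝ (label Ω γ t) x).det :=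
    LinearMap.det_comp _ _
  have h5 : (ContinuousLinearMap.id ℝ E3).det = 1 := LinearMap.det_id
  simp only at h3
  rw [h4, h5, hγ.jacobian_eq_one t ht _ hy, one_mul] at h3
  exact h3

theorem isDiffeo_flowMap (hΩ : IsOpen Ω) (hγ : IsMotion Ω T₀ γ) (hΓ : IsVariation Ω T₀ γ Γ δ)
    {s t : ℝ} (hs : s ∈ Ioo (-δ) δ) (ht : t ∈ Ioo 0 T₀) :
    IsDiffeo Ω (flowMap Ω γ Γ s t) ∧ ∀ x ∈ Ω, (fderiv ℝ (flowMap Ω γ Γ s t) x).det =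
      (fderiv ℝ (Γ s t) (label Ω γ t x)).det := by
  have hγd := hγ.diffeo t ht
  have hΓd := hΓ.diffeo s hs t ht
  have hdet : ∀ x ∈ Ω, (fderiv ℝ (flowMap Ω γ Γ s t) x).det =
      (fderiv ℝ (Γ s t) (label Ω γ t x)).det := by
    intro x hx
    obtain ⟨hl, h1⟩ := det_fderiv_label hΩ hγ ht hx
    have h2 : HasFDerivAt (flowMap Ω γ Γ s t) _ x :=
      (hΓd.differentiableAt hΩ (label_mem hγd hx)).hasFDerivAt.comp x hl.hasFDerivAt
    have h4 : ((fderiv ℝ (Γ s t) (label Ω γ t x)).comp (fderiv ℝ (label Ω γ t) x)).det =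
        (fderiv ℝ (Γ s t) (label Ω γ t x)).det * (fderiv ℝ (label Ω γ t) x).det :=
      LinearMap.det_comp _ _
    rw [h2.fderiv, h4, h1, mul_one]
  refine ⟨⟨?_, ?_, fun x hx => ?_⟩, hdet⟩
  · refine hΓd.bijOn.comp ⟨fun x hx => label_mem hγd hx, fun x hx x' hx' h => ?_, fun y hy => ?_⟩
    · rw [← apply_label hγd hx, h, apply_label hγd hx']
    · exact ⟨γ t y, hγd.bijOn.mapsTo hy, label_apply hγd hy⟩
  · refine hΓd.smooth.comp ?_ fun x hx => label_mem hγd hx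
    exact (hγ.label_contDiffOn hΩ).comp (f := fun x : E3 => (t, x))
      (contDiffOn_const.prodMk contDiffOn_id) fun x hx => ⟨ht, hx⟩
  · rw [hdet x hx]
    exact hΓd.jacobian_pos _ (label_mem hγd hx)

theorem label_flowMap (hγ : IsMotion Ω T₀ γ) (hΓ : IsVariation Ω T₀ γ Γ δ)
    {s t : ℝ} (hs : s ∈ Ioo (-δ) δ) (ht : t ∈ Ioo 0 T₀) {x : E3} (hx : x ∈ Ω) :
    label Ω (Γ s) t (flowMap Ω γ Γ s t x) = label Ω γ t x :=
  label_apply (hΓ.diffeo s hs t ht) (label_mem (hγ.diffeo t ht) hx)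

theorem transported_flowMap (hγ : IsMotion Ω T₀ γ) (hΓ : IsVariation Ω T₀ γ Γ δ)
    {s t : ℝ} (hs : s ∈ Ioo (-δ) δ) (ht : t ∈ Ioo 0 T₀) {x : E3} (hx : x ∈ Ω) (f : E3 → ℝ) :
    transported Ω (Γ s) f t (flowMap Ω γ Γ s t x) = transported Ω γ f t x := by
  rw [transported, label_flowMap hγ hΓ hs ht hx, transported]

theorem density_flowMap (hγ : IsMotion Ω T₀ γ) (hΓ : IsVariation Ω T₀ γ Γ δ)
    {s t : ℝ} (hs : s ∈ Ioo (-δ) δ) (ht : t ∈ Ioo 0 T₀) {x : E3} (hx : x ∈ Ω)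
    (ξ : Fin 3 → E3 → ℝ) (ρ : Fin 3 → ℝ) :
    density Ω ξ ρ (Γ s) t (flowMap Ω γ Γ s t x) = density Ω ξ ρ γ t x := by
  simp only [density, transported_flowMap hγ hΓ hs ht hx]

theorem velocity_flowMap (hγ : IsMotion Ω T₀ γ) (hΓ : IsVariation Ω T₀ γ Γ δ)
    {s t : ℝ} (hs : s ∈ Ioo (-δ) δ) (ht : t ∈ Ioo 0 T₀) {x : E3} (hx : x ∈ Ω) :
    velocity Ω (Γ s) t (flowMap Ω γ Γ s t x) = particleVelocity Ω γ Γ s t x := by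
  rw [velocity, label_flowMap hγ hΓ hs ht hx, particleVelocity]

theorem det_ne_zero_inverse {A : E3 →L[ℝ] E3} (hA : A.det ≠ 0) :
    ∃ e : E3 ≃L[ℝ] E3, (e : E3 →L[ℝ] E3) = A :=
  ⟨A.toContinuousLinearEquivOfDetNeZero hA, by ext; rfl⟩

/-- The color function of the deformed motion, composed with the flow map, is that of the original
motion; the chain rule then multiplies the covector by the inverse deformation gradient. -/
theorem gradNorm_flowMap (hΩ : IsOpen Ω) (hγ : IsMotion Ω T₀ γ) (hΓ : IsVariation Ω T₀ γ Γ δ)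
    {ξ : Fin 3 → E3 → ℝ} (hξ : ∀ a, ContDiffOn ℝ ∞ (ξ a) Ω)
    {s t : ℝ} (hs : s ∈ Ioo (-δ) δ) (ht : t ∈ Ioo 0 T₀) {x : E3} (hx : x ∈ Ω) (a : Fin 3) :
    gradNorm Ω ξ (Γ s) a t (flowMap Ω γ Γ s t x) =
      ‖(fderiv ℝ (transported Ω γ (ξ a) t) x).comp
        (fderiv ℝ (flowMap Ω γ Γ s t) x).inverse‖ := by
  obtain ⟨hd, -⟩ := isDiffeo_flowMap hΩ hγ hΓ hs ht
  have hfx := hd.bijOn.mapsTo hx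
  have hΓd := hΓ.diffeo s hs t ht
  have hlab : DifferentiableAt ℝ (label Ω (Γ s) t) (flowMap Ω γ Γ s t x) := by
    have hsm : ContDiffOn ℝ ∞ (fun z : ℝ × E3 => Γ s z.1 z.2) (Ioo 0 T₀ ×ˢ Ω) :=
      hΓ.smooth.comp (f := fun z : ℝ × E3 => (s, z)) (contDiffOn_const.prodMk contDiffOn_id)
        fun z hz => ⟨hs, hz⟩
    exact (hasFDerivAt_partial_snd (f := fun z : ℝ × E3 => label Ω (Γ s) z.1 z.2)
      (z := (t, flowMap Ω γ Γ s t x)) (((contDiffOn_label hΩ hsm fun t ht =>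
        hΓ.diffeo s hs t ht).contDiffAt ((IsMotion.isOpen_domain hΩ T₀).mem_nhds
          ⟨ht, hfx⟩)).differentiableAt (by simp))).differentiableAt
  have htr : DifferentiableAt ℝ (transported Ω (Γ s) (ξ a) t) (flowMap Ω γ Γ s t x) :=
    DifferentiableAt.comp (g := ξ a) _ (((hξ a).contDiffAt (hΩ.mem_nhds
      (label_mem hΓd hfx))).differentiableAt (by simp)) hlab
  have hfd := hd.differentiableAt hΩ hx
  have h1 := htr.hasFDerivAt.comp x hfd.hasFDerivAt
  have h2 : HasFDerivAt (transported Ω γ (ξ a) t)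
      ((fderiv ℝ (transported Ω (Γ s) (ξ a) t) (flowMap Ω γ Γ s t x)).comp
        (fderiv ℝ (flowMap Ω γ Γ s t) x)) x := by
    refine h1.congr_of_eventuallyEq ?_
    filter_upwards [hΩ.mem_nhds hx] with z hz
    exact (transported_flowMap hγ hΓ hs ht hz (ξ a)).symm
  obtain ⟨e, he⟩ := det_ne_zero_inverse (hd.jacobian_pos x hx).ne'
  rw [h2.fderiv, ← he, ContinuousLinearMap.inverse_equiv, ContinuousLinearMap.comp_assoc]
  simp [gradNorm, gradient]

end Flow

/-- The gradient of a phase in the deformed motion, times the Jacobian of the deformation. -/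
def gradVec (Ω : Set E3) (γ : ℝ → E3 → E3) (Γ : ℝ → ℝ → E3 → E3) (f : E3 → ℝ) (s t : ℝ)
    (x : E3) : E3 :=
  (InnerProductSpace.toDual ℝ E3).symm ((fderiv ℝ (flowMap Ω γ Γ s t) x).det •
    (fderiv ℝ (transported Ω γ f t) x).comp (fderiv ℝ (flowMap Ω γ Γ s t) x).inverse)

/-- The smooth part of the action density of the deformed motion. -/
def bulkDensity (Ω : Set E3) (ξ : Fin 3 → E3 → ℝ) (ρ p : Fin 3 → ℝ) (γ : ℝ → E3 → E3)
    (Γ : ℝ → ℝ → E3 → E3) (s t : ℝ) (x : E3) : ℝ :=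
  (1 / 2 * density Ω ξ ρ γ t x * ‖particleVelocity Ω γ Γ s t x‖ ^ 2 +
    (p 1 * transported Ω γ (ξ 1) t x + p 2 * transported Ω γ (ξ 2) t x)) *
    (fderiv ℝ (flowMap Ω γ Γ s t) x).det

/-- The action density of the deformed motion in the coordinates of the undeformed one. -/
def actionDensity (Ω : Set E3) (ξ : Fin 3 → E3 → ℝ) (ρ σ p : Fin 3 → ℝ) (γ : ℝ → E3 → E3)
    (Γ : ℝ → ℝ → E3 → E3) (s t : ℝ) (x : E3) : ℝ :=
  bulkDensity Ω ξ ρ p γ Γ s t x -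
    (σ 1 * ‖gradVec Ω γ Γ (ξ 1) s t x‖ + σ 2 * ‖gradVec Ω γ Γ (ξ 2) s t x‖)

section
variable {Ω : Set E3} {T₀ : ℝ} {γ : ℝ → E3 → E3} {Γ : ℝ → ℝ → E3 → E3} {δ : ℝ}
  {ξ : Fin 3 → E3 → ℝ}

/-- Change of variables by the flow map. Densities and color functions are carried along, so they
become independent of s. The positive Jacobian is absorbed into the norm of `gradVec`. -/
theorem wallAction_eq (hΩ : IsOpen Ω) (hγ : IsMotion Ω T₀ γ) (hΓ : IsVariation Ω T₀ γ Γ δ)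
    (hξ : ∀ a, ContDiffOn ℝ ∞ (ξ a) Ω) (ρ σ p : Fin 3 → ℝ) {s : ℝ} (hs : s ∈ Ioo (-δ) δ) :
    wallAction Ω T₀ ξ ρ σ p (Γ s) =
      ∫ t in Ioo 0 T₀, ∫ x in Ω, actionDensity Ω ξ ρ σ p γ Γ s t x := by
  refine setIntegral_congr_fun measurableSet_Ioo fun t ht => ?_
  obtain ⟨hd, -⟩ := isDiffeo_flowMap hΩ hγ hΓ hs ht
  rw [hd.integral_comp hΩ]
  refine setIntegral_congr_fun hΩ.measurableSet fun x hx => ?_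
  have hJ := hd.jacobian_pos x hx
  have hn : ∀ a, ‖gradVec Ω γ Γ (ξ a) s t x‖ = (fderiv ℝ (flowMap Ω γ Γ s t) x).det *
      gradNorm Ω ξ (Γ s) a t (flowMap Ω γ Γ s t x) := by
    intro a
    rw [gradVec, LinearIsometryEquiv.norm_map, norm_smul, Real.norm_of_nonneg hJ.le,
      gradNorm_flowMap hΩ hγ hΓ hξ hs ht hx]
  simp only [actionDensity, bulkDensity, hn, kinetic, Finset.sum_pair (by decide : (1 : Fin 3) ≠ 2),
    density_flowMap hγ hΓ hs ht hx, velocity_flowMap hγ hΓ hs ht hx,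
    transported_flowMap hγ hΓ hs ht hx]
  ring

theorem IsVariation.isOpen_domain (hΩ : IsOpen Ω) (T₀ δ : ℝ) :
    IsOpen (Ioo (-δ) δ ×ˢ (Ioo 0 T₀ ×ˢ Ω)) := isOpen_Ioo.prod (isOpen_Ioo.prod hΩ)

theorem contDiffOn_lagrangian_label {F : Type*} [NormedAddCommGroup F] [NormedSpace ℝ F]
    (hΩ : IsOpen Ω) (hγ : IsMotion Ω T₀ γ) {g : ℝ × ℝ × E3 → F}
    (hg : ContDiffOn ℝ ∞ g (Ioo (-δ) δ ×ˢ (Ioo 0 T₀ ×ˢ Ω))) :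
    ContDiffOn ℝ ∞ (fun z : ℝ × ℝ × E3 => g (z.1, z.2.1, label Ω γ z.2.1 z.2.2))
      (Ioo (-δ) δ ×ˢ (Ioo 0 T₀ ×ˢ Ω)) := by
  have hl : ContDiffOn ℝ ∞ (fun z : ℝ × ℝ × E3 => label Ω γ z.2.1 z.2.2)
      (Ioo (-δ) δ ×ˢ (Ioo 0 T₀ ×ˢ Ω)) :=
    (hγ.label_contDiffOn hΩ).comp contDiffOn_snd fun z hz => hz.2
  refine hg.comp (contDiffOn_fst.prodMk ((contDiff_fst.comp contDiff_snd).contDiffOn.prodMk hl))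
    fun z hz => ⟨hz.1, hz.2.1, label_mem (hγ.diffeo _ hz.2.1) hz.2.2⟩

theorem contDiffOn_flowMap (hΩ : IsOpen Ω) (hγ : IsMotion Ω T₀ γ)
    (hΓ : IsVariation Ω T₀ γ Γ δ) :
    ContDiffOn ℝ ∞ (fun z : ℝ × ℝ × E3 => flowMap Ω γ Γ z.1 z.2.1 z.2.2)
      (Ioo (-δ) δ ×ˢ (Ioo 0 T₀ ×ˢ Ω)) :=
  contDiffOn_lagrangian_label hΩ hγ hΓ.smooth

theorem fderiv_flowMap_eq (hΩ : IsOpen Ω) (hγ : IsMotion Ω T₀ γ) (hΓ : IsVariation Ω T₀ γ Γ δ)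
    {z : ℝ × ℝ × E3} (hz : z ∈ Ioo (-δ) δ ×ˢ (Ioo 0 T₀ ×ˢ Ω)) :
    fderiv ℝ (flowMap Ω γ Γ z.1 z.2.1) z.2.2 =
      (fderiv ℝ (fun z : ℝ × ℝ × E3 => flowMap Ω γ Γ z.1 z.2.1 z.2.2) z).comp
      ((ContinuousLinearMap.inr ℝ ℝ (ℝ × E3)).comp (ContinuousLinearMap.inr ℝ ℝ E3)) :=
  (hasFDerivAt_partial_third (((contDiffOn_flowMap hΩ hγ hΓ).contDiffAt
    ((IsVariation.isOpen_domain hΩ T₀ δ).mem_nhds hz)).differentiableAt (by simp))).fderiv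

theorem contDiffOn_fderiv_flowMap (hΩ : IsOpen Ω) (hγ : IsMotion Ω T₀ γ)
    (hΓ : IsVariation Ω T₀ γ Γ δ) :
    ContDiffOn ℝ ∞ (fun z : ℝ × ℝ × E3 => fderiv ℝ (flowMap Ω γ Γ z.1 z.2.1) z.2.2)
      (Ioo (-δ) δ ×ˢ (Ioo 0 T₀ ×ˢ Ω)) := by
  have ho := IsVariation.isOpen_domain hΩ T₀ δ
  refine ContDiffOn.congr ?_ fun z hz => fderiv_flowMap_eq hΩ hγ hΓ hz
  exact ((contDiffOn_flowMap hΩ hγ hΓ).fderiv_of_isOpen ho (by simp)).clm_comp contDiffOn_const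

theorem contDiffOn_particleVelocity (hΩ : IsOpen Ω) (hγ : IsMotion Ω T₀ γ)
    (hΓ : IsVariation Ω T₀ γ Γ δ) :
    ContDiffOn ℝ ∞ (fun z : ℝ × ℝ × E3 => particleVelocity Ω γ Γ z.1 z.2.1 z.2.2)
      (Ioo (-δ) δ ×ˢ (Ioo 0 T₀ ×ˢ Ω)) := by
  have ho := IsVariation.isOpen_domain hΩ T₀ δ
  have h : ContDiffOn ℝ ∞ (fun z : ℝ × ℝ × E3 => deriv (fun τ => Γ z.1 τ z.2.2) z.2.1)
      (Ioo (-δ) δ ×ˢ (Ioo 0 T₀ ×ˢ Ω)) := by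
    have h1 : ContDiffOn ℝ ∞ (fun z => fderiv ℝ (fun z : ℝ × ℝ × E3 => Γ z.1 z.2.1 z.2.2) z
        (0, 1, 0)) (Ioo (-δ) δ ×ˢ (Ioo 0 T₀ ×ˢ Ω)) :=
      (hΓ.smooth.fderiv_of_isOpen ho (by simp)).clm_apply contDiffOn_const
    refine h1.congr fun z hz => ?_
    exact (hasDerivAt_partial_second (f := fun z : ℝ × ℝ × E3 => Γ z.1 z.2.1 z.2.2)
      ((hΓ.smooth.contDiffAt (ho.mem_nhds hz)).differentiableAt (by simp))).deriv
  exact contDiffOn_lagrangian_label hΩ hγ h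

theorem contDiffOn_eulerian_snd {F : Type*} [NormedAddCommGroup F] [NormedSpace ℝ F]
    {g : ℝ × E3 → F} (hg : ContDiffOn ℝ ∞ g (Ioo 0 T₀ ×ˢ Ω)) :
    ContDiffOn ℝ ∞ (fun z : ℝ × ℝ × E3 => g z.2) (Ioo (-δ) δ ×ˢ (Ioo 0 T₀ ×ˢ Ω)) :=
  hg.comp contDiffOn_snd fun _ hz => hz.2

theorem contDiffOn_inverse {X : Type*} [NormedAddCommGroup X] [NormedSpace ℝ X] {D : Set X}
    {M : X → E3 →L[ℝ] E3} (hM : ContDiffOn ℝ ∞ M D) (h0 : ∀ z ∈ D, (M z).det ≠ 0) :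
    ContDiffOn ℝ ∞ (fun z => (M z).inverse) D := by
  intro z hz
  obtain ⟨e, he⟩ := det_ne_zero_inverse (h0 z hz)
  have h : ContDiffAt ℝ ∞ (ContinuousLinearMap.inverse : (E3 →L[ℝ] E3) → _) (M z) := by
    rw [← he]; exact contDiffAt_map_inverse e
  exact h.comp_contDiffWithinAt z (hM z hz)

theorem contDiffOn_gradVec (hΩ : IsOpen Ω) (hγ : IsMotion Ω T₀ γ)
    (hΓ : IsVariation Ω T₀ γ Γ δ) {f : E3 → ℝ} (hf : ContDiffOn ℝ ∞ f Ω) :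
    ContDiffOn ℝ ∞ (fun z : ℝ × ℝ × E3 => gradVec Ω γ Γ f z.1 z.2.1 z.2.2)
      (Ioo (-δ) δ ×ˢ (Ioo 0 T₀ ×ˢ Ω)) := by
  have hM := contDiffOn_fderiv_flowMap hΩ hγ hΓ
  have hdet := contDiff_det.comp_contDiffOn hM
  have hinv := contDiffOn_inverse hM fun z hz =>
    ((isDiffeo_flowMap hΩ hγ hΓ hz.1 hz.2.1).1.jacobian_pos _ hz.2.2).ne'
  have hfd : ContDiffOn ℝ ∞ (fun z : ℝ × ℝ × E3 => fderiv ℝ (transported Ω γ f z.2.1) z.2.2)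
      (Ioo (-δ) δ ×ˢ (Ioo 0 T₀ ×ˢ Ω)) :=
    contDiffOn_eulerian_snd (g := fun z : ℝ × E3 => fderiv ℝ (transported Ω γ f z.1) z.2)
      (contDiffOn_partial_snd (f := fun z : ℝ × E3 => transported Ω γ f z.1 z.2)
        (IsMotion.isOpen_domain hΩ T₀) (hγ.transported_contDiffOn hΩ hf))
  exact (InnerProductSpace.toDual ℝ E3).symm.contDiff.comp_contDiffOn
    (hdet.smul (hfd.clm_comp hinv))

theorem contDiffOn_bulkDensity (hΩ : IsOpen Ω) (hγ : IsMotion Ω T₀ γ)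
    (hΓ : IsVariation Ω T₀ γ Γ δ) (hξ : ∀ a, ContDiffOn ℝ ∞ (ξ a) Ω) (ρ p : Fin 3 → ℝ) :
    ContDiffOn ℝ ∞ (fun z : ℝ × ℝ × E3 => bulkDensity Ω ξ ρ p γ Γ z.1 z.2.1 z.2.2)
      (Ioo (-δ) δ ×ˢ (Ioo 0 T₀ ×ˢ Ω)) := by
  have hdet := contDiff_det.comp_contDiffOn (contDiffOn_fderiv_flowMap hΩ hγ hΓ)
  have hρ := contDiffOn_eulerian_snd (δ := δ) (hγ.density_contDiffOn hΩ hξ ρ)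
  have ht := fun a => contDiffOn_eulerian_snd (δ := δ) (hγ.transported_contDiffOn hΩ (hξ a))
  exact (((contDiffOn_const.mul hρ).mul ((contDiffOn_particleVelocity hΩ hγ hΓ).norm_sq ℝ)).add
    ((contDiffOn_const.mul (ht 1)).add (contDiffOn_const.mul (ht 2)))).mul hdet

/-- The norm destroys smoothness where a gradient vanishes, but the Lipschitz bound that remains is
all that dominated differentiation in s needs. -/
theorem actionDensity_locallyLipschitzOn (hΩ : IsOpen Ω) (hγ : IsMotion Ω T₀ γ)
    (hΓ : IsVariation Ω T₀ γ Γ δ) (hξ : ∀ a, ContDiffOn ℝ ∞ (ξ a) Ω) (ρ σ p : Fin 3 → ℝ) :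
    LocallyLipschitzOn (Ioo (-δ) δ ×ˢ (Ioo 0 T₀ ×ˢ Ω))
      fun z : ℝ × ℝ × E3 => actionDensity Ω ξ ρ σ p γ Γ z.1 z.2.1 z.2.2 := by
  have ho := IsVariation.isOpen_domain hΩ T₀ δ
  have h : ∀ a, LocallyLipschitzOn (Ioo (-δ) δ ×ˢ (Ioo 0 T₀ ×ˢ Ω))
      fun z : ℝ × ℝ × E3 => σ a * ‖gradVec Ω γ Γ (ξ a) z.1 z.2.1 z.2.2‖ := fun a =>
    ((lipschitzWith_one_norm (E := E3)).const_mul_real (σ a)).comp_locallyLipschitzOn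
      (locallyLipschitzOn_of_contDiffOn ho (contDiffOn_gradVec hΩ hγ hΓ (hξ a)))
  exact (locallyLipschitzOn_of_contDiffOn ho (contDiffOn_bulkDensity hΩ hγ hΓ hξ ρ p)).sub
    ((h 1).add (h 2))

/-- The deformation acts in a compact part of space-time. -/
theorem exists_compact_flowMap_eq (hγ : IsMotion Ω T₀ γ) (hΓ : IsVariation Ω T₀ γ Γ δ) :
    ∃ K : Set (ℝ × E3), IsCompact K ∧ K ⊆ Ioo 0 T₀ ×ˢ Ω ∧
      ∀ t ∈ Ioo 0 T₀, ∀ y ∈ Ω, (t, γ t y) ∉ K → ∀ s ∈ Ioo (-δ) δ, Γ s t y = γ t y := by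
  obtain ⟨K, hK, hKW, h⟩ := hΓ.compactSupport
  refine ⟨(fun z : ℝ × E3 => (z.1, γ z.1 z.2)) '' K, hK.image_of_continuousOn ?_, ?_, ?_⟩
  · exact continuousOn_fst.prodMk (hγ.smooth.continuousOn.mono hKW)
  · rintro _ ⟨z, hz, rfl⟩
    exact ⟨(hKW hz).1, (hγ.diffeo _ (hKW hz).1).bijOn.mapsTo (hKW hz).2⟩
  · intro t ht y hy hK s hs
    exact h s hs t ht y hy fun hmem => hK ⟨(t, y), hmem, rfl⟩

theorem flowMap_zero (hγ : IsMotion Ω T₀ γ) (hΓ : IsVariation Ω T₀ γ Γ δ) {t : ℝ}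
    (ht : t ∈ Ioo 0 T₀) {x : E3} (hx : x ∈ Ω) : flowMap Ω γ Γ 0 t x = x := by
  rw [flowMap, hΓ.start t ht _ (label_mem (hγ.diffeo t ht) hx), apply_label (hγ.diffeo t ht) hx]

theorem fderiv_flowMap_zero (hΩ : IsOpen Ω) (hγ : IsMotion Ω T₀ γ)
    (hΓ : IsVariation Ω T₀ γ Γ δ) {t : ℝ} (ht : t ∈ Ioo 0 T₀) {x : E3} (hx : x ∈ Ω) :
    fderiv ℝ (flowMap Ω γ Γ 0 t) x = ContinuousLinearMap.id ℝ E3 := by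
  have : flowMap Ω γ Γ 0 t =ᶠ[𝓝 x] id := by
    filter_upwards [hΩ.mem_nhds hx] with z hz
    exact flowMap_zero hγ hΓ ht hz
  rw [this.fderiv_eq, fderiv_id]

theorem particleVelocity_zero (hγ : IsMotion Ω T₀ γ) (hΓ : IsVariation Ω T₀ γ Γ δ) {t : ℝ}
    (ht : t ∈ Ioo 0 T₀) {x : E3} (hx : x ∈ Ω) :
    particleVelocity Ω γ Γ 0 t x = velocity Ω γ t x := by
  refine EventuallyEq.deriv_eq ?_
  filter_upwards [isOpen_Ioo.mem_nhds ht] with τ hτ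
  exact hΓ.start τ hτ _ (label_mem (hγ.diffeo t ht) hx)

/-- Off the support, the deformation is trivial near every point. -/
theorem flowMap_eventuallyEq_of_notMem (hΩ : IsOpen Ω) (hγ : IsMotion Ω T₀ γ)
    {K : Set (ℝ × E3)} (hK : IsCompact K)
    (h : ∀ t ∈ Ioo 0 T₀, ∀ y ∈ Ω, (t, γ t y) ∉ K → ∀ s ∈ Ioo (-δ) δ, Γ s t y = γ t y)
    {t : ℝ} (ht : t ∈ Ioo 0 T₀) {x : E3} (hx : x ∈ Ω) (hxK : (t, x) ∉ K) {s : ℝ}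
    (hs : s ∈ Ioo (-δ) δ) :
    (flowMap Ω γ Γ s t =ᶠ[𝓝 x] id) ∧
    particleVelocity Ω γ Γ s t x = velocity Ω γ t x := by
  have hnb := hK.isClosed.isOpen_compl.mem_nhds hxK
  constructor
  · have hc : ContinuousAt (fun x' : E3 => (t, x')) x := by fun_prop
    filter_upwards [hc.preimage_mem_nhds hnb, hΩ.mem_nhds hx] with x' h1 h2
    have h3 := apply_label (hγ.diffeo t ht) h2
    rw [flowMap, h t ht _ (label_mem (hγ.diffeo t ht) h2) (by rw [h3]; exact h1) s hs, h3]
    rfl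
  · have hl := label_mem (hγ.diffeo t ht) hx
    refine EventuallyEq.deriv_eq ?_
    have hc : ContinuousAt (fun τ : ℝ => (τ, γ τ (label Ω γ t x))) t := by
      refine continuousAt_id.prodMk ?_
      exact (hasDerivAt_partial_fst (f := fun z : ℝ × E3 => γ z.1 z.2)
        (z := (t, label Ω γ t x)) ((hγ.smooth.contDiffAt ((IsMotion.isOpen_domain hΩ T₀).mem_nhds
          ⟨ht, hl⟩)).differentiableAt (by simp))).continuousAt
    have hnb' : Kᶜ ∈ 𝓝 (t, γ t (label Ω γ t x)) := by
      rwa [apply_label (hγ.diffeo t ht) hx]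
    filter_upwards [hc.preimage_mem_nhds hnb', isOpen_Ioo.mem_nhds ht] with τ h1 h2
    exact h τ h2 _ hl h1 s hs

/-- The right-hand side does not involve s, so away from the support of the variation the density is
constant in s. -/
theorem actionDensity_eq_of_flowMap_eventuallyEq {s t : ℝ} {x : E3} {ρ σ p : Fin 3 → ℝ}
    (h1 : flowMap Ω γ Γ s t =ᶠ[𝓝 x] id)
    (h2 : particleVelocity Ω γ Γ s t x = velocity Ω γ t x) :
    actionDensity Ω ξ ρ σ p γ Γ s t x = kinetic Ω ξ ρ γ t x -
      ∑ a ∈ ({1, 2} : Finset (Fin 3)),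
        (σ a * gradNorm Ω ξ γ a t x - p a * transported Ω γ (ξ a) t x) := by
  have h3 : fderiv ℝ (flowMap Ω γ Γ s t) x = ContinuousLinearMap.id ℝ E3 := by
    rw [h1.fderiv_eq, fderiv_id]
  have h4 : (ContinuousLinearMap.id ℝ E3).det = 1 := LinearMap.det_id
  have h5 : (ContinuousLinearMap.id ℝ E3).inverse = ContinuousLinearMap.id ℝ E3 :=
    ContinuousLinearMap.inverse_id
  rw [Finset.sum_pair (by decide)]
  simp only [actionDensity, bulkDensity, gradVec, h3, h4, h5, h2, one_smul, mul_one, kinetic,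
    gradNorm, gradient, ContinuousLinearMap.comp_id]
  ring

end

/-! ### First variation of the action density -/

/-- Contracting |q|(I - n ⊗ n) with A leaves |q|(tr A - n · A n), the form in which the derivative
of the Jacobian times the gradient length appears. -/
theorem sum_stressEntry_mul (q : E3) (A : E3 →L[ℝ] E3) :
    ∑ i : Fin 3, ∑ j : Fin 3, stressEntry i j q * A (EuclideanSpace.single j 1) i =
      ‖q‖ * ((∑ i : Fin 3, A (EuclideanSpace.single i 1) i) -
        inner ℝ (‖q‖⁻¹ • q) (A (‖q‖⁻¹ • q))) := by
  set n := ‖q‖⁻¹ • q with hn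
  have hA : A n = ∑ j, n j • A (EuclideanSpace.single j 1) := by
    conv_lhs => rw [← (EuclideanSpace.basisFun (Fin 3) ℝ).sum_repr n]
    simp
  rw [inner_eq_sum, hA]
  simp only [stressEntry, ← hn, Fin.sum_univ_three, PiLp.add_apply, PiLp.smul_apply, smul_eq_mul]
  simp
  ring

theorem hasDerivAt_norm_of_ne_zero {g : ℝ → E3} {g' : E3} {s : ℝ} (hg : HasDerivAt g g' s)
    (h0 : g s ≠ 0) : HasDerivAt (fun s => ‖g s‖) (inner ℝ (‖g s‖⁻¹ • g s) g') s := by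
  have h1 := hg.norm_sq.sqrt (by positivity)
  simp only [Real.sqrt_sq (norm_nonneg _)] at h1
  refine h1.congr_deriv ?_
  rw [real_inner_smul_left]
  have := norm_ne_zero_iff.2 h0
  field_simp

/-- First order change of the norm of the gradient under a deformation. -/
theorem hasDerivAt_norm_gradient {M : ℝ → E3 →L[ℝ] E3} {A : E3 →L[ℝ] E3}
    (hM : HasDerivAt M A 0) (h0 : M 0 = ContinuousLinearMap.id ℝ E3)
    (htr : ∑ i : Fin 3, A (EuclideanSpace.single i 1) i = 0) (q : E3) :
    HasDerivAt (fun s => ‖(InnerProductSpace.toDual ℝ E3).symm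
        ((M s).det • (innerSL ℝ q).comp (M s).inverse)‖)
      (∑ i : Fin 3, ∑ j : Fin 3, stressEntry i j q * A (EuclideanSpace.single j 1) i) 0 := by
  have hdet := hasDerivAt_det_of_eq_id hM h0
  rw [htr] at hdet
  have hinv : HasDerivAt (fun s => (M s).inverse) (-A) 0 := by
    have h1 := hasFDerivAt_ringInverse (𝕜 := ℝ) (1 : (E3 →L[ℝ] E3)ˣ)
    rw [ContinuousLinearMap.ringInverse_eq_inverse] at h1
    have h2 : ((1 : (E3 →L[ℝ] E3)ˣ) : E3 →L[ℝ] E3) = M 0 := by rw [h0]; rfl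
    rw [h2] at h1
    refine (h1.comp_hasDerivAt 0 hM).congr_deriv ?_
    ext v
    simp
  have h4 : (ContinuousLinearMap.id ℝ E3).det = 1 := LinearMap.det_id
  have h5 : (ContinuousLinearMap.id ℝ E3).inverse = ContinuousLinearMap.id ℝ E3 :=
    ContinuousLinearMap.inverse_id
  have hcomp : HasDerivAt (fun s => (innerSL ℝ q).comp (M s).inverse)
      ((innerSL ℝ q).comp (-A)) 0 := by
    simpa using (hasDerivAt_const (0 : ℝ) (innerSL ℝ q)).clm_comp hinv
  set R : (E3 →L[ℝ] ℝ) →L[ℝ] E3 := LinearMap.mkContinuous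
    { toFun := fun l => (InnerProductSpace.toDual ℝ E3).symm l
      map_add' := fun l m => map_add _ l m
      map_smul' := fun c l => by simp } 1 (fun l => by simp) with hR
  have hRin : ∀ (l : E3 →L[ℝ] ℝ) (v : E3), inner ℝ (R l) v = l v := fun l v =>
    InnerProductSpace.toDual_symm_apply
  have hg := R.hasFDerivAt.comp_hasDerivAt (0 : ℝ) (hdet.smul hcomp)
  have hg0 : (InnerProductSpace.toDual ℝ E3).symm
      ((M 0).det • (innerSL ℝ q).comp (M 0).inverse) = q := by
    rw [h0, h4, h5, one_smul, ContinuousLinearMap.comp_id]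
    exact (InnerProductSpace.toDual ℝ E3).symm_apply_apply q
  -- If q = 0 the vector inside the norm is 0 for every s, so the corner of the norm is never met
  -- and the derivative is 0, as is the stress.
  rcases eq_or_ne q 0 with rfl | hq
  · have h1 : ∀ i j, stressEntry i j (0 : E3) = 0 := fun i j => by simp [stressEntry]
    simp only [h1, zero_mul, Finset.sum_const_zero, map_zero, ContinuousLinearMap.zero_comp,
      smul_zero, norm_zero]
    exact hasDerivAt_const _ _
  · have h1 := hasDerivAt_norm_of_ne_zero hg (by
      show (InnerProductSpace.toDual ℝ E3).symm
        ((M 0).det • (innerSL ℝ q).comp (M 0).inverse) ≠ 0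
      rw [hg0]; exact hq)
    refine HasDerivAt.congr_deriv (f := fun s => ‖(InnerProductSpace.toDual ℝ E3).symm
        ((M s).det • (innerSL ℝ q).comp (M s).inverse)‖) h1 ?_
    rw [sum_stressEntry_mul, htr]
    have h2 : (R ∘ ((fun s => (M s).det) • fun s => (innerSL ℝ q).comp (M s).inverse)) 0 = q := hg0
    rw [h2, h0, h4, one_smul, zero_smul, add_zero, real_inner_comm, hRin]
    have hq' : ‖q‖ ≠ 0 := norm_ne_zero_iff.2 hq
    simp only [ContinuousLinearMap.comp_apply, neg_apply, innerSL_apply_apply,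
      map_smul, inner_neg_right, real_inner_smul_left, real_inner_smul_right]
    rw [smul_eq_mul, zero_sub, mul_neg, mul_neg, neg_inj, mul_inv_cancel_left₀ hq']

section
variable {Ω : Set E3} {T₀ : ℝ} {γ : ℝ → E3 → E3} {Γ : ℝ → ℝ → E3 → E3} {δ : ℝ}
  {ξ : Fin 3 → E3 → ℝ}

theorem IsVariation.zero_mem (hΓ : IsVariation Ω T₀ γ Γ δ) : (0 : ℝ) ∈ Ioo (-δ) δ :=
  ⟨by linarith [hΓ.pos], hΓ.pos⟩

theorem IsVariation.mem_domain (hΓ : IsVariation Ω T₀ γ Γ δ) {t : ℝ} (ht : t ∈ Ioo 0 T₀) {x : E3}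
    (hx : x ∈ Ω) : ((0, t, x) : ℝ × ℝ × E3) ∈ Ioo (-δ) δ ×ˢ (Ioo 0 T₀ ×ˢ Ω) :=
  ⟨hΓ.zero_mem, ht, hx⟩

theorem variationField_contDiffOn (hΩ : IsOpen Ω) (hγ : IsMotion Ω T₀ γ)
    (hΓ : IsVariation Ω T₀ γ Γ δ) :
    ContDiffOn ℝ ∞ (fun z : ℝ × E3 => variationField Ω γ Γ z.1 z.2) (Ioo 0 T₀ ×ˢ Ω) :=
  (contDiffOn_partial_fst (f := fun z : ℝ × ℝ × E3 => flowMap Ω γ Γ z.1 z.2.1 z.2.2)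
    (IsVariation.isOpen_domain hΩ T₀ δ) (contDiffOn_flowMap hΩ hγ hΓ)).comp
    (f := fun z : ℝ × E3 => ((0 : ℝ), z)) (contDiffOn_const.prodMk contDiffOn_id)
    fun _ hz => ⟨hΓ.zero_mem, hz⟩

/-- The derivatives in s and x commute, both being components of the second derivative of the
jointly smooth flow map. -/
theorem hasDerivAt_fderiv_flowMap (hΩ : IsOpen Ω) (hγ : IsMotion Ω T₀ γ)
    (hΓ : IsVariation Ω T₀ γ Γ δ) {t : ℝ} (ht : t ∈ Ioo 0 T₀) {x : E3} (hx : x ∈ Ω) :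
    HasDerivAt (fun s => fderiv ℝ (flowMap Ω γ Γ s t) x)
      (fderiv ℝ (variationField Ω γ Γ t) x) 0 := by
  have ho := IsVariation.isOpen_domain hΩ T₀ δ
  set ψ := fun z : ℝ × ℝ × E3 => flowMap Ω γ Γ z.1 z.2.1 z.2.2 with hψ
  set L := (ContinuousLinearMap.inr ℝ ℝ (ℝ × E3)).comp (ContinuousLinearMap.inr ℝ ℝ E3) with hL
  have hψc : ContDiffOn ℝ ∞ ψ _ := contDiffOn_flowMap hΩ hγ hΓ
  have hz := hΓ.mem_domain ht hx
  have hat := hψc.contDiffAt (ho.mem_nhds hz)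
  have hd2 : DifferentiableAt ℝ (fderiv ℝ ψ) (0, t, x) :=
    (hat.fderiv_right (m := ∞) (by simp)).differentiableAt (by simp)
  have h1 := (hasDerivAt_partial_fst hd2).clm_comp (hasDerivAt_const (0 : ℝ) L)
  have h2 : HasDerivAt (fun s => fderiv ℝ (flowMap Ω γ Γ s t) x)
      ((fderiv ℝ (fderiv ℝ ψ) (0, t, x) (1, 0)).comp L +
        (fderiv ℝ ψ (0, t, x)).comp (0 : E3 →L[ℝ] ℝ × ℝ × E3)) 0 := by
    refine h1.congr_of_eventuallyEq ?_
    filter_upwards [isOpen_Ioo.mem_nhds hΓ.zero_mem] with s hs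
    exact fderiv_flowMap_eq hΩ hγ hΓ (z := (s, t, x)) ⟨hs, ht, hx⟩
  refine h2.congr_deriv ?_
  have hd3 : DifferentiableAt ℝ (fun z => fderiv ℝ ψ z (1, 0)) (0, t, x) :=
    hd2.clm_apply (differentiableAt_const _)
  have h3 : HasFDerivAt (variationField Ω γ Γ t)
      ((fderiv ℝ (fun z => fderiv ℝ ψ z (1, 0)) (0, t, x)).comp L) x := by
    refine (hasFDerivAt_partial_third hd3).congr_of_eventuallyEq ?_
    filter_upwards [hΩ.mem_nhds hx] with x' hx'
    exact (hasDerivAt_partial_fst (f := ψ) (z := (0, t, x'))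
      ((hψc.contDiffAt (ho.mem_nhds (hΓ.mem_domain ht hx'))).differentiableAt (by simp))).deriv
  rw [h3.fderiv]
  ext1 v
  have h4 := hasDerivAt_fderiv_apply_comm (e := ((1, 0) : ℝ × ℝ × E3)) (w := L v) hat
  have h5 : fderiv ℝ (fun z => fderiv ℝ ψ z (L v)) (0, t, x) (1, 0) =
      fderiv ℝ (fderiv ℝ ψ) (0, t, x) (1, 0) (L v) := by
    rw [fderiv_clm_apply hd2 (differentiableAt_const _)]
    simp
  simp only [ContinuousLinearMap.comp_apply]
  rw [← h4, h5]
  simp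

/-- The velocity field of an admissible variation is divergence free. -/
theorem divergence_variationField (hΩ : IsOpen Ω) (hγ : IsMotion Ω T₀ γ)
    (hΓ : IsVariation Ω T₀ γ Γ δ) {t : ℝ} (ht : t ∈ Ioo 0 T₀) {x : E3} (hx : x ∈ Ω) :
    divergence (variationField Ω γ Γ t) x = 0 := by
  have h1 := hasDerivAt_det_of_eq_id (hasDerivAt_fderiv_flowMap hΩ hγ hΓ ht hx)
    (fderiv_flowMap_zero hΩ hγ hΓ ht hx)
  have h2 := hΓ.tangent t ht _ (label_mem (hγ.diffeo t ht) hx)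
  have h3 : HasDerivAt (fun s => (fderiv ℝ (flowMap Ω γ Γ s t) x).det) 0 0 := by
    refine h2.congr_of_eventuallyEq ?_
    filter_upwards [isOpen_Ioo.mem_nhds hΓ.zero_mem] with s hs
    exact (isDiffeo_flowMap hΩ hγ hΓ hs ht).2 x hx
  exact h1.unique h3

/-- The rate of change of the particle velocity is the time derivative of the variation. -/
theorem hasDerivAt_variationField_along (hΩ : IsOpen Ω) (hγ : IsMotion Ω T₀ γ)
    (hΓ : IsVariation Ω T₀ γ Γ δ) {t : ℝ} (ht : t ∈ Ioo 0 T₀) {y : E3} (hy : y ∈ Ω) :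
    HasDerivAt (fun τ => variationField Ω γ Γ τ (γ τ y))
      (deriv (fun s => particleVelocity Ω γ Γ s t (γ t y)) 0) t := by
  have ho := IsVariation.isOpen_domain hΩ T₀ δ
  set g := fun z : ℝ × ℝ × E3 => Γ z.1 z.2.1 z.2.2 with hg
  have hgc : ContDiffOn ℝ ∞ g _ := hΓ.smooth
  have hat := hgc.contDiffAt (ho.mem_nhds (hΓ.mem_domain ht hy))
  have hd2 : DifferentiableAt ℝ (fderiv ℝ g) (0, t, y) :=
    (hat.fderiv_right (m := ∞) (by simp)).differentiableAt (by simp)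
  have hd : ∀ z ∈ Ioo (-δ) δ ×ˢ (Ioo 0 T₀ ×ˢ Ω), DifferentiableAt ℝ g z := fun z hz =>
    (hgc.contDiffAt (ho.mem_nhds hz)).differentiableAt (by simp)
  have h1 : HasDerivAt (fun τ => fderiv ℝ g (0, τ, y) (1, 0)) _ t :=
    hasDerivAt_partial_second (f := fun z => fderiv ℝ g z (1, 0)) (z := (0, t, y))
      (hd2.clm_apply (differentiableAt_const _))
  have h2 : HasDerivAt (fun s => fderiv ℝ g (s, t, y) (0, 1, 0)) _ 0 :=
    hasDerivAt_partial_fst (f := fun z => fderiv ℝ g z (0, 1, 0)) (z := (0, t, y))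
      (hd2.clm_apply (differentiableAt_const _))
  have h3 : deriv (fun s => particleVelocity Ω γ Γ s t (γ t y)) 0 =
      fderiv ℝ (fun z => fderiv ℝ g z (0, 1, 0)) (0, t, y) (1, 0) := by
    rw [← h2.deriv]
    refine EventuallyEq.deriv_eq ?_
    filter_upwards [isOpen_Ioo.mem_nhds hΓ.zero_mem] with s hs
    rw [particleVelocity, label_apply (hγ.diffeo t ht) hy]
    exact (hasDerivAt_partial_second (z := (s, t, y)) (hd (s, t, y) ⟨hs, ht, hy⟩)).deriv
  -- At a fixed label both sides are the mixed derivative of Γ in s and t.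
  rw [h3, ← hasDerivAt_fderiv_apply_comm hat]
  refine h1.congr_of_eventuallyEq ?_
  filter_upwards [isOpen_Ioo.mem_nhds ht] with τ hτ
  rw [variationField]
  simp only [flowMap, label_apply (hγ.diffeo τ hτ) hy]
  exact (hasDerivAt_partial_fst (z := (0, τ, y)) (hd (0, τ, y) (hΓ.mem_domain hτ hy))).deriv

/-- The first variation of the action density. -/
theorem hasDerivAt_actionDensity (hΩ : IsOpen Ω) (hγ : IsMotion Ω T₀ γ)
    (hΓ : IsVariation Ω T₀ γ Γ δ) (ρ σ p : Fin 3 → ℝ)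
    {t : ℝ} (ht : t ∈ Ioo 0 T₀) {x : E3} (hx : x ∈ Ω) :
    HasDerivAt (fun s => actionDensity Ω ξ ρ σ p γ Γ s t x)
      (density Ω ξ ρ γ t x * inner ℝ (velocity Ω γ t x)
        (deriv (fun s => particleVelocity Ω γ Γ s t x) 0) -
      ∑ i : Fin 3, ∑ j : Fin 3, stress Ω ξ σ γ t x i j *
        fderiv ℝ (variationField Ω γ Γ t) x (EuclideanSpace.single j 1) i) 0 := by
  have hM := hasDerivAt_fderiv_flowMap hΩ hγ hΓ ht hx
  have hM0 := fderiv_flowMap_zero hΩ hγ hΓ ht hx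
  have htr := divergence_variationField hΩ hγ hΓ ht hx
  have hdet := hasDerivAt_det_of_eq_id hM hM0
  have htr' : ∑ i : Fin 3, fderiv ℝ (variationField Ω γ Γ t) x (EuclideanSpace.single i 1) i = 0 :=
    htr
  -- The Jacobian has derivative 0 at s = 0, so neither the constants p_a nor the undifferentiated
  -- kinetic energy contribute.
  rw [htr'] at hdet
  have hU : HasDerivAt (fun s => particleVelocity Ω γ Γ s t x)
      (deriv (fun s => particleVelocity Ω γ Γ s t x) 0) 0 :=
    (hasDerivAt_partial_fst (f := fun z : ℝ × ℝ × E3 => particleVelocity Ω γ Γ z.1 z.2.1 z.2.2)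
      (z := (0, t, x)) (((contDiffOn_particleVelocity hΩ hγ hΓ).contDiffAt
        ((IsVariation.isOpen_domain hΩ T₀ δ).mem_nhds (hΓ.mem_domain ht hx))).differentiableAt
          (by simp))).differentiableAt.hasDerivAt
  have hgrad : ∀ a, HasDerivAt (fun s => ‖gradVec Ω γ Γ (ξ a) s t x‖)
      (∑ i : Fin 3, ∑ j : Fin 3, stressEntry i j (gradient (transported Ω γ (ξ a) t) x) *
        fderiv ℝ (variationField Ω γ Γ t) x (EuclideanSpace.single j 1) i) 0 := by
    intro a
    have h := hasDerivAt_norm_gradient hM hM0 htr' (gradient (transported Ω γ (ξ a) t) x)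
    have h2 : (innerSL ℝ (gradient (transported Ω γ (ξ a) t) x) : E3 →L[ℝ] ℝ) =
        fderiv ℝ (transported Ω γ (ξ a) t) x :=
      (InnerProductSpace.toDual ℝ E3).apply_symm_apply _
    rw [h2] at h
    exact h
  have hbulk := ((((hU.norm_sq).const_mul (1 / 2 * density Ω ξ ρ γ t x)).add_const
    (p 1 * transported Ω γ (ξ 1) t x + p 2 * transported Ω γ (ξ 2) t x)).mul hdet)
  have hall := hbulk.sub (((hgrad 1).const_mul (σ 1)).add ((hgrad 2).const_mul (σ 2)))
  refine HasDerivAt.congr_deriv (f := fun s => actionDensity Ω ξ ρ σ p γ Γ s t x) hall ?_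
  have h4 : (ContinuousLinearMap.id ℝ E3).det = 1 := LinearMap.det_id
  rw [hM0, h4, particleVelocity_zero hγ hΓ ht hx]
  simp only [stress_eq, Finset.sum_pair (by decide : (1 : Fin 3) ≠ 2), add_mul,
    Finset.sum_add_distrib, Finset.mul_sum, mul_assoc]
  ring

end

/-! ### First variation of the action integral -/

theorem integrableOn_of_continuousOn_of_eq_zero {X : Type*} [TopologicalSpace X] [T2Space X]
    [MeasurableSpace X] [OpensMeasurableSpace X] {μ : Measure X} [IsFiniteMeasureOnCompacts μ]
    {W K : Set X} (hW : MeasurableSet W) (hK : IsCompact K) (hKW : K ⊆ W) {f : X → ℝ}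
    (hf : ContinuousOn f W) (h0 : ∀ z ∈ W, z ∉ K → f z = 0) : IntegrableOn f W μ :=
  ((hf.mono hKW).integrableOn_compact' hK hK.measurableSet).of_forall_sdiff_eq_zero hW
    fun z hz => h0 z hz.1 hz.2

/-- Extended by zero, f is differentiable on the whole line with f and f' integrable, so no boundary
terms arise. -/
theorem setIntegral_hasDerivAt_eq_zero {T₀ : ℝ} {f f' : ℝ → ℝ} {K : Set ℝ} (hK : IsCompact K)
    (hKT : K ⊆ Ioo 0 T₀) (hf : ∀ t ∈ Ioo 0 T₀, HasDerivAt f (f' t) t)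
    (h0 : ∀ t ∈ Ioo 0 T₀, t ∉ K → f t = 0) (hc : ContinuousOn f' (Ioo 0 T₀)) :
    ∫ t in Ioo 0 T₀, f' t = 0 := by
  have h0F : ∀ t ∉ K, (Ioo 0 T₀).indicator f t = 0 := fun t ht => by
    by_cases h : t ∈ Ioo 0 T₀
    · rw [indicator_of_mem h, h0 t h ht]
    · rw [indicator_of_notMem h]
  have hd : ∀ t, HasDerivAt ((Ioo 0 T₀).indicator f) ((Ioo 0 T₀).indicator f' t) t := by
    intro t
    by_cases h : t ∈ Ioo 0 T₀
    · rw [indicator_of_mem h]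
      refine (hf t h).congr_of_eventuallyEq ?_
      filter_upwards [isOpen_Ioo.mem_nhds h] with τ hτ
      rw [indicator_of_mem hτ]
    · rw [indicator_of_notMem h]
      refine (hasDerivAt_const t (0 : ℝ)).congr_of_eventuallyEq ?_
      filter_upwards [hK.isClosed.isOpen_compl.mem_nhds fun hm => h (hKT hm)] with τ hτ
      exact h0F τ hτ
  have h0' : ∀ t ∈ Ioo 0 T₀, t ∉ K → f' t = 0 := fun t ht htK => by
    have h1 : HasDerivAt f 0 t := by
      refine (hasDerivAt_const t (0 : ℝ)).congr_of_eventuallyEq ?_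
      filter_upwards [isOpen_Ioo.mem_nhds ht, hK.isClosed.isOpen_compl.mem_nhds htK] with τ h1 h2
      exact h0 τ h1 h2
    exact (hf t ht).unique h1
  have hi : Integrable ((Ioo 0 T₀).indicator f) := by
    rw [integrable_indicator_iff measurableSet_Ioo]
    exact integrableOn_of_continuousOn_of_eq_zero measurableSet_Ioo hK hKT
      (fun t ht => (hf t ht).continuousAt.continuousWithinAt) h0
  have hi' : Integrable ((Ioo 0 T₀).indicator f') := by
    rw [integrable_indicator_iff measurableSet_Ioo]
    exact integrableOn_of_continuousOn_of_eq_zero measurableSet_Ioo hK hKT hc h0'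
  rw [← integral_indicator measurableSet_Ioo]
  exact integral_eq_zero_of_hasDerivAt_of_integrable hd hi' hi

theorem isTestField_indicator {Ω K : Set E3} {v : E3 → E3} (hΩ : IsOpen Ω) (hK : IsCompact K)
    (hKΩ : K ⊆ Ω) (hv : ContDiffOn ℝ ∞ v Ω) (h0 : ∀ x ∈ Ω, x ∉ K → v x = 0) :
    IsTestField Ω (Ω.indicator v) := by
  have hz : ∀ x ∉ K, Ω.indicator v x = 0 := fun x hx => by
    by_cases h : x ∈ Ω
    · rw [indicator_of_mem h, h0 x h hx]
    · rw [indicator_of_notMem h]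
  refine ⟨contDiff_iff_contDiffAt.2 fun x => ?_, HasCompactSupport.intro hK hz, ?_⟩
  · by_cases h : x ∈ Ω
    · refine (hv.contDiffAt (hΩ.mem_nhds h)).congr_of_eventuallyEq ?_
      filter_upwards [hΩ.mem_nhds h] with z hz
      rw [indicator_of_mem hz]
    · refine (contDiffAt_const (c := (0 : E3))).congr_of_eventuallyEq ?_
      filter_upwards [hK.isClosed.isOpen_compl.mem_nhds fun hm => h (hKΩ hm)] with z h1
      exact hz z h1
  · refine (closure_minimal (fun x hx => ?_) hK.isClosed).trans hKΩ
    by_contra h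
    exact hx (hz x h)

section
variable {Ω : Set E3} {T₀ : ℝ} {γ : ℝ → E3 → E3} {Γ : ℝ → ℝ → E3 → E3} {δ : ℝ}
  {ξ : Fin 3 → E3 → ℝ}

theorem volume_domain_ne_top (hvol : volume Ω ≠ ⊤) (T₀ : ℝ) :
    volume (Ioo 0 T₀ ×ˢ Ω) ≠ ⊤ := by
  rw [Measure.volume_eq_prod, Measure.prod_prod]
  exact ENNReal.mul_ne_top (by simp) hvol

theorem color_le_one (hξ_nonneg : ∀ a, ∀ x ∈ Ω, 0 ≤ ξ a x) (hξ_sum : ∀ x ∈ Ω, ∑ a, ξ a x = 1)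
    (a : Fin 3) {x : E3} (hx : x ∈ Ω) : ξ a x ≤ 1 := by
  rw [← hξ_sum x hx]
  exact Finset.single_le_sum (fun b _ => hξ_nonneg b x hx) (Finset.mem_univ a)

theorem integrableOn_transported (hΩ : IsOpen Ω) (hvol : volume Ω ≠ ⊤) (hγ : IsMotion Ω T₀ γ)
    (hξ : ∀ a, ContDiffOn ℝ ∞ (ξ a) Ω) (hξ_nonneg : ∀ a, ∀ x ∈ Ω, 0 ≤ ξ a x)
    (hξ_sum : ∀ x ∈ Ω, ∑ a, ξ a x = 1) (a : Fin 3) :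
    IntegrableOn (fun z : ℝ × E3 => transported Ω γ (ξ a) z.1 z.2) (Ioo 0 T₀ ×ˢ Ω) := by
  have hW := (IsMotion.isOpen_domain hΩ T₀).measurableSet
  refine IntegrableOn.of_bound (volume_domain_ne_top hvol T₀).lt_top
    ((hγ.transported_contDiffOn hΩ (hξ a)).continuousOn.aestronglyMeasurable hW) 1 ?_
  filter_upwards [ae_restrict_mem hW] with z hz
  have hl := label_mem (hγ.diffeo _ hz.1) hz.2
  rw [transported, Real.norm_of_nonneg (hξ_nonneg a _ hl)]
  exact color_le_one hξ_nonneg hξ_sum a hl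

theorem integrableOn_phaseDensity (hΩ : IsOpen Ω) (hvol : volume Ω ≠ ⊤) (hγ : IsMotion Ω T₀ γ)
    (hξ : ∀ a, ContDiffOn ℝ ∞ (ξ a) Ω) (hξ_nonneg : ∀ a, ∀ x ∈ Ω, 0 ≤ ξ a x)
    (hξ_sum : ∀ x ∈ Ω, ∑ a, ξ a x = 1) {ρ : Fin 3 → ℝ} (σ p : Fin 3 → ℝ)
    (hkin : IntegrableOn (fun z : ℝ × E3 => kinetic Ω ξ ρ γ z.1 z.2) (Ioo 0 T₀ ×ˢ Ω))
    (hsurf : ∀ a, IntegrableOn (fun z : ℝ × E3 => gradNorm Ω ξ γ a z.1 z.2) (Ioo 0 T₀ ×ˢ Ω))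
    (A : Finset (Fin 3)) :
    IntegrableOn (fun z : ℝ × E3 => kinetic Ω ξ ρ γ z.1 z.2 -
      ∑ a ∈ A, (σ a * gradNorm Ω ξ γ a z.1 z.2 - p a * transported Ω γ (ξ a) z.1 z.2))
      (Ioo 0 T₀ ×ˢ Ω) :=
  hkin.sub (integrable_finsetSum _ fun a _ => ((hsurf a).const_mul (σ a)).sub
    ((integrableOn_transported hΩ hvol hγ hξ hξ_nonneg hξ_sum a).const_mul (p a)))

/-! ### Fields of a variation outside the support -/

theorem particleVelocityRate_contDiffOn (hΩ : IsOpen Ω) (hγ : IsMotion Ω T₀ γ)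
    (hΓ : IsVariation Ω T₀ γ Γ δ) :
    ContDiffOn ℝ ∞ (fun z : ℝ × E3 => deriv (fun s => particleVelocity Ω γ Γ s z.1 z.2) 0)
      (Ioo 0 T₀ ×ˢ Ω) :=
  (contDiffOn_partial_fst (f := fun z : ℝ × ℝ × E3 => particleVelocity Ω γ Γ z.1 z.2.1 z.2.2)
    (IsVariation.isOpen_domain hΩ T₀ δ) (contDiffOn_particleVelocity hΩ hγ hΓ)).comp
    (f := fun z : ℝ × E3 => ((0 : ℝ), z)) (contDiffOn_const.prodMk contDiffOn_id)
    fun _ hz => ⟨hΓ.zero_mem, hz⟩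

section OffSupport
variable {K : Set (ℝ × E3)}

theorem variationField_eq_zero (hγ : IsMotion Ω T₀ γ) (hΓ : IsVariation Ω T₀ γ Γ δ)
    (h : ∀ t ∈ Ioo 0 T₀, ∀ y ∈ Ω, (t, γ t y) ∉ K → ∀ s ∈ Ioo (-δ) δ, Γ s t y = γ t y)
    {t : ℝ} (ht : t ∈ Ioo 0 T₀) {x : E3} (hx : x ∈ Ω) (hxK : (t, x) ∉ K) :
    variationField Ω γ Γ t x = 0 := by
  have h1 : (fun s => flowMap Ω γ Γ s t x) =ᶠ[𝓝 0] fun _ => x := by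
    filter_upwards [isOpen_Ioo.mem_nhds hΓ.zero_mem] with s hs
    have h3 := apply_label (hγ.diffeo t ht) hx
    rw [flowMap, h t ht _ (label_mem (hγ.diffeo t ht) hx) (by rw [h3]; exact hxK) s hs, h3]
  rw [variationField, h1.deriv_eq, deriv_const]

theorem fderiv_variationField_eq_zero (hΩ : IsOpen Ω) (hγ : IsMotion Ω T₀ γ)
    (hΓ : IsVariation Ω T₀ γ Γ δ) (hK : IsCompact K)
    (h : ∀ t ∈ Ioo 0 T₀, ∀ y ∈ Ω, (t, γ t y) ∉ K → ∀ s ∈ Ioo (-δ) δ, Γ s t y = γ t y)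
    {t : ℝ} (ht : t ∈ Ioo 0 T₀) {x : E3} (hx : x ∈ Ω) (hxK : (t, x) ∉ K) :
    fderiv ℝ (variationField Ω γ Γ t) x = 0 := by
  have hc : ContinuousAt (fun x' : E3 => (t, x')) x := by fun_prop
  have h1 : variationField Ω γ Γ t =ᶠ[𝓝 x] fun _ => 0 := by
    filter_upwards [hc.preimage_mem_nhds (hK.isClosed.isOpen_compl.mem_nhds hxK),
      hΩ.mem_nhds hx] with x' h1 h2
    exact variationField_eq_zero hγ hΓ h ht h2 h1
  rw [h1.fderiv_eq]
  simp

theorem particleVelocityRate_eq_zero (hΩ : IsOpen Ω) (hγ : IsMotion Ω T₀ γ)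
    (hΓ : IsVariation Ω T₀ γ Γ δ) (hK : IsCompact K)
    (h : ∀ t ∈ Ioo 0 T₀, ∀ y ∈ Ω, (t, γ t y) ∉ K → ∀ s ∈ Ioo (-δ) δ, Γ s t y = γ t y)
    {t : ℝ} (ht : t ∈ Ioo 0 T₀) {x : E3} (hx : x ∈ Ω) (hxK : (t, x) ∉ K) :
    deriv (fun s => particleVelocity Ω γ Γ s t x) 0 = 0 := by
  have h1 : (fun s => particleVelocity Ω γ Γ s t x) =ᶠ[𝓝 0] fun _ => velocity Ω γ t x := by
    filter_upwards [isOpen_Ioo.mem_nhds hΓ.zero_mem] with s hs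
    exact (flowMap_eventuallyEq_of_notMem hΩ hγ hK h ht hx hxK hs).2
  rw [h1.deriv_eq, deriv_const]

/-- The variation field extends by zero to a solenoidal test field. -/
theorem isTestField_variationField (hΩ : IsOpen Ω) (hγ : IsMotion Ω T₀ γ)
    (hΓ : IsVariation Ω T₀ γ Γ δ) (hK : IsCompact K) (hKW : K ⊆ Ioo 0 T₀ ×ˢ Ω)
    (h : ∀ t ∈ Ioo 0 T₀, ∀ y ∈ Ω, (t, γ t y) ∉ K → ∀ s ∈ Ioo (-δ) δ, Γ s t y = γ t y)
    {t : ℝ} (ht : t ∈ Ioo 0 T₀) :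
    IsTestField Ω (Ω.indicator (variationField Ω γ Γ t)) ∧
      ∀ x, divergence (Ω.indicator (variationField Ω γ Γ t)) x = 0 := by
  have hKt : IsCompact ((fun x : E3 => (t, x)) ⁻¹' K) :=
    (hK.image continuous_snd).of_isClosed_subset
      (hK.isClosed.preimage (by fun_prop)) fun x hx => ⟨(t, x), hx, rfl⟩
  have hKΩ : (fun x : E3 => (t, x)) ⁻¹' K ⊆ Ω := fun x hx => (hKW hx).2
  have hT := isTestField_indicator hΩ hKt hKΩ (v := variationField Ω γ Γ t)
    ((variationField_contDiffOn hΩ hγ hΓ).comp (f := fun x : E3 => (t, x))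
      (contDiffOn_const.prodMk contDiffOn_id) fun _ hx => ⟨ht, hx⟩)
    fun x hx hxK => variationField_eq_zero hγ hΓ h ht hx hxK
  refine ⟨hT, fun x => ?_⟩
  by_cases hx : x ∈ Ω
  · have h1 : Ω.indicator (variationField Ω γ Γ t) =ᶠ[𝓝 x] variationField Ω γ Γ t := by
      filter_upwards [hΩ.mem_nhds hx] with z hz
      rw [indicator_of_mem hz]
    have h2 := divergence_variationField hΩ hγ hΓ ht hx
    rw [divergence] at h2 ⊢
    rw [h1.fderiv_eq, h2]
  · have h1 : fderiv ℝ (Ω.indicator (variationField Ω γ Γ t)) x = 0 :=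
      image_eq_zero_of_notMem_tsupport fun hm => hx (hT.support (tsupport_fderiv_subset ℝ hm))
    simp [divergence, h1]

end OffSupport

theorem workDensity_indicator (hΩ : IsOpen Ω) {ρ σ : Fin 3 → ℝ} (t : ℝ) (v : E3 → E3) {x : E3}
    (hx : x ∈ Ω) :
    workDensity Ω ξ ρ σ γ t (Ω.indicator v) x = workDensity Ω ξ ρ σ γ t v x := by
  have h1 : Ω.indicator v =ᶠ[𝓝 x] v := by
    filter_upwards [hΩ.mem_nhds hx] with z hz
    rw [indicator_of_mem hz]
  rw [workDensity, workDensity, h1.fderiv_eq, h1.eq_of_nhds]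

theorem continuousOn_workDensity_variationField (hΩ : IsOpen Ω) (hγ : IsMotion Ω T₀ γ)
    (hξ : ∀ a, ContDiffOn ℝ ∞ (ξ a) Ω) (hΓ : IsVariation Ω T₀ γ Γ δ) (ρ σ : Fin 3 → ℝ) :
    ContinuousOn (fun z : ℝ × E3 => workDensity Ω ξ ρ σ γ z.1 (variationField Ω γ Γ z.1) z.2)
      (Ioo 0 T₀ ×ˢ Ω) := by
  have hv := variationField_contDiffOn hΩ hγ hΓ
  have hDv := (contDiffOn_partial_snd (f := fun z : ℝ × E3 => variationField Ω γ Γ z.1 z.2)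
    (IsMotion.isOpen_domain hΩ T₀) hv).continuousOn
  refine ((momentumRate_contDiffOn hΩ hγ hξ ρ).continuousOn.inner hv.continuousOn).add
    (continuousOn_finsetSum _ fun i _ => continuousOn_finsetSum _ fun j _ =>
      (stress_locallyLipschitzOn hΩ hγ hξ i j).continuousOn.mul ?_)
  exact (entryCLM i j).continuous.comp_continuousOn hDv

/-- Integration by parts in time along the particle paths. -/
theorem integral_inertia_eq_zero (hΩ : IsOpen Ω) (hγ : IsMotion Ω T₀ γ)
    (hξ : ∀ a, ContDiffOn ℝ ∞ (ξ a) Ω) (hΓ : IsVariation Ω T₀ γ Γ δ) (ρ : Fin 3 → ℝ) :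
    ∫ z in Ioo 0 T₀ ×ˢ Ω, (density Ω ξ ρ γ z.1 z.2 * inner ℝ (velocity Ω γ z.1 z.2)
        (deriv (fun s => particleVelocity Ω γ Γ s z.1 z.2) 0) +
      inner ℝ (momentumRate Ω ξ ρ γ z.1 z.2) (variationField Ω γ Γ z.1 z.2)) = 0 := by
  obtain ⟨K, hK, hKW, hKid⟩ := exists_compact_flowMap_eq hγ hΓ
  have hW := IsMotion.isOpen_domain hΩ T₀
  set B : ℝ × E3 → ℝ := fun z => density Ω ξ ρ γ z.1 z.2 * inner ℝ (velocity Ω γ z.1 z.2)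
        (deriv (fun s => particleVelocity Ω γ Γ s z.1 z.2) 0) +
      inner ℝ (momentumRate Ω ξ ρ γ z.1 z.2) (variationField Ω γ Γ z.1 z.2) with hB
  have hBc : ContinuousOn B (Ioo 0 T₀ ×ˢ Ω) :=
    ((hγ.density_contDiffOn hΩ hξ ρ).continuousOn.mul ((hγ.velocity_contDiffOn hΩ).continuousOn.inner
      (particleVelocityRate_contDiffOn hΩ hγ hΓ).continuousOn)).add
    ((momentumRate_contDiffOn hΩ hγ hξ ρ).continuousOn.inner
      (variationField_contDiffOn hΩ hγ hΓ).continuousOn)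
  have hB0 : ∀ z ∈ Ioo 0 T₀ ×ˢ Ω, z ∉ K → B z = 0 := fun z hz hzK => by
    simp only [hB]
    rw [particleVelocityRate_eq_zero hΩ hγ hΓ hK hKid hz.1 hz.2 hzK,
      variationField_eq_zero hγ hΓ hKid hz.1 hz.2 hzK]
    simp
  have hBi : IntegrableOn B (Ioo 0 T₀ ×ˢ Ω) :=
    integrableOn_of_continuousOn_of_eq_zero hW.measurableSet hK hKW hBc hB0
  set Q : ℝ × E3 → ℝ × E3 := fun z => (z.1, γ z.1 z.2) with hQ
  have hQm : MapsTo Q (Ioo 0 T₀ ×ˢ Ω) (Ioo 0 T₀ ×ˢ Ω) := fun z hz =>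
    ⟨hz.1, (hγ.diffeo _ hz.1).bijOn.mapsTo hz.2⟩
  have hQc : ContinuousOn Q (Ioo 0 T₀ ×ˢ Ω) := continuousOn_fst.prodMk hγ.smooth.continuousOn
  -- The support in particle labels instead of positions; its compactness makes the integrand in
  -- Lagrangian coordinates integrable.
  set K' : Set (ℝ × E3) := (fun z : ℝ × E3 => (z.1, label Ω γ z.1 z.2)) '' K with hK'
  have hK'c : IsCompact K' := hK.image_of_continuousOn
    (continuousOn_fst.prodMk ((hγ.label_contDiffOn hΩ).continuousOn.mono hKW))
  have hK'W : K' ⊆ Ioo 0 T₀ ×ˢ Ω := by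
    rintro _ ⟨z, hz, rfl⟩
    exact hγ.mapsTo_label (hKW hz)
  have hQK : ∀ z ∈ Ioo 0 T₀ ×ˢ Ω, z ∉ K' → Q z ∉ K := fun z hz hzK' hm =>
    hzK' ⟨Q z, hm, Prod.ext rfl (label_apply (hγ.diffeo _ hz.1) hz.2)⟩
  have hBQi : IntegrableOn (fun z => B (Q z)) (Ioo 0 T₀ ×ˢ Ω) :=
    integrableOn_of_continuousOn_of_eq_zero hW.measurableSet hK'c hK'W (hBc.comp hQc hQm)
      fun z hz hzK => hB0 _ (hQm hz) (hQK z hz hzK)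
  rw [Measure.volume_eq_prod, setIntegral_prod _ hBi]
  -- Passing to labels costs no factor since γ_t has Jacobian 1.
  have hcv : ∀ t ∈ Ioo 0 T₀, ∫ x in Ω, B (t, x) = ∫ y in Ω, B (Q (t, y)) := fun t ht => by
    rw [(hγ.diffeo t ht).integral_comp hΩ]
    refine setIntegral_congr_fun hΩ.measurableSet fun y hy => ?_
    simp only [hγ.jacobian_eq_one t ht y hy, one_mul, hQ]
  rw [setIntegral_congr_fun measurableSet_Ioo hcv]
  have hBQi' : Integrable (fun z => B (Q z))
      ((volume.restrict (Ioo 0 T₀)).prod (volume.restrict Ω)) := by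
    rw [Measure.prod_restrict]; exact hBQi
  rw [integral_integral_swap (f := fun t y => B (Q (t, y))) hBQi']
  -- For each particle the integrand is the time derivative of ρu · v along its path, where v is the
  -- variation field. Since v is evaluated along the path, its time derivative is the rate of change
  -- of the particle velocity.
  refine setIntegral_eq_zero_of_forall_eq_zero fun y hy => ?_
  have hm := hγ.momentum_contDiffOn hΩ hξ ρ
  refine setIntegral_hasDerivAt_eq_zero (f := fun t => inner ℝ
      (density Ω ξ ρ γ t (γ t y) • velocity Ω γ t (γ t y)) (variationField Ω γ Γ t (γ t y)))
    (hK'c.image continuous_fst) ?_ ?_ ?_ ?_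
  · rintro _ ⟨z, hz, rfl⟩
    exact (hK'W hz).1
  · intro t ht
    refine ((hγ.hasDerivAt_along hΩ
      (m := fun t x => density Ω ξ ρ γ t x • velocity Ω γ t x) hm ht hy).inner ℝ
      (hasDerivAt_variationField_along hΩ hγ hΓ ht hy)).congr_deriv ?_
    simp only [hB, hQ, real_inner_smul_left]
    rfl
  · intro t ht htK
    have hz : ((t, y) : ℝ × E3) ∈ Ioo 0 T₀ ×ˢ Ω := ⟨ht, hy⟩
    have h1 := hQK (t, y) hz fun hm => htK ⟨(t, y), hm, rfl⟩
    rw [variationField_eq_zero hγ hΓ hKid ht (hQm hz).2 h1, inner_zero_right]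
  · exact (hBc.comp hQc hQm).comp (f := fun t : ℝ => (t, y)) (by fun_prop) fun t ht => ⟨ht, hy⟩

/-- The first variation of the action is the negative virtual work. -/
theorem hasDerivAt_wallAction (hΩ : IsOpen Ω) (hvol : volume Ω ≠ ⊤) (hγ : IsMotion Ω T₀ γ)
    (hξ : ∀ a, ContDiffOn ℝ ∞ (ξ a) Ω) (hξ_nonneg : ∀ a, ∀ x ∈ Ω, 0 ≤ ξ a x)
    (hξ_sum : ∀ x ∈ Ω, ∑ a, ξ a x = 1) {ρ : Fin 3 → ℝ} (σ p : Fin 3 → ℝ)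
    (hkin : IntegrableOn (fun z : ℝ × E3 => kinetic Ω ξ ρ γ z.1 z.2) (Ioo 0 T₀ ×ˢ Ω))
    (hsurf : ∀ a, IntegrableOn (fun z : ℝ × E3 => gradNorm Ω ξ γ a z.1 z.2) (Ioo 0 T₀ ×ˢ Ω))
    (hΓ : IsVariation Ω T₀ γ Γ δ) :
    HasDerivAt (fun s => wallAction Ω T₀ ξ ρ σ p (Γ s))
      (-∫ t in Ioo 0 T₀, ∫ x in Ω, workDensity Ω ξ ρ σ γ t (variationField Ω γ Γ t) x) 0 := by
  obtain ⟨K, hK, hKW, hKid⟩ := exists_compact_flowMap_eq hγ hΓ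
  have hWo := IsMotion.isOpen_domain hΩ T₀
  have hW := hWo.measurableSet
  have hll := actionDensity_locallyLipschitzOn hΩ hγ hΓ hξ ρ σ p
  have hoff : ∀ s ∈ Ioo (-δ) δ, ∀ z ∈ Ioo 0 T₀ ×ˢ Ω, z ∉ K →
      actionDensity Ω ξ ρ σ p γ Γ s z.1 z.2 = kinetic Ω ξ ρ γ z.1 z.2 -
      ∑ a ∈ ({1, 2} : Finset (Fin 3)),
        (σ a * gradNorm Ω ξ γ a z.1 z.2 - p a * transported Ω γ (ξ a) z.1 z.2) :=
    fun s hs z hz hzK => by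
      obtain ⟨h1, h2⟩ := flowMap_eventuallyEq_of_notMem hΩ hγ hK hKid hz.1 hz.2 hzK hs
      exact actionDensity_eq_of_flowMap_eventuallyEq h1 h2
  have hcont : ∀ s ∈ Ioo (-δ) δ, ContinuousOn
      (fun z : ℝ × E3 => actionDensity Ω ξ ρ σ p γ Γ s z.1 z.2) (Ioo 0 T₀ ×ˢ Ω) := fun s hs =>
    hll.continuousOn.comp (f := fun z : ℝ × E3 => (s, z)) (by fun_prop) fun z hz => ⟨hs, hz⟩
  have hbase := integrableOn_phaseDensity hΩ hvol hγ hξ hξ_nonneg hξ_sum σ p hkin hsurf {1, 2}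
  have hint : ∀ s ∈ Ioo (-δ) δ, IntegrableOn
      (fun z : ℝ × E3 => actionDensity Ω ξ ρ σ p γ Γ s z.1 z.2) (Ioo 0 T₀ ×ˢ Ω) := by
    have h0 : IntegrableOn
      (fun z : ℝ × E3 => actionDensity Ω ξ ρ σ p γ Γ 0 z.1 z.2) (Ioo 0 T₀ ×ˢ Ω) := by
      refine hbase.congr_fun (fun z hz => ?_) hW
      refine (actionDensity_eq_of_flowMap_eventuallyEq ?_
        (particleVelocity_zero hγ hΓ hz.1 hz.2)).symm
      filter_upwards [hΩ.mem_nhds hz.2] with x hx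
      exact flowMap_zero hγ hΓ hz.1 hx
    intro s hs
    -- Integrability is assumed only for the undeformed motion. Any other density differs from that
    -- one by a continuous function vanishing outside the compact set K.
    have hdiff := integrableOn_of_continuousOn_of_eq_zero (μ := volume) hW hK hKW
      ((hcont s hs).sub (hcont 0 hΓ.zero_mem)) fun z hz hzK => by
        rw [Pi.sub_apply, hoff s hs z hz hzK, hoff 0 hΓ.zero_mem z hz hzK, sub_self]
    refine (h0.add hdiff).congr_fun (fun z _ => ?_) hW
    simp
  have hact : ∀ s ∈ Ioo (-δ) δ, wallAction Ω T₀ ξ ρ σ p (Γ s) =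
      ∫ z in Ioo 0 T₀ ×ˢ Ω, actionDensity Ω ξ ρ σ p γ Γ s z.1 z.2 := fun s hs => by
    rw [wallAction_eq hΩ hγ hΓ hξ ρ σ p hs, Measure.volume_eq_prod, setIntegral_prod _ (hint s hs)]
  set F' : ℝ × E3 → ℝ := fun z => density Ω ξ ρ γ z.1 z.2 * inner ℝ (velocity Ω γ z.1 z.2)
        (deriv (fun s => particleVelocity Ω γ Γ s z.1 z.2) 0) -
      ∑ i : Fin 3, ∑ j : Fin 3, stress Ω ξ σ γ z.1 z.2 i j *
        fderiv ℝ (variationField Ω γ Γ z.1) z.2 (EuclideanSpace.single j 1) i with hF'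
  set B : ℝ × E3 → ℝ := fun z => density Ω ξ ρ γ z.1 z.2 * inner ℝ (velocity Ω γ z.1 z.2)
        (deriv (fun s => particleVelocity Ω γ Γ s z.1 z.2) 0) +
      inner ℝ (momentumRate Ω ξ ρ γ z.1 z.2) (variationField Ω γ Γ z.1 z.2) with hB
  set w : ℝ × E3 → ℝ := fun z => workDensity Ω ξ ρ σ γ z.1 (variationField Ω γ Γ z.1) z.2 with hw
  -- The inertial part of the virtual work is added and subtracted: B has integral 0 by integration
  -- by parts in time, so only the virtual work remains.
  have hF'B : F' = fun z => B z - w z := by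
    funext z
    simp only [hF', hB, hw, workDensity]
    ring
  have hwc : ContinuousOn w (Ioo 0 T₀ ×ˢ Ω) :=
    continuousOn_workDensity_variationField hΩ hγ hξ hΓ ρ σ
  have hBc : ContinuousOn B (Ioo 0 T₀ ×ˢ Ω) :=
    ((hγ.density_contDiffOn hΩ hξ ρ).continuousOn.mul ((hγ.velocity_contDiffOn hΩ).continuousOn.inner
      (particleVelocityRate_contDiffOn hΩ hγ hΓ).continuousOn)).add
    ((momentumRate_contDiffOn hΩ hγ hξ ρ).continuousOn.inner
      (variationField_contDiffOn hΩ hγ hΓ).continuousOn)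
  have hwi : IntegrableOn w (Ioo 0 T₀ ×ˢ Ω) :=
    integrableOn_of_continuousOn_of_eq_zero hW hK hKW hwc fun z hz hzK => by
      simp only [hw, workDensity]
      rw [variationField_eq_zero hγ hΓ hKid hz.1 hz.2 hzK,
        fderiv_variationField_eq_zero hΩ hγ hΓ hK hKid hz.1 hz.2 hzK]
      simp
  have hBi : IntegrableOn B (Ioo 0 T₀ ×ˢ Ω) :=
    integrableOn_of_continuousOn_of_eq_zero hW hK hKW hBc fun z hz hzK => by
      simp only [hB]
      rw [particleVelocityRate_eq_zero hΩ hγ hΓ hK hKid hz.1 hz.2 hzK,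
        variationField_eq_zero hγ hΓ hKid hz.1 hz.2 hzK]
      simp
  have hval : ∫ z in Ioo 0 T₀ ×ˢ Ω, F' z =
      -∫ t in Ioo 0 T₀, ∫ x in Ω, workDensity Ω ξ ρ σ γ t (variationField Ω γ Γ t) x := by
    rw [hF'B, integral_sub hBi hwi, integral_inertia_eq_zero hΩ hγ hξ hΓ ρ, zero_sub,
      Measure.volume_eq_prod, setIntegral_prod _ hwi]
  rw [← hval]
  have hδ := hΓ.pos
  have hsub : Icc (-(δ / 2)) (δ / 2) ⊆ Ioo (-δ) δ := fun s hs =>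
    ⟨by linarith [hs.1], by linarith [hs.2]⟩
  -- A Lipschitz constant in s that is uniform over K dominates the difference quotients there; off
  -- K they vanish. Hence the dominating function is C on K and 0 elsewhere.
  obtain ⟨C, hC⟩ := (hll.mono (prod_mono hsub hKW)).exists_lipschitzOnWith_of_compact
    (isCompact_Icc.prod hK)
  have hmain := hasDerivAt_integral_of_dominated_loc_of_lip (μ := volume.restrict (Ioo 0 T₀ ×ˢ Ω))
    (F := fun s (z : ℝ × E3) => actionDensity Ω ξ ρ σ p γ Γ s z.1 z.2) (F' := F') (x₀ := (0 : ℝ))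
    (s := Icc (-(δ / 2)) (δ / 2)) (bound := K.indicator fun _ => (C : ℝ))
    (Icc_mem_nhds (by linarith) (by linarith)) ?_ (hint 0 hΓ.zero_mem) ?_ ?_ ?_ ?_
  · refine hmain.2.congr_of_eventuallyEq ?_
    filter_upwards [isOpen_Ioo.mem_nhds hΓ.zero_mem] with s hs
    exact hact s hs
  · filter_upwards [isOpen_Ioo.mem_nhds hΓ.zero_mem] with s hs
    exact (hint s hs).aestronglyMeasurable
  · rw [hF'B]
    exact (hBi.sub hwi).aestronglyMeasurable
  · filter_upwards [ae_restrict_mem hW] with z hz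
    by_cases hzK : z ∈ K
    · rw [indicator_of_mem hzK]
      refine LipschitzOnWith.of_dist_le_mul fun s hs s' hs' => ?_
      have := hC.dist_le_mul (s, z) ⟨hs, hzK⟩ (s', z) ⟨hs', hzK⟩
      simpa [Prod.dist_eq] using this
    · refine LipschitzOnWith.of_dist_le_mul fun s hs s' hs' => ?_
      rw [hoff s (hsub hs) z hz hzK, hoff s' (hsub hs') z hz hzK, dist_self]
      positivity
  · refine Integrable.mono_measure ?_ Measure.restrict_le_self
    rw [integrable_indicator_iff hK.measurableSet]
    exact integrableOn_const hK.measure_lt_top.ne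
  · filter_upwards [ae_restrict_mem hW] with z hz
    exact hasDerivAt_actionDensity hΩ hγ hΓ ρ σ p hz.1 hz.2

/-- A solution of the equation of motion is stationary. -/
theorem SolvesEquationOfMotion.isStationary (hΩ : IsOpen Ω) (hvol : volume Ω ≠ ⊤)
    (hγ : IsMotion Ω T₀ γ) (hξ : ∀ a, ContDiffOn ℝ ∞ (ξ a) Ω)
    (hξ_nonneg : ∀ a, ∀ x ∈ Ω, 0 ≤ ξ a x) (hξ_sum : ∀ x ∈ Ω, ∑ a, ξ a x = 1)
    {ρ σ : Fin 3 → ℝ} (p₀ : Fin 3 → ℝ)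
    (hkin : IntegrableOn (fun z : ℝ × E3 => kinetic Ω ξ ρ γ z.1 z.2) (Ioo 0 T₀ ×ˢ Ω))
    (hsurf : ∀ a, IntegrableOn (fun z : ℝ × E3 => gradNorm Ω ξ γ a z.1 z.2) (Ioo 0 T₀ ×ˢ Ω))
    {p : ℝ → E3 → ℝ} (hp : SolvesEquationOfMotion Ω T₀ ξ ρ σ γ p) :
    IsStationary Ω T₀ (wallAction Ω T₀ ξ ρ σ p₀) γ := by
  intro Γ δ hΓ
  have h := hasDerivAt_wallAction hΩ hvol hγ hξ hξ_nonneg hξ_sum σ p₀ hkin hsurf hΓ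
  obtain ⟨K, hK, hKW, hKid⟩ := exists_compact_flowMap_eq hγ hΓ
  refine h.congr_deriv ?_
  rw [neg_eq_zero]
  refine setIntegral_eq_zero_of_forall_eq_zero fun t ht => ?_
  obtain ⟨h1, h2⟩ := isTestField_variationField hΩ hγ hΓ hK hKW hKid ht
  rw [← integral_workDensity_eq_zero hΩ hγ hξ hp ht h1 h2]
  exact setIntegral_congr_fun hΩ.measurableSet fun x hx => (workDensity_indicator hΩ t _ hx).symm

end

/-! ### Variations generated by test fields -/

section
variable {Ω : Set E3} {T₀ : ℝ} {γ : ℝ → E3 → E3} {ξ : Fin 3 → E3 → ℝ} {φ : E3 → E3}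

theorem hasFDerivAt_id_add_smul (hφ : IsTestField Ω φ) (r : ℝ) (x : E3) :
    HasFDerivAt (fun x => x + r • φ x) (ContinuousLinearMap.id ℝ E3 + r • fderiv ℝ φ x) x :=
  (hasFDerivAt_id x).add ((hφ.smooth.differentiable (by simp) x).hasFDerivAt.const_smul r)

/-- Small displacements along a test field are diffeomorphisms. -/
theorem IsTestField.exists_isDiffeo (hφ : IsTestField Ω φ) :
    ∃ ε > 0, ∀ r : ℝ, |r| < ε → IsDiffeo Ω fun x => x + r • φ x := by
  obtain ⟨C, hC⟩ := ContDiff.lipschitzWith_of_hasCompactSupport hφ.compact hφ.smooth (by simp)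
  have h4 : (ContinuousLinearMap.id ℝ E3).det = 1 := LinearMap.det_id
  have hdet : ∀ᶠ A : E3 →L[ℝ] E3 in 𝓝 0, 0 < (ContinuousLinearMap.id ℝ E3 + A).det := by
    have hc : Continuous fun A : E3 →L[ℝ] E3 => (ContinuousLinearMap.id ℝ E3 + A).det :=
      contDiff_det.continuous.comp (continuous_const.add continuous_id)
    refine hc.continuousAt.eventually_const_lt ?_
    simp only [add_zero, h4, one_pos]
  obtain ⟨η, hη, hball⟩ := Metric.eventually_nhds_iff.1 hdet
  have hC0 : (0 : ℝ) < C + 1 := by positivity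
  -- With C a Lipschitz constant of φ, the bound |r|C < 1 makes the map a contractive perturbation
  -- of the identity, and |r|C < η keeps its Jacobian positive.
  refine ⟨min 1 η / (C + 1), by positivity, fun r hr => ?_⟩
  have hr' : |r| * C < min 1 η := by
    rw [lt_div_iff₀ hC0] at hr
    nlinarith [abs_nonneg r]
  have hr1 : |r| * C < 1 := hr'.trans_le (min_le_left _ _)
  have hlip : ∀ x y, ‖r • φ x - r • φ y‖ ≤ |r| * C * ‖x - y‖ := fun x y => by
    rw [← smul_sub, norm_smul, Real.norm_eq_abs, mul_assoc]
    exact mul_le_mul_of_nonneg_left (hC.norm_sub_le x y) (abs_nonneg r)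
  have hinj : Function.Injective fun x => x + r • φ x := by
    intro x y hxy
    simp only at hxy
    have h1 : x - y = -(r • φ x - r • φ y) := by
      rw [neg_sub, sub_eq_sub_iff_add_eq_add, hxy, add_comm]
    have h2 := hlip x y
    rw [← norm_neg (r • φ x - r • φ y), ← h1] at h2
    have h3 : ‖x - y‖ = 0 := by nlinarith [norm_nonneg (x - y)]
    exact sub_eq_zero.1 (norm_eq_zero.1 h3)
  have hzero : ∀ x, x ∉ Ω → φ x = 0 := fun x hx =>
    image_eq_zero_of_notMem_tsupport fun h => hx (hφ.support h)
  refine ⟨⟨fun x hx => ?_, hinj.injOn, fun z hz => ?_⟩, ?_, fun x _ => ?_⟩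
  -- Points outside Ω are fixed because φ vanishes there, so by injectivity no point of Ω can be
  -- sent outside.
  · by_contra h
    have h1 : (fun x => x + r • φ x) (x + r • φ x) = (fun x => x + r • φ x) x := by
      simp only at h ⊢
      rw [hzero _ h, smul_zero, add_zero]
    have h2 : x + r • φ x = x := hinj h1
    exact h (show x + r • φ x ∈ Ω by rw [h2]; exact hx)
  -- A preimage of z is a fixed point of x ↦ z - rφ(x). If it lay outside Ω, it would equal z.
  · have hK : (⟨|r| * C, by positivity⟩ : ℝ≥0) < 1 := hr1
    have hcon : ContractingWith ⟨|r| * C, by positivity⟩ fun x => z - r • φ x :=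
      ⟨hK, LipschitzWith.of_dist_le_mul fun x y => by
        rw [dist_eq_norm, dist_eq_norm, sub_sub_sub_cancel_left, norm_sub_rev]
        exact hlip x y⟩
    have hfix : z - r • φ (hcon.fixedPoint _) = hcon.fixedPoint _ := hcon.fixedPoint_isFixedPt
    refine ⟨hcon.fixedPoint _, ?_, ?_⟩
    · by_contra h
      rw [hzero _ h, smul_zero, sub_zero] at hfix
      exact h (hfix ▸ hz)
    · exact (sub_eq_iff_eq_add.1 hfix).symm
  · exact (contDiff_id.add (hφ.smooth.const_smul r)).contDiffOn
  · rw [(hasFDerivAt_id_add_smul hφ r x).fderiv]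
    refine hball ?_
    rw [dist_zero_right, norm_smul, Real.norm_eq_abs]
    exact ((mul_le_mul_of_nonneg_left (norm_fderiv_le_of_lipschitz ℝ hC) (abs_nonneg r)).trans_lt
      hr').trans_le (min_le_right _ _)

theorem IsDiffeo.comp {f g : E3 → E3} (hΩ : IsOpen Ω) (hf : IsDiffeo Ω f) (hg : IsDiffeo Ω g) :
    IsDiffeo Ω fun x => f (g x) := by
  refine ⟨hf.bijOn.comp hg.bijOn, hf.smooth.comp hg.smooth hg.bijOn.mapsTo, fun x hx => ?_⟩
  have hgx := hg.bijOn.mapsTo hx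
  have h : HasFDerivAt (fun x => f (g x)) _ x :=
    (hf.differentiableAt hΩ hgx).hasFDerivAt.comp x (hg.differentiableAt hΩ hx).hasFDerivAt
  have h2 : ((fderiv ℝ f (g x)).comp (fderiv ℝ g x)).det =
      (fderiv ℝ f (g x)).det * (fderiv ℝ g x).det := LinearMap.det_comp _ _
  rw [h.fderiv, h2]
  exact mul_pos (hf.jacobian_pos _ hgx) (hg.jacobian_pos x hx)

/-- The deformation of a motion along a test field, localised in time. -/
def displacement (γ : ℝ → E3 → E3) (χ : ℝ → ℝ) (φ : E3 → E3) (s t : ℝ) (y : E3) : E3 :=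
  γ t y + (s * χ t) • φ (γ t y)

/-- The straight displacement x + sχφ(x) preserves volume only to first order in s, since its
Jacobian has derivative χ div φ = 0. That is exactly what tangency requires, so the flow of φ is not
needed. -/
theorem exists_isVariation_displacement (hΩ : IsOpen Ω) (hγ : IsMotion Ω T₀ γ)
    (hφ : IsTestField Ω φ) (hdiv : ∀ x, divergence φ x = 0) {χ : ℝ → ℝ} (hχ : ContDiff ℝ ∞ χ)
    (hχc : HasCompactSupport χ) (hχT : tsupport χ ⊆ Ioo 0 T₀) :
    ∃ δ, IsVariation Ω T₀ γ (displacement γ χ φ) δ := by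
  obtain ⟨ε, hε, hdiffeo⟩ := hφ.exists_isDiffeo
  obtain ⟨M, hM⟩ := hχc.exists_bound_of_continuous hχ.continuous
  have hM0 : 0 ≤ M := (norm_nonneg _).trans (hM 0)
  have hsmall : ∀ s ∈ Ioo (-(ε / (M + 1))) (ε / (M + 1)), ∀ t, |s * χ t| < ε := by
    intro s hs t
    have h1 : |s| < ε / (M + 1) := abs_lt.2 hs
    rw [lt_div_iff₀ (by positivity)] at h1
    have h2 := hM t
    rw [Real.norm_eq_abs] at h2
    rw [abs_mul]
    nlinarith [abs_nonneg s, mul_le_mul_of_nonneg_left h2 (abs_nonneg s)]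
  have hcomp : ∀ s t, displacement γ χ φ s t = fun y => (fun x => x + (s * χ t) • φ x) (γ t y) :=
    fun s t => rfl
  refine ⟨ε / (M + 1), by positivity, ?_, ?_, ?_, ?_, ?_⟩
  · have hg : ContDiffOn ℝ ∞ (fun z : ℝ × ℝ × E3 => γ z.2.1 z.2.2)
        (Ioo (-(ε / (M + 1))) (ε / (M + 1)) ×ˢ (Ioo 0 T₀ ×ˢ Ω)) :=
      contDiffOn_eulerian_snd hγ.smooth
    exact hg.add ((contDiff_fst.mul (hχ.comp (contDiff_fst.comp contDiff_snd))).contDiffOn.smul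
      (hφ.smooth.comp_contDiffOn hg))
  · intro s hs t ht
    rw [hcomp]
    exact (hdiffeo _ (hsmall s hs t)).comp hΩ (hγ.diffeo t ht)
  · intro t _ y _
    simp [displacement]
  · refine ⟨(fun z : ℝ × E3 => (z.1, label Ω γ z.1 z.2)) '' (tsupport χ ×ˢ tsupport φ), ?_, ?_, ?_⟩
    · exact (hχc.isCompact.prod hφ.compact.isCompact).image_of_continuousOn
        (continuousOn_fst.prodMk ((hγ.label_contDiffOn hΩ).continuousOn.mono
          (prod_mono hχT hφ.support)))
    · rintro _ ⟨z, hz, rfl⟩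
      exact hγ.mapsTo_label (prod_mono hχT hφ.support hz)
    · intro s _ t ht y hy hmem
      have h1 : χ t = 0 ∨ φ (γ t y) = 0 := by
        by_contra! h
        exact hmem ⟨(t, γ t y), ⟨subset_tsupport _ h.1, subset_tsupport _ h.2⟩,
          Prod.ext rfl (label_apply (hγ.diffeo t ht) hy)⟩
      rcases h1 with h1 | h1 <;> simp [displacement, h1]
  · intro t ht y hy
    have hdet : ∀ s, (fderiv ℝ (displacement γ χ φ s t) y).det =
        (ContinuousLinearMap.id ℝ E3 + (s * χ t) • fderiv ℝ φ (γ t y)).det := by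
      intro s
      have h : HasFDerivAt (displacement γ χ φ s t) _ y :=
        (hasFDerivAt_id_add_smul hφ (s * χ t) (γ t y)).comp y
          ((hγ.diffeo t ht).differentiableAt hΩ hy).hasFDerivAt
      have h2 : ((ContinuousLinearMap.id ℝ E3 + (s * χ t) • fderiv ℝ φ (γ t y)).comp
          (fderiv ℝ (γ t) y)).det =
          (ContinuousLinearMap.id ℝ E3 + (s * χ t) • fderiv ℝ φ (γ t y)).det *
            (fderiv ℝ (γ t) y).det := LinearMap.det_comp _ _
      rw [h.fderiv, h2, hγ.jacobian_eq_one t ht y hy, mul_one]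
    simp only [hdet]
    have hM' : HasDerivAt (fun s : ℝ => ContinuousLinearMap.id ℝ E3 +
        (s * χ t) • fderiv ℝ φ (γ t y)) (χ t • fderiv ℝ φ (γ t y)) 0 := by
      have h1 : HasDerivAt (fun s : ℝ => s * χ t) (χ t) 0 := by
        simpa using (hasDerivAt_id (0 : ℝ)).mul_const (χ t)
      exact (h1.smul_const (fderiv ℝ φ (γ t y))).const_add _
    refine (hasDerivAt_det_of_eq_id hM' (by
      rw [zero_mul]; exact add_eq_left.2 (zero_smul ℝ (fderiv ℝ φ (γ t y))))).congr_deriv ?_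
    have h3 := hdiv (γ t y)
    rw [divergence] at h3
    simp only [smul_apply, PiLp.smul_apply, ← Finset.smul_sum, h3, smul_zero]

theorem variationField_displacement (hγ : IsMotion Ω T₀ γ) (χ : ℝ → ℝ) (φ : E3 → E3) {t : ℝ}
    (ht : t ∈ Ioo 0 T₀) {x : E3} (hx : x ∈ Ω) :
    variationField Ω γ (displacement γ χ φ) t x = χ t • φ x := by
  have h1 : HasDerivAt (fun s : ℝ => s * χ t) (χ t) 0 := by
    simpa using (hasDerivAt_id (0 : ℝ)).mul_const (χ t)
  have h2 := (h1.smul_const (φ x)).const_add x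
  rw [variationField]
  simp only [flowMap, displacement, apply_label (hγ.diffeo t ht) hx]
  exact h2.deriv

theorem workDensity_displacement (hΩ : IsOpen Ω) (hγ : IsMotion Ω T₀ γ) (hφ : IsTestField Ω φ)
    (χ : ℝ → ℝ) {ρ σ : Fin 3 → ℝ} {t : ℝ} (ht : t ∈ Ioo 0 T₀) {x : E3} (hx : x ∈ Ω) :
    workDensity Ω ξ ρ σ γ t (variationField Ω γ (displacement γ χ φ) t) x =
      χ t * workDensity Ω ξ ρ σ γ t φ x := by
  have h1 : variationField Ω γ (displacement γ χ φ) t =ᶠ[𝓝 x] fun x => χ t • φ x := by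
    filter_upwards [hΩ.mem_nhds hx] with z hz
    exact variationField_displacement hγ χ φ ht hz
  have h2 : fderiv ℝ (fun x => χ t • φ x) x = χ t • fderiv ℝ φ x :=
    ((hφ.smooth.differentiable (by simp) x).hasFDerivAt.const_smul (χ t)).fderiv
  rw [workDensity, workDensity, h1.fderiv_eq, h1.eq_of_nhds, h2, inner_smul_right, mul_add,
    Finset.mul_sum]
  simp only [Finset.mul_sum, smul_apply, PiLp.smul_apply, smul_eq_mul]
  congr 1
  exact Finset.sum_congr rfl fun i _ => Finset.sum_congr rfl fun j _ => by ring

/-- The virtual work of a stationary motion vanishes at every time. -/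
theorem IsStationary.integral_workDensity_eq_zero (hΩ : IsOpen Ω) (hvol : volume Ω ≠ ⊤)
    (hγ : IsMotion Ω T₀ γ) (hξ : ∀ a, ContDiffOn ℝ ∞ (ξ a) Ω)
    (hξ_nonneg : ∀ a, ∀ x ∈ Ω, 0 ≤ ξ a x) (hξ_sum : ∀ x ∈ Ω, ∑ a, ξ a x = 1)
    {ρ σ p₀ : Fin 3 → ℝ}
    (hkin : IntegrableOn (fun z : ℝ × E3 => kinetic Ω ξ ρ γ z.1 z.2) (Ioo 0 T₀ ×ˢ Ω))
    (hsurf : ∀ a, IntegrableOn (fun z : ℝ × E3 => gradNorm Ω ξ γ a z.1 z.2) (Ioo 0 T₀ ×ˢ Ω))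
    (hst : IsStationary Ω T₀ (wallAction Ω T₀ ξ ρ σ p₀) γ)
    (hφ : IsTestField Ω φ) (hdiv : ∀ x, divergence φ x = 0) {t : ℝ} (ht : t ∈ Ioo 0 T₀) :
    ∫ x in Ω, workDensity Ω ξ ρ σ γ t φ x = 0 := by
  -- Cut-offs χ in time localise: the fundamental lemma gives zero virtual work for almost every t,
  -- and continuity in t extends this to every t.
  have hc := continuousOn_integral_workDensity (σ := σ) hΩ hγ hξ ρ hφ
  have hae := isOpen_Ioo.ae_eq_zero_of_integral_contDiff_smul_eq_zero (μ := volume)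
    (hc.locallyIntegrableOn measurableSet_Ioo) fun χ hχ hχc hχT => by
      obtain ⟨δ, hΓ⟩ := exists_isVariation_displacement hΩ hγ hφ hdiv hχ hχc hχT
      have h1 := hasDerivAt_wallAction hΩ hvol hγ hξ hξ_nonneg hξ_sum σ p₀ hkin hsurf hΓ
      have h2 := neg_eq_zero.1 (h1.unique (hst _ _ hΓ))
      rw [← h2, ← setIntegral_eq_integral_of_forall_compl_eq_zero (s := Ioo 0 T₀) fun t ht => by
        rw [image_eq_zero_of_notMem_tsupport fun h => ht (hχT h), zero_smul]]
      refine setIntegral_congr_fun measurableSet_Ioo fun t ht => ?_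
      rw [smul_eq_mul, ← integral_const_mul]
      exact setIntegral_congr_fun hΩ.measurableSet fun x hx =>
        (workDensity_displacement hΩ hγ hφ χ ht hx).symm
  exact Measure.eqOn_open_of_ae_eq ((ae_restrict_iff' measurableSet_Ioo).2 hae) isOpen_Ioo hc
    continuousOn_const ht

theorem isStationary_iff (hΩ : IsOpen Ω) (hΩc : IsConnected Ω) (hvol : volume Ω ≠ ⊤)
    (hγ : IsMotion Ω T₀ γ) (hξ : ∀ a, ContDiffOn ℝ ∞ (ξ a) Ω)
    (hξ_nonneg : ∀ a, ∀ x ∈ Ω, 0 ≤ ξ a x) (hξ_sum : ∀ x ∈ Ω, ∑ a, ξ a x = 1)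
    (ρ σ p₀ : Fin 3 → ℝ)
    (hkin : IntegrableOn (fun z : ℝ × E3 => kinetic Ω ξ ρ γ z.1 z.2) (Ioo 0 T₀ ×ˢ Ω))
    (hsurf : ∀ a, IntegrableOn (fun z : ℝ × E3 => gradNorm Ω ξ γ a z.1 z.2) (Ioo 0 T₀ ×ˢ Ω)) :
    IsStationary Ω T₀ (wallAction Ω T₀ ξ ρ σ p₀) γ ↔
      ∃ p, SolvesEquationOfMotion Ω T₀ ξ ρ σ γ p :=
  ⟨fun hst => exists_solvesEquationOfMotion hΩ hΩc hγ hξ ρ fun _ hφ hdiv _ ht =>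
    hst.integral_workDensity_eq_zero hΩ hvol hγ hξ hξ_nonneg hξ_sum hkin hsurf hφ hdiv ht,
  fun ⟨_, hp⟩ => hp.isStationary hΩ hvol hγ hξ hξ_nonneg hξ_sum p₀ hkin hsurf⟩

end

/-! ### Algebra of the tension coefficients -/

theorem properTension_add {σ : Fin 3 → Fin 3 → ℝ} (hσ : ∀ a b, σ a b = σ b a) {a b : Fin 3}
    (hab : a ≠ b) : σ a b = properTension σ a + properTension σ b := by
  have h01 := hσ 0 1
  have h02 := hσ 0 2
  have h12 := hσ 1 2
  have e1 : (1 : Fin 3) + 1 = 2 := rfl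
  have e2 : (1 : Fin 3) + 2 = 0 := rfl
  have e3 : (2 : Fin 3) + 1 = 0 := rfl
  have e4 : (2 : Fin 3) + 2 = 1 := rfl
  fin_cases a <;> fin_cases b <;> simp only [ne_eq, not_true_eq_false] at hab <;>
    simp [properTension, e1, e2, e3, e4] <;> linarith

/-- The difference of the surface energy densities of the symmetric and of the multiphase action,
in terms of `gₐ = |∇ξₐ|` and `xₐ = ξₐ`. -/
def surfaceDefect (σ : Fin 3 → Fin 3 → ℝ) (g x : Fin 3 → ℝ) : ℝ :=
  ∑ a, properTension σ a * g a - ∑ a : Fin 3, ∑ b ∈ Finset.univ.filter (fun b : Fin 3 => b < a),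
    σ a b * √(g a * g b) * (x a + x b)

/-- Substituting σ_ab = σ_a + σ_b isolates the coefficient of each proper tension: g_a minus the two
mixed terms that involve phase a. -/
theorem surfaceDefect_eq {σ : Fin 3 → Fin 3 → ℝ} (hσ : ∀ a b, σ a b = σ b a) (g x : Fin 3 → ℝ) :
    surfaceDefect σ g x =
      properTension σ 0 * (g 0 - (√(g 1 * g 0) * (x 1 + x 0) + √(g 2 * g 0) * (x 2 + x 0))) +
      properTension σ 1 * (g 1 - (√(g 1 * g 0) * (x 1 + x 0) + √(g 2 * g 1) * (x 2 + x 1))) +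
      properTension σ 2 * (g 2 - (√(g 2 * g 0) * (x 2 + x 0) + √(g 2 * g 1) * (x 2 + x 1))) := by
  have h10 := properTension_add hσ (show (1 : Fin 3) ≠ 0 by decide)
  have h20 := properTension_add hσ (show (2 : Fin 3) ≠ 0 by decide)
  have h21 := properTension_add hσ (show (2 : Fin 3) ≠ 1 by decide)
  have e1 : ¬ (1 : Fin 3) < 0 := by decide
  have e2 : (1 : Fin 3) < 2 := by decide
  have e3 : ¬ (2 : Fin 3) < 1 := by decide
  have e4 : (0 : Fin 3) < 1 := by decide
  have e5 : (0 : Fin 3) < 2 := by decide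
  have e6 : ¬ (2 : Fin 3) < 0 := by decide
  simp only [surfaceDefect, Finset.sum_filter, Fin.sum_univ_three, lt_irrefl, if_true, if_false, e1,
    e2, e3, e4, e5, e6, h10, h20, h21]
  ring

theorem sqrt_mul_le_half_add {u v : ℝ} (hu : 0 ≤ u) (hv : 0 ≤ v) : √(u * v) ≤ (u + v) / 2 := by
  rw [Real.sqrt_le_left (by positivity)]
  nlinarith [sq_nonneg (u - v)]

/-- Each mixed term lies between 0 and (g_a + g_b)/2, as x_a + x_b ≤ 1. Hence each bracket of
`surfaceDefect_eq` is at most g_0 + g_1 + g_2 in absolute value. -/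
theorem abs_surfaceDefect_le {σ : Fin 3 → Fin 3 → ℝ} (hσ : ∀ a b, σ a b = σ b a) {g x : Fin 3 → ℝ}
    (hg : ∀ a, 0 ≤ g a) (hx : ∀ a, 0 ≤ x a) (hsum : ∑ a, x a = 1) :
    |surfaceDefect σ g x| ≤ (∑ a, |properTension σ a|) * ∑ a, g a := by
  rw [Fin.sum_univ_three] at hsum
  have hs : ∀ a b, a ≠ b → x a + x b ≤ 1 → 0 ≤ √(g a * g b) * (x a + x b) ∧
      √(g a * g b) * (x a + x b) ≤ (g a + g b) / 2 := fun a b _ h => by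
    have h1 := sqrt_mul_le_half_add (hg a) (hg b)
    have h2 := Real.sqrt_nonneg (g a * g b)
    have h3 := add_nonneg (hx a) (hx b)
    exact ⟨mul_nonneg h2 h3, by nlinarith⟩
  have h10 := hs 1 0 (by decide) (by linarith [hx 2])
  have h20 := hs 2 0 (by decide) (by linarith [hx 1])
  have h21 := hs 2 1 (by decide) (by linarith [hx 0])
  have hb : ∀ c q : ℝ, |q| ≤ g 0 + g 1 + g 2 → |c * q| ≤ |c| * (g 0 + g 1 + g 2) := fun c q h => by
    rw [abs_mul]; exact mul_le_mul_of_nonneg_left h (abs_nonneg c)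
  rw [surfaceDefect_eq hσ, Fin.sum_univ_three, Fin.sum_univ_three, add_mul, add_mul]
  refine (abs_add_three _ _ _).trans (add_le_add (add_le_add (hb _ _ ?_) (hb _ _ ?_)) (hb _ _ ?_))
  all_goals
    rw [abs_le]
    constructor <;> linarith [hg 0, hg 1, hg 2, h10.1, h10.2, h20.1, h20.2, h21.1, h21.2]

/-- There is no defect where one of the phases is absent. -/
theorem surfaceDefect_eq_zero {σ : Fin 3 → Fin 3 → ℝ} (hσ : ∀ a b, σ a b = σ b a) {g x : Fin 3 → ℝ}
    (hg : ∀ a, 0 ≤ g a) (hsum : ∑ a, x a = 1) {c : Fin 3} (hgc : g c = 0) (hxc : x c = 0)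
    (hgg : ∀ a b, a ≠ c → b ≠ c → g a = g b) : surfaceDefect σ g x = 0 := by
  rw [surfaceDefect_eq hσ]
  rw [Fin.sum_univ_three] at hsum
  -- Mixed terms with the absent phase vanish. The remaining one is √(g·g) · 1 = g and cancels the
  -- gradient terms of both present phases.
  have hsq : ∀ a, √(g a * g a) = g a := fun a => Real.sqrt_mul_self (hg a)
  fin_cases c
  · have h := hgg 2 1 (by decide) (by decide)
    simp only [Fin.zero_eta] at hgc hxc
    have h2 : x 2 + x 1 = 1 := by linarith
    rw [h, hsq, h2, hgc]
    simp
  · have h := hgg 2 0 (by decide) (by decide)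
    simp only [Fin.mk_one] at hgc hxc
    have h2 : x 2 + x 0 = 1 := by linarith
    rw [h, hsq, h2, hgc]
    simp
  · have h := hgg 1 0 (by decide) (by decide)
    simp only [Fin.reduceFinMk] at hgc hxc
    have h2 : x 1 + x 0 = 1 := by linarith
    rw [h, hsq, h2, hgc]
    simp

/-! ### Comparison of the actions -/

section
variable {Ω : Set E3} {T₀ : ℝ} {γ : ℝ → E3 → E3} {ξ : Fin 3 → E3 → ℝ}

theorem _root_.Filter.EventuallyEq.gradient_eq_of_nhds {f g : E3 → ℝ} {x : E3} (h : f =ᶠ[𝓝 x] g) :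
    gradient f x = gradient g x := by
  rw [gradient, gradient, h.fderiv_eq]

/-- The support of a transported function is carried by the motion. -/
theorem mem_closure_transported_iff (hΩ : IsOpen Ω) (hγ : IsMotion Ω T₀ γ) (f : E3 → ℝ) {t : ℝ}
    (ht : t ∈ Ioo 0 T₀) {x : E3} (hx : x ∈ Ω) :
    x ∈ closure {x ∈ Ω | transported Ω γ f t x ≠ 0} ↔
      label Ω γ t x ∈ closure {y ∈ Ω | f y ≠ 0} := by
  have hd := hγ.diffeo t ht
  have hl := label_mem hd hx
  constructor
  · intro h
    exact ((det_fderiv_label hΩ hγ ht hx).1.continuousAt.continuousWithinAt).mem_closure h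
      fun z hz => ⟨label_mem hd hz.1, hz.2⟩
  · intro h
    have h1 := ((hd.differentiableAt hΩ hl).continuousAt.continuousWithinAt).mem_closure h
      (t := {x ∈ Ω | transported Ω γ f t x ≠ 0}) fun z hz => ⟨hd.bijOn.mapsTo hz.1, by
        rw [transported_apply f hd hz.1]; exact hz.2⟩
    rwa [apply_label hd hx] at h1

theorem measurableSet_tripleRegion (hΩ : IsOpen Ω) (t : ℝ) :
    MeasurableSet (tripleRegion Ω ξ γ t) :=
  hΩ.measurableSet.inter (MeasurableSet.iInter fun _ => isClosed_closure.measurableSet)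

/-- Supports are carried by the motion, so in space-time the region is the preimage, under the
continuous label map, of a closed set of labels. -/
theorem measurableSet_tripleRegion_spaceTime (hΩ : IsOpen Ω) (hγ : IsMotion Ω T₀ γ) :
    MeasurableSet {z : ℝ × E3 | z ∈ Ioo 0 T₀ ×ˢ Ω ∧ z.2 ∈ tripleRegion Ω ξ γ z.1} := by
  have hW := IsMotion.isOpen_domain hΩ T₀
  have hC : IsClosed (⋂ a : Fin 3, closure {y ∈ Ω | ξ a y ≠ 0}) :=
    isClosed_iInter fun _ => isClosed_closure
  have ho := (hγ.label_contDiffOn hΩ).continuousOn.isOpen_inter_preimage hW hC.isOpen_compl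
  convert hW.measurableSet.diff ho.measurableSet using 1
  ext z
  constructor
  · rintro ⟨hz, hzt⟩
    refine ⟨hz, fun h => h.2 (mem_iInter.2 fun a => ?_)⟩
    exact (mem_closure_transported_iff hΩ hγ (ξ a) hz.1 hz.2).1 (mem_iInter.1 hzt.2 a)
  · rintro ⟨hz, h⟩
    refine ⟨hz, hz.2, mem_iInter.2 fun a => ?_⟩
    refine (mem_closure_transported_iff hΩ hγ (ξ a) hz.1 hz.2).2 ?_
    by_contra hn
    exact h ⟨hz, fun hm => hn (mem_iInter.1 hm a)⟩

/-- Off the region some phase c vanishes in a whole neighbourhood, so its gradient vanishes too. The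
other two satisfy ξ_a = 1 - ξ_b there and have gradients of equal length. -/
theorem surfaceDefect_eq_zero_of_notMem_tripleRegion (hΩ : IsOpen Ω) (hγ : IsMotion Ω T₀ γ)
    (hξ_sum : ∀ x ∈ Ω, ∑ a, ξ a x = 1) {σ : Fin 3 → Fin 3 → ℝ} (hσ : ∀ a b, σ a b = σ b a)
    {t : ℝ} (ht : t ∈ Ioo 0 T₀) {x : E3} (hx : x ∈ Ω) (hxt : x ∉ tripleRegion Ω ξ γ t) :
    surfaceDefect σ (fun a => gradNorm Ω ξ γ a t x) (fun a => transported Ω γ (ξ a) t x) = 0 := by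
  have hd := hγ.diffeo t ht
  obtain ⟨c, hc⟩ : ∃ c, x ∉ closure {x ∈ Ω | transported Ω γ (ξ c) t x ≠ 0} := by
    by_contra! h
    exact hxt ⟨hx, mem_iInter.2 h⟩
  have hz : ∀ᶠ z in 𝓝 x, z ∈ Ω ∧ transported Ω γ (ξ c) t z = 0 := by
    filter_upwards [hΩ.mem_nhds hx, isClosed_closure.isOpen_compl.mem_nhds hc] with z h1 h2
    refine ⟨h1, ?_⟩
    by_contra h
    exact h2 (subset_closure ⟨h1, h⟩)
  refine surfaceDefect_eq_zero hσ (fun a => norm_nonneg _) (hξ_sum _ (label_mem hd hx)) (c := c)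
    ?_ hz.self_of_nhds.2 fun a b ha hb => ?_
  · have h1 : transported Ω γ (ξ c) t =ᶠ[𝓝 x] fun _ => (0 : ℝ) := hz.mono fun z h => h.2
    rw [gradNorm, h1.gradient_eq_of_nhds, gradient_fun_const, norm_zero]
  · rcases eq_or_ne a b with rfl | hab
    · rfl
    have h1 : transported Ω γ (ξ a) t =ᶠ[𝓝 x] fun z => 1 - transported Ω γ (ξ b) t z := by
      filter_upwards [hz] with z h
      have h2 := hξ_sum _ (label_mem hd h.1)
      have h3 := h.2
      rw [transported] at h3 ⊢
      rw [transported]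
      rw [Fin.sum_univ_three] at h2
      fin_cases a <;> fin_cases b <;> fin_cases c <;> simp_all <;> linarith
    simp only [gradNorm]
    rw [h1.gradient_eq_of_nhds, gradient, gradient, fderiv_const_sub, map_neg, norm_neg]

theorem integrableOn_surfaceDefect (hΩ : IsOpen Ω) (hγ : IsMotion Ω T₀ γ)
    (hξ : ∀ a, ContDiffOn ℝ ∞ (ξ a) Ω) (hξ_nonneg : ∀ a, ∀ x ∈ Ω, 0 ≤ ξ a x)
    (hξ_sum : ∀ x ∈ Ω, ∑ a, ξ a x = 1) {σ : Fin 3 → Fin 3 → ℝ} (hσ : ∀ a b, σ a b = σ b a)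
    (hsurf : ∀ a, IntegrableOn (fun z : ℝ × E3 => gradNorm Ω ξ γ a z.1 z.2) (Ioo 0 T₀ ×ˢ Ω)) :
    IntegrableOn (fun z : ℝ × E3 => surfaceDefect σ (fun a => gradNorm Ω ξ γ a z.1 z.2)
      (fun a => transported Ω γ (ξ a) z.1 z.2)) (Ioo 0 T₀ ×ˢ Ω) := by
  have hW := (IsMotion.isOpen_domain hΩ T₀).measurableSet
  have hg : ∀ a, ContinuousOn (fun z : ℝ × E3 => gradNorm Ω ξ γ a z.1 z.2) (Ioo 0 T₀ ×ˢ Ω) :=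
    fun a => (hγ.gradient_contDiffOn hΩ (hξ a)).continuousOn.norm
  have hx := fun a => (hγ.transported_contDiffOn hΩ (hξ a)).continuousOn
  refine Integrable.mono' (((integrable_finsetSum Finset.univ fun a _ => hsurf a)).const_mul
    (∑ a, |properTension σ a|)) (ContinuousOn.aestronglyMeasurable ?_ hW) ?_
  · exact (continuousOn_finsetSum _ fun a _ => continuousOn_const.mul (hg a)).sub
      (continuousOn_finsetSum _ fun a _ => continuousOn_finsetSum _ fun b _ =>
        (continuousOn_const.mul ((hg a).mul (hg b)).sqrt).mul ((hx a).add (hx b)))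
  · filter_upwards [ae_restrict_mem hW] with z hz
    have hl := label_mem (hγ.diffeo _ hz.1) hz.2
    exact abs_surfaceDefect_le hσ (fun a => norm_nonneg _) (fun a => hξ_nonneg a _ hl)
      (hξ_sum _ hl)

/-- The multiphase action differs from the symmetric one only through the triple junctions. -/
theorem abs_multiAction_sub_triAction_le (hΩ : IsOpen Ω) (hvol : volume Ω ≠ ⊤)
    (hγ : IsMotion Ω T₀ γ) (hξ : ∀ a, ContDiffOn ℝ ∞ (ξ a) Ω)
    (hξ_nonneg : ∀ a, ∀ x ∈ Ω, 0 ≤ ξ a x) (hξ_sum : ∀ x ∈ Ω, ∑ a, ξ a x = 1)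
    {ρ : Fin 3 → ℝ} (p : Fin 3 → ℝ) {σ : Fin 3 → Fin 3 → ℝ} (hσ : ∀ a b, σ a b = σ b a)
    (hkin : IntegrableOn (fun z : ℝ × E3 => kinetic Ω ξ ρ γ z.1 z.2) (Ioo 0 T₀ ×ˢ Ω))
    (hsurf : ∀ a, IntegrableOn (fun z : ℝ × E3 => gradNorm Ω ξ γ a z.1 z.2) (Ioo 0 T₀ ×ˢ Ω)) :
    |multiAction Ω T₀ ξ ρ σ p γ - triAction Ω T₀ ξ ρ (properTension σ) p γ| ≤
      (∑ a, |properTension σ a|) *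
        ∫ t in Ioo 0 T₀, ∫ x in tripleRegion Ω ξ γ t, ∑ a, gradNorm Ω ξ γ a t x := by
  have hW := (IsMotion.isOpen_domain hΩ T₀).measurableSet
  have hD := integrableOn_surfaceDefect hΩ hγ hξ hξ_nonneg hξ_sum hσ hsurf
  set D := fun z : ℝ × E3 => surfaceDefect σ (fun a => gradNorm Ω ξ γ a z.1 z.2)
      (fun a => transported Ω γ (ξ a) z.1 z.2) with hDdef
  have htri := integrableOn_phaseDensity hΩ hvol hγ hξ hξ_nonneg hξ_sum (properTension σ) p hkin
    hsurf Finset.univ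
  set τ := fun z : ℝ × E3 => kinetic Ω ξ ρ γ z.1 z.2 - ∑ a, (properTension σ a *
    gradNorm Ω ξ γ a z.1 z.2 - p a * transported Ω γ (ξ a) z.1 z.2) with hτ
  have h1 : triAction Ω T₀ ξ ρ (properTension σ) p γ = ∫ z in Ioo 0 T₀ ×ˢ Ω, τ z := by
    rw [Measure.volume_eq_prod, setIntegral_prod _ htri]
    rfl
  have h2 : multiAction Ω T₀ ξ ρ σ p γ = ∫ z in Ioo 0 T₀ ×ˢ Ω, (τ z + D z) := by
    rw [Measure.volume_eq_prod, setIntegral_prod (fun z => τ z + D z) (htri.add hD), multiAction]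
    refine integral_congr_ae (ae_of_all _ fun t => integral_congr_ae (ae_of_all _ fun x => ?_))
    simp only [hτ, hDdef, surfaceDefect, Finset.sum_sub_distrib]
    ring
  -- The bound is first taken on space-time, where the defect is dominated by G on R and is zero
  -- elsewhere, and then sliced in time.
  set R := {z : ℝ × E3 | z ∈ Ioo 0 T₀ ×ˢ Ω ∧ z.2 ∈ tripleRegion Ω ξ γ z.1} with hR
  set G := fun z : ℝ × E3 => (∑ a, |properTension σ a|) * ∑ a, gradNorm Ω ξ γ a z.1 z.2 with hG
  have hGi : IntegrableOn G (Ioo 0 T₀ ×ˢ Ω) :=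
    (integrable_finsetSum Finset.univ fun a _ => hsurf a).const_mul _
  have hRG : IntegrableOn (R.indicator G) (Ioo 0 T₀ ×ˢ Ω) :=
    hGi.indicator (measurableSet_tripleRegion_spaceTime hΩ hγ)
  have h3 : ∀ z ∈ Ioo 0 T₀ ×ˢ Ω, ‖D z‖ ≤ R.indicator G z := by
    intro z hz
    have hl := label_mem (hγ.diffeo _ hz.1) hz.2
    by_cases hzR : z ∈ R
    · rw [indicator_of_mem hzR]
      exact abs_surfaceDefect_le hσ (fun a => norm_nonneg _) (fun a => hξ_nonneg a _ hl)
        (hξ_sum _ hl)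
    · rw [indicator_of_notMem hzR, hDdef]
      simp only
      rw [surfaceDefect_eq_zero_of_notMem_tripleRegion hΩ hγ hξ_sum hσ hz.1 hz.2
        fun h => hzR ⟨hz, h⟩, norm_zero]
  rw [h1, h2, integral_add htri hD, add_sub_cancel_left, ← integral_const_mul]
  calc |∫ z in Ioo 0 T₀ ×ˢ Ω, D z| ≤ ∫ z in Ioo 0 T₀ ×ˢ Ω, ‖D z‖ :=
        norm_integral_le_integral_norm (μ := volume.restrict (Ioo 0 T₀ ×ˢ Ω)) D
    _ ≤ ∫ z in Ioo 0 T₀ ×ˢ Ω, R.indicator G z := setIntegral_mono_on hD.norm hRG hW h3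
    _ = ∫ t in Ioo 0 T₀, (∑ a, |properTension σ a|) *
          ∫ x in tripleRegion Ω ξ γ t, ∑ a, gradNorm Ω ξ γ a t x := by
      rw [Measure.volume_eq_prod, setIntegral_prod _ hRG]
      refine setIntegral_congr_fun measurableSet_Ioo fun t ht => ?_
      have h4 : ∫ x in Ω, R.indicator G (t, x) =
          ∫ x in Ω, (tripleRegion Ω ξ γ t).indicator (fun x => G (t, x)) x := by
        refine setIntegral_congr_fun hΩ.measurableSet fun x hx => ?_
        by_cases hxt : x ∈ tripleRegion Ω ξ γ t
        · rw [indicator_of_mem hxt, indicator_of_mem (show (t, x) ∈ R from ⟨⟨ht, hx⟩, hxt⟩)]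
        · rw [indicator_of_notMem hxt, indicator_of_notMem fun h => hxt h.2]
      have h5 : Ω ∩ tripleRegion Ω ξ γ t = tripleRegion Ω ξ γ t :=
        inter_eq_right.2 inter_subset_left
      rw [h4, setIntegral_indicator (measurableSet_tripleRegion hΩ t), h5, ← integral_const_mul]

/-- If the wall is fixed, the symmetric action and the action with a wall differ by a constant. -/
theorem triAction_eq_wallAction_sub (hΩ : IsOpen Ω) (hvol : volume Ω ≠ ⊤) (hT : 0 < T₀)
    (hγ : IsMotion Ω T₀ γ) (hξ : ∀ a, ContDiffOn ℝ ∞ (ξ a) Ω)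
    (hξ_nonneg : ∀ a, ∀ x ∈ Ω, 0 ≤ ξ a x) (hξ_sum : ∀ x ∈ Ω, ∑ a, ξ a x = 1)
    (hwall : ∀ t ∈ Ioo 0 T₀, ∀ y ∈ Ω, ξ 0 (γ t y) = ξ 0 y)
    {ρ : Fin 3 → ℝ} (σ p : Fin 3 → ℝ)
    (hkin : IntegrableOn (fun z : ℝ × E3 => kinetic Ω ξ ρ γ z.1 z.2) (Ioo 0 T₀ ×ˢ Ω))
    (hsurf : ∀ a, IntegrableOn (fun z : ℝ × E3 => gradNorm Ω ξ γ a z.1 z.2) (Ioo 0 T₀ ×ˢ Ω)) :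
    triAction Ω T₀ ξ ρ σ p γ = wallAction Ω T₀ ξ ρ σ p γ -
      T₀ * ∫ x in Ω, (σ 0 * ‖gradient (ξ 0) x‖ - p 0 * ξ 0 x) := by
  have hW := (IsMotion.isOpen_domain hΩ T₀).measurableSet
  have htr : ∀ t ∈ Ioo 0 T₀, ∀ x ∈ Ω, transported Ω γ (ξ 0) t x = ξ 0 x := fun t ht x hx => by
    have hd := hγ.diffeo t ht
    rw [transported, ← hwall t ht _ (label_mem hd hx), apply_label hd hx]
  have hgr : ∀ t ∈ Ioo 0 T₀, ∀ x ∈ Ω, gradNorm Ω ξ γ 0 t x = ‖gradient (ξ 0) x‖ :=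
    fun t ht x hx => by
      have h : transported Ω γ (ξ 0) t =ᶠ[𝓝 x] ξ 0 := by
        filter_upwards [hΩ.mem_nhds hx] with z hz
        exact htr t ht z hz
      rw [gradNorm, h.gradient_eq_of_nhds]
  have hi := integrableOn_phaseDensity hΩ hvol hγ hξ hξ_nonneg hξ_sum σ p hkin hsurf {1, 2}
  have h0 : IntegrableOn (fun z : ℝ × E3 => σ 0 * gradNorm Ω ξ γ 0 z.1 z.2 -
      p 0 * transported Ω γ (ξ 0) z.1 z.2) (Ioo 0 T₀ ×ˢ Ω) :=
    ((hsurf 0).const_mul _).sub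
      ((integrableOn_transported hΩ hvol hγ hξ hξ_nonneg hξ_sum 0).const_mul _)
  have hall := integrableOn_phaseDensity hΩ hvol hγ hξ hξ_nonneg hξ_sum σ p hkin hsurf Finset.univ
  have h1 : wallAction Ω T₀ ξ ρ σ p γ = ∫ z in Ioo 0 T₀ ×ˢ Ω, (kinetic Ω ξ ρ γ z.1 z.2 -
      ∑ a ∈ ({1, 2} : Finset (Fin 3)),
        (σ a * gradNorm Ω ξ γ a z.1 z.2 - p a * transported Ω γ (ξ a) z.1 z.2)) := by
    rw [Measure.volume_eq_prod, setIntegral_prod _ hi]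
    rfl
  have h2 : triAction Ω T₀ ξ ρ σ p γ = ∫ z in Ioo 0 T₀ ×ˢ Ω, (kinetic Ω ξ ρ γ z.1 z.2 -
      ∑ a, (σ a * gradNorm Ω ξ γ a z.1 z.2 - p a * transported Ω γ (ξ a) z.1 z.2)) := by
    rw [Measure.volume_eq_prod, setIntegral_prod _ hall]
    rfl
  have h3 : T₀ * ∫ x in Ω, (σ 0 * ‖gradient (ξ 0) x‖ - p 0 * ξ 0 x) =
      ∫ z in Ioo 0 T₀ ×ˢ Ω, (σ 0 * gradNorm Ω ξ γ 0 z.1 z.2 -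
        p 0 * transported Ω γ (ξ 0) z.1 z.2) := by
    rw [Measure.volume_eq_prod, setIntegral_prod _ h0]
    have h4 : ∀ t ∈ Ioo 0 T₀, ∫ x in Ω, (σ 0 * gradNorm Ω ξ γ 0 t x -
        p 0 * transported Ω γ (ξ 0) t x) = ∫ x in Ω, (σ 0 * ‖gradient (ξ 0) x‖ - p 0 * ξ 0 x) :=
      fun t ht => setIntegral_congr_fun hΩ.measurableSet fun x hx => by
        simp only [hgr t ht x hx, htr t ht x hx]
    rw [setIntegral_congr_fun measurableSet_Ioo h4, setIntegral_const, Measure.real,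
      Real.volume_Ioo, sub_zero, ENNReal.toReal_ofReal hT.le, smul_eq_mul]
  rw [h1, h2, h3, ← integral_sub hi h0]
  refine integral_congr_ae (ae_of_all _ fun z => ?_)
  simp only [Fin.sum_univ_three, Finset.sum_pair (by decide : (1 : Fin 3) ≠ 2)]
  ring

end

end
end WallFlow

theorem theorem5p3 (Ω : Set WallFlow.E3) (hΩ : IsOpen Ω) (hΩc : IsConnected Ω)
    (hvol : volume Ω ≠ ⊤) (T₀ : ℝ) (hT : 0 < T₀)
    (ξ : Fin 3 → WallFlow.E3 → ℝ)
    (hξ : ∀ a, ContDiffOn ℝ ∞ (ξ a) Ω)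
    (hξ_nonneg : ∀ a, ∀ x ∈ Ω, 0 ≤ ξ a x)
    (hξ_sum : ∀ x ∈ Ω, ∑ a, ξ a x = 1)
    (ρ p₀ : Fin 3 → ℝ) (σ : Fin 3 → Fin 3 → ℝ) (hσ : ∀ a b, σ a b = σ b a)
    (γ : ℝ → WallFlow.E3 → WallFlow.E3) (hγ : WallFlow.IsMotion Ω T₀ γ)
    (hwall : ∀ t ∈ Ioo 0 T₀, ∀ y ∈ Ω, ξ 0 (γ t y) = ξ 0 y)
    (hkin : IntegrableOn
      (fun z : ℝ × WallFlow.E3 => WallFlow.kinetic Ω ξ ρ γ z.1 z.2) (Ioo 0 T₀ ×ˢ Ω))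
    (hsurf : ∀ a, IntegrableOn
      (fun z : ℝ × WallFlow.E3 => WallFlow.gradNorm Ω ξ γ a z.1 z.2) (Ioo 0 T₀ ×ˢ Ω)) :
    (∀ a b, a ≠ b →
      σ a b = WallFlow.properTension σ a + WallFlow.properTension σ b) ∧
    |WallFlow.multiAction Ω T₀ ξ ρ σ p₀ γ
        - WallFlow.triAction Ω T₀ ξ ρ (WallFlow.properTension σ) p₀ γ|
      ≤ (∑ a, |WallFlow.properTension σ a|) *
        ∫ t in Ioo 0 T₀, ∫ x in WallFlow.tripleRegion Ω ξ γ t,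
          ∑ a, WallFlow.gradNorm Ω ξ γ a t x ∧
    WallFlow.triAction Ω T₀ ξ ρ (WallFlow.properTension σ) p₀ γ
      = WallFlow.wallAction Ω T₀ ξ ρ (WallFlow.properTension σ) p₀ γ
        - T₀ * ∫ x in Ω,
            (WallFlow.properTension σ 0 * ‖gradient (ξ 0) x‖ - p₀ 0 * ξ 0 x) ∧
    (WallFlow.IsStationary Ω T₀
        (WallFlow.wallAction Ω T₀ ξ ρ (WallFlow.properTension σ) p₀) γ ↔
      ∃ p : ℝ → WallFlow.E3 → ℝ,
        WallFlow.SolvesEquationOfMotion Ω T₀ ξ ρ (WallFlow.properTension σ) γ p) := by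
  exact ⟨fun _ _ hab => WallFlow.properTension_add hσ hab,
    WallFlow.abs_multiAction_sub_triAction_le hΩ hvol hγ hξ hξ_nonneg hξ_sum p₀ hσ hkin hsurf,
    WallFlow.triAction_eq_wallAction_sub hΩ hvol hT hγ hξ hξ_nonneg hξ_sum hwall _ p₀ hkin hsurf,
    WallFlow.isStationary_iff hΩ hΩc hvol hγ hξ hξ_nonneg hξ_sum ρ _ p₀ hkin hsurf⟩
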